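/- Fix $p\in(0,1)$ and integer sequences $m=m_n$, $K=K_n$ with $m_n\to\infty$, $m_n=O(\sqrt n)$ and $K_n=O(\sqrt n)$ as $n\to\infty$ (for instance $m=\lfloor\epsilon\sqrt{2n}\rfloor$, $K=\lfloor\epsilon'\sqrt n\rfloor$ with constants $\epsilon,\epsilon'>0$). **Model.** For each $n$ let $V=V'=[n]=\{1,\dots,n\}$ be the two sides of a bipartite Erdős–Rényi graph with planted biclique: start from independent $\mathrm{Ber}(p)$ edge indicators, $(u,v)\in V\times V'$; let $\mathcal A_0=\{1,\dots,K\}\subset V$ and let $\mathcal B_0\subset V'$ be a uniformly random set of size $K$, independent of the edges; set all edges in $\mathcal A_0\times\mathcal B_0$ to be present. Let $\xi_{uv}\in\{0,1\}$ be the resulting edge indicators. **Weights.** For $\mathcal A\subset V$, $\mathcal B\subset V'$ of size $m$ let $$Y(\mathcal A,\mathcal B)=\frac1{p^m m!}\sum_{\sigma\in\mathrm{Bij}(\mathcal A,\mathcal B)}\prod_{u\in\mathcal A}\xi_{u\sigma(u)},$$ and for $i\in V$ let $$W(i)=\frac1{\binom{n-1}{m-1}\binom nm}\sum_{\mathcal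 A\in\binom Vm,\ i\in\mathcal A}\ \sum_{\mathcal B\in\binom{V'}m}Y(\mathcal A,\mathcal B)^2,\qquad Z(i)=W(i)-\mathbb E[W(i)].$$ **Vertices.** Fix integers $0\le\ell_0\le\ell$ and positive integers $i'(1),\dots,i'(\ell)$, possibly with repetitions, such that $i'(j)\le K_n$ for all $j\le\ell_0$ and all large $n$. Put $i(j)=i'(j)$ for $j\le\ell_0$ (vertices in $\mathcal A_0$) and $i(j)=i'(j)+K_n$ for $j>\ell_0$ (vertices outside $\mathcal A_0$). Let $$C^{(n)}_{j,j'}=C_{i(j),i(j')}=4(p^{-1}-1)e^{2(p^{-1}-1)}\left[\mathbb I_{i(j)=i(j')}+\frac{m^2}{n}\right],\qquad j,j'\in[\ell],$$ and let $X^{(n)}$ be a centered Gaussian vector in $\mathbb R^\ell$ with covariance matrix $C^{(n)}$. **Claim.** The vector $\zeta^{(n)}=(\sqrt n\,Z(i(j)))_{j\in[\ell]}$ has asymptotically the same moments of every order as $X^{(n)}$: for all $\alpha\in\mathbb N^\ell$, $$\mathbb E\Big[\prod_{j}(\zeta^{(n)}_j)^{\alpha_j}\Big]-\mathbb E\Big[\prod_{j}(X^{(n)}_j)^{\alpha_j}\Big]\longrightarrow0\qquad(n\to\infty).$$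 Consequently it converges weakly to this Gaussian distribution, in the sense that $\mathbb E[f(\zeta^{(n)})]-\mathbb E[f(X^{(n)})]\to0$ for every bounded continuous $f:\mathbb R^\ell\to\mathbb R$; and if $C^{(n)}$ converges to a matrix $S$ (for example if $m^2/n$ converges), then $\zeta^{(n)}$ converges in distribution to the centered Gaussian law with covariance matrix $S$. -/

import Mathlib

namespace PlantedGBS

open MeasureTheory ProbabilityTheory

/-- The vertex labels `{1, …, n}` of each of the two sides `V` and `V'`. -/
def side (n : ℕ) : Finset ℕ := Finset.Icc 1 n

/-- `Y(A, B) = (p ^ m m!)⁻¹ ∑_{σ ∈ Bij(A, B)} ∏_{u ∈ A} ξ u (σ u)`, for an edge-indicator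
function `ξ`. -/
noncomputable def matchingSum (p : ℝ) (m : ℕ) (ξ : ℕ → ℕ → ℝ) (A B : Finset ℕ) : ℝ :=
  (p ^ m * (m.factorial : ℝ))⁻¹ * ∑ σ : ↥A ≃ ↥B, ∏ u : ↥A, ξ u (σ u)

/-- The weight `W(i)` of a vertex `i` of the left side: the normalized sum of `Y(A, B) ^ 2` over
all `m`-subsets `A ∋ i` of `V` and all `m`-subsets `B` of `V'`. -/
noncomputable def weight (n m : ℕ) (p : ℝ) (ξ : ℕ → ℕ → ℝ) (i : ℕ) : ℝ :=
  (((n - 1).choose (m - 1) : ℝ) * (n.choose m : ℝ))⁻¹ *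
    ∑ A ∈ ((side n).powersetCard m).filter (fun A => i ∈ A),
      ∑ B ∈ (side n).powersetCard m, matchingSum p m ξ A B ^ 2

/-- The data of a bipartite Erdős–Rényi graph `ER(n, n, p)` with a `K × K` planted biclique:
`η u v` tells whether the edge `(u, v)` is present before planting, these are independent
`Ber(p)` variables, and the right side `B₀` of the biclique is a uniformly random `K`-subset of
`V'`, independent of all edges. The left side of the biclique is `{1, …, K}`. -/
structure IsPlantedModel {Ω : Type*} [MeasurableSpace Ω] (P : Measure Ω) (n K : ℕ) (p : ℝ)
    (η : ℕ → ℕ → Ω → Bool) (B₀ : Ω → Finset ℕ) : Prop where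
  measurable_edge : ∀ u ∈ side n, ∀ v ∈ side n, Measurable (η u v)
  bernoulli_edge : ∀ u ∈ side n, ∀ v ∈ side n, P.real {ω | η u v ω = true} = p
  indep_edge : iIndepFun (fun (e : ↥(side n ×ˢ side n)) (ω : Ω) => η e.1.1 e.1.2 ω) P
  measurable_right : Measurable B₀
  uniform_right : ∀ B ∈ (side n).powersetCard K,
    P.real {ω | B₀ ω = B} = ((n.choose K : ℕ) : ℝ)⁻¹
  indep_right : IndepFun (fun (ω : Ω) (e : ↥(side n ×ˢ side n)) => η e.1.1 e.1.2 ω) B₀ P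

/-- Edge indicators `ξ u v` of the graph after planting the biclique `{1, …, K} × B₀`. -/
noncomputable def edgeIndicator {Ω : Type*} (K : ℕ) (η : ℕ → ℕ → Ω → Bool) (B₀ : Ω → Finset ℕ)
    (ω : Ω) (u v : ℕ) : ℝ :=
  if (u ∈ side K ∧ v ∈ B₀ ω) ∨ η u v ω = true then 1 else 0

/-- The centered weight `Z(i) = W(i) - 𝔼[W(i)]` in the planted graph. -/
noncomputable def centeredWeight {Ω : Type*} [MeasurableSpace Ω] (P : Measure Ω) (n m K : ℕ)
    (p : ℝ) (η : ℕ → ℕ → Ω → Bool) (B₀ : Ω → Finset ℕ) (i : ℕ) (ω : Ω) : ℝ :=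
  weight n m p (edgeIndicator K η B₀ ω) i -
    ∫ ω', weight n m p (edgeIndicator K η B₀ ω') i ∂P

/-- The vertices `i(1), …, i(ℓ)`: the first `ℓ₀` of them are `i'(j)` (in the biclique), the
others are `i'(j) + K` (outside the biclique). -/
def vertexIndex {ℓ : ℕ} (ℓ₀ K : ℕ) (i' : Fin ℓ → ℕ) (j : Fin ℓ) : ℕ :=
  if (j : ℕ) < ℓ₀ then i' j else i' j + K

/-- The random vector `(√n Z(i(j)))_{j}` for a given tuple `i` of vertices. -/
noncomputable def rescaledVector {Ω : Type*} [MeasurableSpace Ω] (P : Measure Ω) (n m K : ℕ)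
    (p : ℝ) (η : ℕ → ℕ → Ω → Bool) (B₀ : Ω → Finset ℕ) {ℓ : ℕ} (i : Fin ℓ → ℕ) (ω : Ω) :
    EuclideanSpace ℝ (Fin ℓ) :=
  WithLp.toLp 2 (fun j => √(n : ℝ) * centeredWeight P n m K p η B₀ (i j) ω)

/-- The covariance matrix
`C_{i(j), i(j')} = 4 (p⁻¹ - 1) e^{2 (p⁻¹ - 1)} (𝟙_{i(j) = i(j')} + m² / n)`. -/
noncomputable def covMatrix (n m : ℕ) (p : ℝ) {ℓ : ℕ} (i : Fin ℓ → ℕ) :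
    Matrix (Fin ℓ) (Fin ℓ) ℝ :=
  Matrix.of fun j j' =>
    4 * (p⁻¹ - 1) * Real.exp (2 * (p⁻¹ - 1)) *
      ((if i j = i j' then (1 : ℝ) else 0) + (m : ℝ) ^ 2 / (n : ℝ))

end PlantedGBS

/-! Fix the right side `b` of the biclique and put `q = p⁻¹`, `Q = side K ×ˢ b`. The normalized
indicator `ξ_e / p` equals `q` on `Q` and `1 + x_e` off `Q`, where the variables `x_e = (η_e - p) /
p` are independent, centered, bounded by `q` and of variance `q - 1`. Writing `Y ^ 2` as a sum over
pairs of matchings, in which an edge used twice contributes an extra factor `q`, turns `W(i)` into a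
multilinear polynomial in the `x_e` (`weight_eq_multilinear`). Its coefficients are treated by
degree.

Degree zero: relabelling the right vertices shows that the constant term depends on `b` only through
its size (`coef_empty_eq`). The conditional mean of `W(i)` given `B₀` is therefore deterministic,
and `Z(i)` is the nonconstant part of the polynomial.

Degree one: the number of common edges of two random perfect matchings is asymptotically Poisson of
mean one, so the weight `q ^ agree` averages to a truncated exponential series tending to `e ^ (q -
1)`. An edge `(u, v)` with `u ∈ A` and `v ∈ B` is covered with probability about `2 / m`. The
coefficient is thus close to `2 e ^ (q - 1) (𝟙_{u = i} + m / n) / n` (`linCoef`), up to a vanishing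
relative error, for every edge outside `Q`; the edges of `Q` are too few to matter. The resulting
linear form does not involve `B₀`, and after rescaling its covariance is the claimed matrix up to a
term of order `m / n`.

Degree at least two: two configurations share two edges with probability `O(n⁻²)`, so the squared
coefficients, even weighted by `t ^ |S|`, sum to `O(n⁻²)` (`exists_sum_sq_coef_le`). The degree of
the polynomial grows with `m`, hence a hypercontractive bound with the weight `t ^ |S|` and no
restriction on the degree is used (`exists_integral_multilinear_pow_le`). It makes the linear
approximation exact in every moment norm, uniformly in `b`
(`tendsto_integral_rescaled_sub_linForm_pow`).

The linear form has coefficients `O(n^(-1/2))` and bounded variance, so its characteristic function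
merges with the Gaussian one (`tendsto_charFun_sub`). As `m ^ 2 / n` need not converge, the
conclusion passes through subsequences along which the bounded covariance matrices converge; there
Lévy's theorem gives weak convergence, and bounded even moments upgrade it to convergence of
moments. -/

namespace PlantedGBS

open MeasureTheory ProbabilityTheory

/-! ### Hypercontractivity for multilinear polynomials of arbitrary degree. -/

/-- The scalar inequality behind hypercontractivity. -/
lemma exists_add_pow_le (r : ℕ) (hr : 1 ≤ r) : ∃ T : ℝ, 1 ≤ T ∧ ∀ a y : ℝ,
    (a + y) ^ (2 * r) ≤ 2 * r * a ^ (2 * r - 1) * y + (a ^ 2 + T * y ^ 2) ^ r := by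
  induction r, hr using Nat.le_induction with
  | base =>
    refine ⟨1, le_rfl, fun a y => ?_⟩
    norm_num
    nlinarith
  | succ r hr ih =>
    obtain ⟨T, hT, h⟩ := ih
    have hrR : (1 : ℝ) ≤ r := by exact_mod_cast hr
    have hTT : T ≤ 1 + r * T + 5 * r := by nlinarith
    -- The bound for `r` is multiplied by `(a + y) ^ 2`. With `s = a ^ 2 + T * y ^ 2`, what remains
    -- beside the new linear term is `s ^ r * (a ^ 2 + y ^ 2)` and three corrections, at most `r *
    -- T`, `4 * r` and `r` times `s ^ r * y ^ 2`; this gives the constant.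
    refine ⟨1 + r * T + 5 * r, by linarith, fun a y => ?_⟩
    obtain ⟨k, rfl⟩ : ∃ k, r = k + 1 := ⟨r - 1, by omega⟩
    set s := a ^ 2 + T * y ^ 2 with hs
    have hs1 : a ^ 2 + y ^ 2 ≤ s := by nlinarith [sq_nonneg y]
    have hs0 : 0 ≤ s := le_trans (by positivity) hs1
    have has : a ^ 2 ≤ s := by nlinarith [sq_nonneg y]
    have h1 : |2 * a * y| ≤ s := by
      rw [abs_le]; constructor <;> nlinarith [sq_nonneg (a + y), sq_nonneg (a - y)]
    have h2 : s ^ (k + 1) - (a ^ 2) ^ (k + 1) ≤ (k + 1) * (T * y ^ 2) * s ^ k := by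
      have key : ∀ j : ℕ, s ^ (j + 1) - (a ^ 2) ^ (j + 1) ≤ (j + 1) * (T * y ^ 2) * s ^ j := by
        intro j
        induction j with
        | zero => simp [hs]
        | succ j ihj =>
          have e1 : s ^ (j + 1 + 1) - (a ^ 2) ^ (j + 1 + 1) =
            s * (s ^ (j + 1) - (a ^ 2) ^ (j + 1)) + (T * y ^ 2) * (a ^ 2) ^ (j + 1) := by
            rw [hs]; ring
          rw [e1]
          have e2 : (a ^ 2) ^ (j + 1) ≤ s ^ (j + 1) := pow_le_pow_left₀ (sq_nonneg a) has _
          have e3 := mul_le_mul_of_nonneg_left ihj hs0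
          have e4 := mul_le_mul_of_nonneg_left e2 (show 0 ≤ T * y ^ 2 by positivity)
          push_cast
          calc _ ≤ s * ((j + 1) * (T * y ^ 2) * s ^ j) + (T * y ^ 2) * s ^ (j + 1) := by linarith
            _ = _ := by ring
      exact key k
    have h2' : 0 ≤ s ^ (k + 1) - (a ^ 2) ^ (k + 1) :=
      sub_nonneg.2 (pow_le_pow_left₀ (sq_nonneg a) has _)
    have hm := mul_le_mul_of_nonneg_right (h a y) (sq_nonneg (a + y))
    have e0 : (a + y) ^ (2 * (k + 1 + 1)) = (a + y) ^ (2 * (k + 1)) * (a + y) ^ 2 := by ring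
    have hsk : 0 ≤ s ^ k := pow_nonneg hs0 _
    have t1 : 2 * a * y * (s ^ (k + 1) - (a ^ 2) ^ (k + 1)) ≤ (k + 1) * T * y ^ 2 * s ^ (k + 1) := by
      calc _ ≤ |2 * a * y| * (s ^ (k + 1) - (a ^ 2) ^ (k + 1)) :=
            mul_le_mul_of_nonneg_right (le_abs_self _) h2'
        _ ≤ s * ((k + 1) * (T * y ^ 2) * s ^ k) := mul_le_mul h1 h2 h2' hs0
        _ = _ := by ring
    have t2 : (a ^ 2) ^ (k + 1) * y ^ 2 ≤ s ^ (k + 1) * y ^ 2 :=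
      mul_le_mul_of_nonneg_right (pow_le_pow_left₀ (sq_nonneg a) has _) (sq_nonneg y)
    have t3 : (2 * a * y) * ((a ^ 2) ^ k * y ^ 2) ≤ s * (s ^ k * y ^ 2) := by
      refine mul_le_mul ((le_abs_self _).trans h1) ?_ (by positivity) hs0
      exact mul_le_mul_of_nonneg_right (pow_le_pow_left₀ (sq_nonneg a) has _) (sq_nonneg y)
    have t4 : s ^ (k + 1) * (a ^ 2 + (1 + (k + 1) * T + 5 * (k + 1)) * y ^ 2) ≤
        (a ^ 2 + (1 + ((k + 1 : ℕ) : ℝ) * T + 5 * ((k + 1 : ℕ) : ℝ)) * y ^ 2) ^ (k + 1 + 1) := by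
      push_cast at hTT ⊢
      rw [pow_succ _ (k + 1)]
      refine mul_le_mul_of_nonneg_right (pow_le_pow_left₀ hs0 ?_ _) (by positivity)
      rw [hs]; nlinarith [sq_nonneg y]
    have e5 : 2 * (k + 1) - 1 = 2 * k + 1 := by omega
    have e6 : 2 * (k + 1 + 1) - 1 = 2 * k + 3 := by omega
    rw [e5] at hm
    rw [e0, e6]
    refine hm.trans ?_
    refine le_trans ?_ (add_le_add_right t4 _)
    push_cast
    have t2' := mul_le_mul_of_nonneg_left t2 (show (0 : ℝ) ≤ 4 * (k + 1) by positivity)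
    have t3' := mul_le_mul_of_nonneg_left t3 (show (0 : ℝ) ≤ (k + 1) by positivity)
    have i1 : (2 * ((k : ℝ) + 1) * a ^ (2 * k + 1) * y + s ^ (k + 1)) * (a + y) ^ 2 =
      2 * (k + 1 + 1) * a ^ (2 * k + 3) * y + 2 * a * y * (s ^ (k + 1) - (a ^ 2) ^ (k + 1))
       + 4 * (k + 1) * ((a ^ 2) ^ (k + 1) * y ^ 2) + (k + 1) * (2 * a * y * ((a ^ 2) ^ k * y ^ 2))
       + s ^ (k + 1) * (a ^ 2 + y ^ 2) := by ring
    rw [i1]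
    have i2 : s * (s ^ k * y ^ 2) = s ^ (k + 1) * y ^ 2 := by ring
    rw [i2] at t3'
    linarith

/-- Polynomial with coefficients `c` in the variables `x e`, `e ∈ F`. -/
noncomputable def multilinear {ι : Type*} (F : Finset ι) (c : Finset ι → ℝ) (x : ι → ℝ) : ℝ :=
  ∑ S ∈ F.powerset, c S * ∏ e ∈ S, x e

lemma multilinear_insert {ι : Type*} [DecidableEq ι] {F : Finset ι} {a : ι} (ha : a ∉ F)
    (c : Finset ι → ℝ) (x : ι → ℝ) :
    multilinear (insert a F) c x =
      multilinear F c x + x a * multilinear F (fun S => c (insert a S)) x := by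
  unfold multilinear
  rw [Finset.sum_powerset_insert ha, Finset.mul_sum]
  congr 1
  refine Finset.sum_congr rfl fun S hS => ?_
  rw [Finset.prod_insert (fun h => ha (Finset.mem_powerset.1 hS h))]
  ring

lemma measurable_multilinear {ι : Type*} (F : Finset ι) (c : Finset ι → ℝ) :
    Measurable (multilinear F c) := by
  unfold multilinear
  fun_prop

lemma multilinear_congr {ι : Type*} {F : Finset ι} (c : Finset ι → ℝ) {x y : ι → ℝ}
    (h : ∀ e ∈ F, x e = y e) : multilinear F c x = multilinear F c y := by
  refine Finset.sum_congr rfl fun S hS => ?_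
  rw [Finset.prod_congr rfl fun e he => h e (Finset.mem_powerset.1 hS he)]

lemma exists_abs_multilinear_le {ι : Type*} (F : Finset ι) (c : Finset ι → ℝ) (M : ℝ) :
    ∃ C, ∀ x : ι → ℝ, (∀ e, |x e| ≤ M) → |multilinear F c x| ≤ C := by
  refine ⟨∑ S ∈ F.powerset, |c S| * ∏ e ∈ S, M, fun x hx => ?_⟩
  refine (Finset.abs_sum_le_sum_abs _ _).trans (Finset.sum_le_sum fun S _ => ?_)
  rw [abs_mul, Finset.abs_prod]
  exact mul_le_mul_of_nonneg_left
    (Finset.prod_le_prod (fun _ _ => abs_nonneg _) fun e _ => hx e) (abs_nonneg _)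

variable {Ω : Type*} [MeasurableSpace Ω] {P : Measure Ω} [IsProbabilityMeasure P]

lemma integrable_of_abs_le {f : Ω → ℝ} (hf : AEStronglyMeasurable f P) {C : ℝ}
    (h : ∀ ω, |f ω| ≤ C) : Integrable f P :=
  Integrable.of_bound hf C (.of_forall fun ω => by simpa using h ω)

/-- Convexity bound for the `r`-th moment of a sum. -/
lemma integral_add_pow_le {U V : Ω → ℝ} (hU : Measurable U) (hV : Measurable V)
    (hU0 : ∀ ω, 0 ≤ U ω) (hV0 : ∀ ω, 0 ≤ V ω) {C : ℝ} (hUC : ∀ ω, U ω ≤ C) (hVC : ∀ ω, V ω ≤ C)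
    (r : ℕ) {a b : ℝ} (ha : 0 ≤ a) (hb : 0 ≤ b)
    (hUa : ∫ ω, U ω ^ r ∂P ≤ a ^ r) (hVb : ∫ ω, V ω ^ r ∂P ≤ b ^ r) :
    ∫ ω, (U ω + V ω) ^ r ∂P ≤ (a + b) ^ r := by
  have hpow : ∀ {f : Ω → ℝ} {D : ℝ}, Measurable f → (∀ ω, 0 ≤ f ω) → (∀ ω, f ω ≤ D) →
      Integrable (fun ω => f ω ^ r) P := fun {f D} hf h0 hD =>
    integrable_of_abs_le (hf.pow_const r).aestronglyMeasurable (C := D ^ r) fun ω => by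
      rw [abs_of_nonneg (pow_nonneg (h0 ω) r)]; exact pow_le_pow_left₀ (h0 ω) (hD ω) r
  have iU := hpow hU hU0 hUC
  have iV := hpow hV hV0 hVC
  -- Minkowski's inequality: `U + V` is `a + b` times the convex combination of `U / a` and `V / b`
  -- with weights `a / (a + b)` and `b / (a + b)`, and both normalized `r`-th moments are at most
  -- one.
  have pos : ∀ a b : ℝ, 0 < a → 0 < b → ∫ ω, U ω ^ r ∂P ≤ a ^ r → ∫ ω, V ω ^ r ∂P ≤ b ^ r →
      ∫ ω, (U ω + V ω) ^ r ∂P ≤ (a + b) ^ r := by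
    intro a b ha hb hUa hVb
    have hs : 0 < a + b := by positivity
    have hpt : ∀ ω, (U ω + V ω) ^ r ≤
        (a + b) ^ r * (a / (a + b) * (U ω ^ r / a ^ r) + b / (a + b) * (V ω ^ r / b ^ r)) := by
      intro ω
      have hab : a / (a + b) + b / (a + b) = 1 := by field_simp
      have hc := (convexOn_pow r).2
        (Set.mem_Ici.2 (div_nonneg (hU0 ω) ha.le)) (Set.mem_Ici.2 (div_nonneg (hV0 ω) hb.le))
        (by positivity) (by positivity) hab
      simp only [smul_eq_mul, div_pow] at hc
      have e : U ω + V ω = (a + b) * (a / (a + b) * (U ω / a) + b / (a + b) * (V ω / b)) := by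
        field_simp
      rw [e, mul_pow]
      refine mul_le_mul_of_nonneg_left ?_ (by positivity)
      exact hc
    calc ∫ ω, (U ω + V ω) ^ r ∂P
        ≤ ∫ ω, (a + b) ^ r * (a / (a + b) * (U ω ^ r / a ^ r) +
            b / (a + b) * (V ω ^ r / b ^ r)) ∂P := by
          refine integral_mono (hpow (hU.add hV) (fun ω => add_nonneg (hU0 ω) (hV0 ω))
            (D := C + C) fun ω => add_le_add (hUC ω) (hVC ω)) ?_ hpt
          exact (((iU.div_const _).const_mul _).add ((iV.div_const _).const_mul _)).const_mul _
      _ = (a + b) ^ r * (a / (a + b) * ((∫ ω, U ω ^ r ∂P) / a ^ r) +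
            b / (a + b) * ((∫ ω, V ω ^ r ∂P) / b ^ r)) := by
          rw [integral_const_mul, integral_add ((iU.div_const _).const_mul _)
            ((iV.div_const _).const_mul _), integral_const_mul, integral_const_mul,
            integral_div, integral_div]
      _ ≤ (a + b) ^ r * (a / (a + b) * 1 + b / (a + b) * 1) := by
          gcongr
          · exact div_le_one_of_le₀ hUa (by positivity)
          · exact div_le_one_of_le₀ hVb (by positivity)
      _ = (a + b) ^ r := by field_simp
  -- When `a` or `b` vanishes the normalization is unavailable, so both are raised by `ε`, which
  -- then tends to zero.
  have hlim : Filter.Tendsto (fun ε : ℝ => (a + ε + (b + ε)) ^ r) (nhdsWithin 0 (Set.Ioi 0))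
      (nhds ((a + b) ^ r)) := by
    have : Continuous fun ε : ℝ => (a + ε + (b + ε)) ^ r := by fun_prop
    simpa using (this.tendsto 0).mono_left nhdsWithin_le_nhds
  refine ge_of_tendsto hlim ?_
  filter_upwards [self_mem_nhdsWithin] with ε hε
  have hε : 0 < ε := hε
  exact pos _ _ (by positivity) (by positivity)
    (hUa.trans (pow_le_pow_left₀ ha (by linarith) r))
    (hVb.trans (pow_le_pow_left₀ hb (by linarith) r))

/-- Hypercontractivity for polynomials in independent centered bounded variables. -/
lemma exists_integral_multilinear_pow_le (r : ℕ) (hr : 1 ≤ r) (M : ℝ) (hM : 0 ≤ M) :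
    ∃ t : ℝ, 0 < t ∧ ∀ {Ω : Type*} [MeasurableSpace Ω] (P : Measure Ω) [IsProbabilityMeasure P]
      {ι : Type} [DecidableEq ι] (x : ι → Ω → ℝ), iIndepFun x P → (∀ e, Measurable (x e)) →
      (∀ e ω, |x e ω| ≤ M) → (∀ e, ∫ ω, x e ω ∂P = 0) → ∀ (F : Finset ι) (c : Finset ι → ℝ),
      ∫ ω, multilinear F c (fun e => x e ω) ^ (2 * r) ∂P ≤
        (∑ S ∈ F.powerset, t ^ S.card * c S ^ 2) ^ r := by
  obtain ⟨T, hT, hTr⟩ := exists_add_pow_le r hr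
  -- `M ^ 2` bounds the square of each variable; the `+ 1` keeps the constant positive when `M = 0`.
  refine ⟨T * (M ^ 2 + 1), by positivity, ?_⟩
  intro Ω _ P _ ι _ x hind hmeas hbd hmean F
  set t := T * (M ^ 2 + 1) with ht
  have ht0 : 0 < t := by positivity
  have hmm : ∀ F c, Measurable fun ω => multilinear F c fun e => x e ω := fun F c =>
    (measurable_multilinear F c).comp (measurable_pi_lambda _ hmeas)
  have hpow2 : ∀ y : ℝ, y ^ (2 * r) = (y ^ 2) ^ r := fun y => pow_mul y 2 r
  induction F using Finset.induction_on with
  | empty => intro c; simp [multilinear, hpow2]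
  | insert a F ha ih =>
    intro c
    -- The polynomial is `h + x a * g` with `g`, `h` free of `x a`. By the scalar inequality its
    -- `2r`-th power is at most a multiple of `x a * h ^ (2 * r - 1) * g`, which has mean zero by
    -- independence, plus `(h ^ 2 + t * g ^ 2) ^ r`, to which Minkowski and the induction hypotheses
    -- for `h` and `g` apply.
    set g : Ω → ℝ := fun ω => multilinear F (fun S => c (insert a S)) fun e => x e ω with hg
    set h : Ω → ℝ := fun ω => multilinear F c fun e => x e ω with hh
    obtain ⟨Cg, hCg⟩ := exists_abs_multilinear_le F (fun S => c (insert a S)) M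
    obtain ⟨Ch, hCh⟩ := exists_abs_multilinear_le F c M
    have hgm : Measurable g := hmm _ _
    have hhm : Measurable h := hmm _ _
    have hgC : ∀ ω, |g ω| ≤ Cg := fun ω => hCg _ fun e => hbd e ω
    have hhC : ∀ ω, |h ω| ≤ Ch := fun ω => hCh _ fun e => hbd e ω
    have hgC2 : ∀ ω, g ω ^ 2 ≤ Cg ^ 2 := fun ω => by
      rw [← sq_abs]; exact pow_le_pow_left₀ (abs_nonneg _) (hgC ω) 2
    have hhC2 : ∀ ω, h ω ^ 2 ≤ Ch ^ 2 := fun ω => by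
      rw [← sq_abs]; exact pow_le_pow_left₀ (abs_nonneg _) (hhC ω) 2
    have hindep : IndepFun (x a) (fun ω => h ω ^ (2 * r - 1) * g ω) P := by
      have hI := hind.indepFun_finset {a} F (by simpa using ha) hmeas
      let φ : (({a} : Finset ι) → ℝ) → ℝ := fun y => y ⟨a, by simp⟩
      -- Extension by zero exhibits `h` and `g` as functions of the variables in `F` only, so
      -- independence of the blocks `{a}` and `F` applies.
      let ext : (F → ℝ) → ι → ℝ := fun y e => if he : e ∈ F then y ⟨e, he⟩ else 0
      have hext : Measurable ext := by
        refine measurable_pi_lambda _ fun e => ?_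
        by_cases he : e ∈ F
        · simp only [ext, he, dite_true]; exact measurable_pi_apply _
        · simp only [ext, he, dite_false]; exact measurable_const
      let ψ : (F → ℝ) → ℝ := fun y => multilinear F c (ext y) ^ (2 * r - 1) *
        multilinear F (fun S => c (insert a S)) (ext y)
      have hψ : Measurable ψ := (((measurable_multilinear F c).comp hext).pow_const _).mul
        ((measurable_multilinear F _).comp hext)
      have hφ : Measurable φ := measurable_pi_apply _
      have hJ := hI.comp hφ hψ
      have e1 : φ ∘ (fun ω (i : ({a} : Finset ι)) => x i ω) = x a := rfl
      have e2 : ψ ∘ (fun ω (i : F) => x i ω) = fun ω => h ω ^ (2 * r - 1) * g ω := by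
        funext ω
        simp only [Function.comp, ψ, hh, hg]
        rw [multilinear_congr c (y := fun e => x e ω) (fun e he => by simp [ext, he]),
          multilinear_congr (fun S => c (insert a S)) (y := fun e => x e ω)
            (fun e he => by simp [ext, he])]
      rw [e1, e2] at hJ
      exact hJ
    have hzero : ∫ ω, x a ω * (h ω ^ (2 * r - 1) * g ω) ∂P = 0 := by
      rw [hindep.integral_fun_mul_eq_mul_integral (hmeas a).aestronglyMeasurable
        ((hhm.pow_const _).mul hgm).aestronglyMeasurable, hmean, zero_mul]
    set A := ∑ S ∈ F.powerset, t ^ S.card * c S ^ 2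
    set B := ∑ S ∈ F.powerset, t ^ S.card * c (insert a S) ^ 2
    have hA : 0 ≤ A := Finset.sum_nonneg fun S _ => by positivity
    have hB : 0 ≤ B := Finset.sum_nonneg fun S _ => by positivity
    have hAB : ∑ S ∈ (insert a F).powerset, t ^ S.card * c S ^ 2 = A + t * B := by
      rw [Finset.sum_powerset_insert ha, Finset.mul_sum]
      congr 1
      refine Finset.sum_congr rfl fun S hS => ?_
      rw [Finset.card_insert_of_notMem (fun h => ha (Finset.mem_powerset.1 hS h))]
      ring
    rw [hAB]
    simp_rw [multilinear_insert ha]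
    have hxa : ∀ ω, x a ω ^ 2 ≤ M ^ 2 := fun ω => by
      rw [← sq_abs]; exact pow_le_pow_left₀ (abs_nonneg _) (hbd a ω) 2
    have hpt : ∀ ω, (h ω + x a ω * g ω) ^ (2 * r) ≤
        2 * r * (x a ω * (h ω ^ (2 * r - 1) * g ω)) + (h ω ^ 2 + t * g ω ^ 2) ^ r := by
      intro ω
      have h1 := hTr (h ω) (x a ω * g ω)
      have h2 : (h ω ^ 2 + T * (x a ω * g ω) ^ 2) ^ r ≤ (h ω ^ 2 + t * g ω ^ 2) ^ r := by
        refine pow_le_pow_left₀ (by positivity) ?_ r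
        have : x a ω ^ 2 * g ω ^ 2 ≤ (M ^ 2 + 1) * g ω ^ 2 :=
          mul_le_mul_of_nonneg_right (by linarith [hxa ω]) (sq_nonneg _)
        rw [ht]
        nlinarith
      calc _ ≤ _ := h1
        _ ≤ _ := by linarith
    have i1 : Integrable (fun ω => x a ω * (h ω ^ (2 * r - 1) * g ω)) P := by
      refine integrable_of_abs_le
        ((hmeas a).mul ((hhm.pow_const _).mul hgm)).aestronglyMeasurable
        (C := M * (Ch ^ (2 * r - 1) * Cg)) fun ω => ?_
      rw [abs_mul, abs_mul, abs_pow]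
      have : 0 ≤ Ch := (abs_nonneg _).trans (hhC ω)
      exact mul_le_mul (hbd a ω) (mul_le_mul (pow_le_pow_left₀ (abs_nonneg _) (hhC ω) _)
        (hgC ω) (abs_nonneg _) (by positivity)) (by positivity) hM
    have i2 : Integrable (fun ω => (h ω ^ 2 + t * g ω ^ 2) ^ r) P := by
      refine integrable_of_abs_le
        (((hhm.pow_const _).add ((hgm.pow_const _).const_mul _)).pow_const r).aestronglyMeasurable
        (C := (Ch ^ 2 + t * Cg ^ 2) ^ r) fun ω => ?_
      rw [abs_of_nonneg (by positivity)]
      refine pow_le_pow_left₀ (by positivity) (add_le_add (hhC2 ω) ?_) r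
      exact mul_le_mul_of_nonneg_left (hgC2 ω) ht0.le
    calc ∫ ω, (h ω + x a ω * g ω) ^ (2 * r) ∂P
        ≤ ∫ ω, (2 * r * (x a ω * (h ω ^ (2 * r - 1) * g ω)) + (h ω ^ 2 + t * g ω ^ 2) ^ r) ∂P := by
          refine integral_mono_of_nonneg (.of_forall fun ω => ?_) ((i1.const_mul _).add i2)
            (.of_forall hpt)
          simp only [hpow2]; positivity
      _ = ∫ ω, (h ω ^ 2 + t * g ω ^ 2) ^ r ∂P := by
          rw [integral_add (i1.const_mul _) i2, integral_const_mul, hzero]; ring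
      _ ≤ (A + t * B) ^ r := by
          refine integral_add_pow_le (C := max (Ch ^ 2) (t * Cg ^ 2)) (hhm.pow_const 2)
            ((hgm.pow_const 2).const_mul t) (fun ω => sq_nonneg _) (fun ω => by positivity)
            (fun ω => (hhC2 ω).trans (le_max_left _ _))
            (fun ω => (mul_le_mul_of_nonneg_left (hgC2 ω) ht0.le).trans (le_max_right _ _))
            r hA (by positivity) ?_ ?_
          · simpa only [hpow2] using ih c
          · simp only [mul_pow _ _ r]
            rw [integral_const_mul]
            refine mul_le_mul_of_nonneg_left ?_ (by positivity)
            simpa only [hpow2] using ih fun S => c (insert a S)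

/-! ### Counting bijections, weighted by their agreements. -/

section Bijections

variable {α β : Type*} [Fintype α] [Fintype β] [DecidableEq α] [DecidableEq β]

/-- The number of points at which two bijections agree. -/
def agree (σ τ : α ≃ β) : ℕ := (Finset.univ.filter fun u => σ u = τ u).card

lemma agree_comm (σ τ : α ≃ β) : agree σ τ = agree τ σ := by
  simp only [agree, eq_comm]

/-- Truncated exponential series. -/
noncomputable def expTrunc (m : ℕ) (x : ℝ) : ℝ :=
  ∑ k ∈ Finset.range (m + 1), x ^ k / (k.factorial : ℝ)

lemma expTrunc_le_exp (m : ℕ) {x : ℝ} (hx : 0 ≤ x) : expTrunc m x ≤ Real.exp x :=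
  Real.sum_le_exp_of_nonneg hx _

lemma tendsto_expTrunc (x : ℝ) :
    Filter.Tendsto (fun m => expTrunc m x) Filter.atTop (nhds (Real.exp x)) := by
  have h := (NormedSpace.expSeries_div_hasSum_exp (𝔸 := ℝ) x).tendsto_sum_nat
  rw [← Real.exp_eq_exp_ℝ] at h
  exact h.comp (Filter.tendsto_add_atTop_nat 1)

/-- Composition with `σ⁻¹` turns these bijections into the permutations fixing `S` pointwise, that
is, the permutations of the complement of `S`. -/
lemma card_filter_agree_on (σ : α ≃ β) (S : Finset α) :
    (Finset.univ.filter fun τ : α ≃ β => ∀ u ∈ S, σ u = τ u).card =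
      (Fintype.card α - S.card).factorial := by
  rw [← Fintype.card_subtype]
  have e1 : {τ : α ≃ β // ∀ u ∈ S, σ u = τ u} ≃
      {f : Equiv.Perm α // ∀ a, ¬ (a ∉ S) → f a = a} :=
    (Equiv.subtypeEquiv (Equiv.equivCongr (Equiv.refl α) σ.symm) fun τ => by
      simp only [not_not]
      refine forall₂_congr fun u _ => ?_
      change σ u = τ u ↔ σ.symm (τ u) = u
      rw [Equiv.symm_apply_eq, eq_comm])
  rw [Fintype.card_congr (e1.trans (Equiv.Perm.subtypeEquivSubtypePerm (· ∉ S)).symm),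
    Fintype.card_perm]
  congr 1
  rw [Fintype.card_subtype_compl]
  simp

/-- Expansion of `(1 + (q - 1)) ^ |s|`. It is the device that converts exponential moments of a
cardinality into inclusion counts. -/
lemma pow_card_eq_sum_powerset {ι : Type*} (s : Finset ι) (q : ℝ) :
    q ^ s.card = ∑ S ∈ s.powerset, (q - 1) ^ S.card := by
  have := Finset.sum_pow_mul_eq_add_pow (q - 1) 1 s
  simpa using this.symm

lemma sum_pow_agree_eq_sum (σ : α ≃ β) (T : Finset α) (q : ℝ) :
    ∑ τ ∈ Finset.univ.filter (fun τ : α ≃ β => ∀ u ∈ T, σ u = τ u), q ^ agree σ τ =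
      ∑ S ∈ (Finset.univ : Finset α).powerset,
        (q - 1) ^ S.card * ((Fintype.card α - (T ∪ S).card).factorial : ℝ) := by
  have h1 : ∀ τ : α ≃ β, q ^ agree σ τ = ∑ S ∈ (Finset.univ : Finset α).powerset,
      if ∀ u ∈ S, σ u = τ u then (q - 1) ^ S.card else 0 := by
    intro τ
    rw [agree, pow_card_eq_sum_powerset, ← Finset.sum_filter]
    refine Finset.sum_congr ?_ fun _ _ => rfl
    ext S
    simp [Finset.subset_iff]
  simp_rw [h1]
  rw [Finset.sum_comm]
  refine Finset.sum_congr rfl fun S _ => ?_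
  rw [← Finset.sum_filter, Finset.filter_filter, Finset.sum_const, ← card_filter_agree_on σ (T ∪ S),
    nsmul_eq_mul, mul_comm]
  congr 3
  ext τ
  simp only [Finset.mem_filter, Finset.mem_union, true_and, Finset.mem_univ]
  exact ⟨fun h u hu => hu.elim (h.1 u) (h.2 u), fun h => ⟨fun u hu => h u (.inl hu),
    fun u hu => h u (.inr hu)⟩⟩

/-- There are `choose N k` subsets of size `k`, and `choose N k * (N - k)! = N! / k!` produces the
exponential series. -/
lemma sum_powerset_mul_factorial {γ : Type*} (U : Finset γ) (x : ℝ) :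
    ∑ S ∈ U.powerset, x ^ S.card * ((U.card - S.card).factorial : ℝ) =
      (U.card.factorial : ℝ) * expTrunc U.card x := by
  rw [Finset.sum_powerset_apply_card (fun k => x ^ k * ((U.card - k).factorial : ℝ)), expTrunc,
    Finset.mul_sum]
  refine Finset.sum_congr rfl fun k hk => ?_
  have hk : k ≤ U.card := Nat.lt_succ_iff.1 (Finset.mem_range.1 hk)
  have h := Nat.choose_mul_factorial_mul_factorial hk
  have h' : (U.card.choose k : ℝ) * (k.factorial : ℝ) * ((U.card - k).factorial : ℝ) =
    (U.card.factorial : ℝ) := by exact_mod_cast h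
  have hf : (k.factorial : ℝ) ≠ 0 := by positivity
  rw [nsmul_eq_mul, ← h']
  field_simp

/-- Generating function of the number of agreements with a fixed bijection. -/
lemma sum_pow_agree (σ : α ≃ β) (q : ℝ) :
    ∑ τ : α ≃ β, q ^ agree σ τ =
      ((Fintype.card α).factorial : ℝ) * expTrunc (Fintype.card α) (q - 1) := by
  have h := sum_pow_agree_eq_sum σ ∅ q
  simp only [Finset.notMem_empty, false_implies, implies_true, Finset.filter_true,
    Finset.empty_union] at h
  rw [h]
  exact sum_powerset_mul_factorial Finset.univ (q - 1)

/-- The subsets `S` and `insert a S` have the same union with `{a}`; pairing them yields the factor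
`1 + (q - 1) = q`, and a sum over the remaining points. -/
lemma sum_pow_agree_of_eq (σ : α ≃ β) (a : α) (q : ℝ) :
    ∑ τ ∈ Finset.univ.filter (fun τ : α ≃ β => τ a = σ a), q ^ agree σ τ =
      q * (((Fintype.card α - 1).factorial : ℝ) * expTrunc (Fintype.card α - 1) (q - 1)) := by
  have h := sum_pow_agree_eq_sum σ {a} q
  simp only [Finset.mem_singleton, forall_eq] at h
  rw [Finset.filter_congr (fun τ _ => show τ a = σ a ↔ σ a = τ a from eq_comm), h,
    ← Finset.insert_erase (Finset.mem_univ a), Finset.sum_powerset_insert (by simp),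
    ← Finset.sum_add_distrib]
  have hc : (Finset.univ.erase a).card = Fintype.card α - 1 := by simp
  rw [← hc, ← sum_powerset_mul_factorial, Finset.mul_sum]
  refine Finset.sum_congr rfl fun S hS => ?_
  have ha : a ∉ S := fun h => by simpa using Finset.mem_powerset.1 hS h
  have e1 : ({a} ∪ S).card = S.card + 1 := by
    rw [← Finset.insert_eq, Finset.card_insert_of_notMem ha]
  have e2 : ({a} ∪ insert a S).card = S.card + 1 := by
    rw [← Finset.insert_eq, Finset.insert_idem, Finset.card_insert_of_notMem ha]
  rw [e1, e2, Finset.card_insert_of_notMem ha, hc,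
    show Fintype.card α - (S.card + 1) = Fintype.card α - 1 - S.card by omega]
  ring

/-- Exchanging the values `b` and `σ a` after `τ` maps one family bijectively onto the other. No
agreement is lost, since a point where `τ` agrees with `σ` has image different from both values. -/
lemma sum_pow_agree_le_of_ne (σ : α ≃ β) (a : α) (b : β) {q : ℝ} (hq : 1 ≤ q) :
    ∑ τ ∈ Finset.univ.filter (fun τ : α ≃ β => τ a = b), q ^ agree σ τ ≤
      ∑ τ ∈ Finset.univ.filter (fun τ : α ≃ β => τ a = σ a), q ^ agree σ τ := by
  by_cases hb : b = σ a
  · rw [hb]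
  have hbij : ∑ τ ∈ Finset.univ.filter (fun τ : α ≃ β => τ a = σ a), q ^ agree σ τ =
      ∑ τ ∈ Finset.univ.filter (fun τ : α ≃ β => τ a = b),
        q ^ agree σ (τ.trans (Equiv.swap b (σ a))) := by
    refine (Finset.sum_bij' (fun τ _ => τ.trans (Equiv.swap b (σ a)))
      (fun τ _ => τ.trans (Equiv.swap b (σ a))) ?_ ?_ ?_ ?_ ?_).symm
    · intro τ hτ
      simp only [Finset.mem_filter, Finset.mem_univ, true_and] at hτ
      simp [hτ]
    · intro τ hτ
      simp only [Finset.mem_filter, Finset.mem_univ, true_and] at hτ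
      simp [hτ]
    · intro τ _; ext; simp
    · intro τ _; ext; simp
    · intro τ _; rfl
  rw [hbij]
  refine Finset.sum_le_sum fun τ hτ => pow_le_pow_right₀ hq (Finset.card_le_card fun u hu => ?_)
  simp only [Finset.mem_filter, Finset.mem_univ, true_and] at hτ hu ⊢
  have hua : u ≠ a := fun h => hb (by rw [← hτ, ← h, hu])
  have h1 : τ u ≠ b := fun h => hua (τ.injective (h.trans hτ.symm))
  have h2 : τ u ≠ σ a := fun h => hua (σ.injective (hu.trans h))
  simp [Equiv.swap_apply_of_ne_of_ne h1 h2, hu]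

/-- Bijections through a given edge carry at most a fraction `O(1/m)` of the total weight. -/
lemma sum_pow_agree_le (σ : α ≃ β) (a : α) (b : β) {q : ℝ} (hq : 1 ≤ q) :
    ∑ τ ∈ Finset.univ.filter (fun τ : α ≃ β => τ a = b), q ^ agree σ τ ≤
      q * Real.exp (q - 1) * ((Fintype.card α).factorial / Fintype.card α : ℝ) := by
  refine (sum_pow_agree_le_of_ne σ a b hq).trans ?_
  rw [sum_pow_agree_of_eq]
  have hpos : 0 < Fintype.card α := Fintype.card_pos_iff.2 ⟨a⟩
  have hR : (0 : ℝ) < Fintype.card α := by exact_mod_cast hpos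
  have hf : ((Fintype.card α).factorial : ℝ) / Fintype.card α = (Fintype.card α - 1).factorial := by
    rw [← Nat.mul_factorial_pred hpos.ne']; push_cast; field_simp
  rw [hf, mul_assoc, mul_comm (Real.exp _)]
  gcongr
  exact expTrunc_le_exp _ (by linarith)

lemma sum_pow_agree_total_le (σ : α ≃ β) {q : ℝ} (hq : 1 ≤ q) :
    ∑ τ : α ≃ β, q ^ agree σ τ ≤ Real.exp (q - 1) * ((Fintype.card α).factorial : ℝ) := by
  rw [sum_pow_agree, mul_comm]
  gcongr
  exact expTrunc_le_exp _ (by linarith)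

/-- The number of bijections through a given edge. -/
lemma card_filter_apply_eq (h : Fintype.card α = Fintype.card β) (a : α) (b : β) :
    ((Finset.univ.filter fun σ : α ≃ β => σ a = b).card : ℝ) =
      (Fintype.card α).factorial / Fintype.card α := by
  obtain ⟨σ₀⟩ : Nonempty (α ≃ β) := ⟨Fintype.equivOfCardEq h⟩
  have h1 := card_filter_agree_on (σ₀.trans (Equiv.swap b (σ₀ a))) {a}
  simp only [Finset.mem_singleton, forall_eq, Equiv.trans_apply, Equiv.swap_apply_right,
    Finset.card_singleton] at h1
  rw [Finset.filter_congr (fun τ _ => show τ a = b ↔ b = τ a from eq_comm), h1]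
  have hpos : 0 < Fintype.card α := Fintype.card_pos_iff.2 ⟨a⟩
  rw [← Nat.mul_factorial_pred hpos.ne']
  have hR : (0 : ℝ) < Fintype.card α := by exact_mod_cast hpos
  push_cast; field_simp

/-- The number of bijections through two given edges. -/
lemma card_filter_apply_eq_and_le (a a' : α) (b b' : β) (hne : (a, b) ≠ (a', b'))
    (h2 : 2 ≤ Fintype.card α) :
    ((Finset.univ.filter fun σ : α ≃ β => σ a = b ∧ σ a' = b').card : ℝ) ≤
      2 * (Fintype.card α).factorial / (Fintype.card α : ℝ) ^ 2 := by
  have hm : (2 : ℝ) ≤ Fintype.card α := by exact_mod_cast h2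
  rcases (Finset.univ.filter fun σ : α ≃ β => σ a = b ∧ σ a' = b').eq_empty_or_nonempty with
    h0 | ⟨σ, hσ⟩
  · rw [h0]; simp; positivity
  · simp only [Finset.mem_filter, Finset.mem_univ, true_and] at hσ
    have haa : a ≠ a' := fun h => hne (by rw [← hσ.1, ← hσ.2, h])
    have h1 := card_filter_agree_on σ {a, a'}
    simp only [Finset.mem_insert, Finset.mem_singleton, forall_eq_or_imp, forall_eq,
      Finset.card_pair haa, hσ.1, hσ.2] at h1
    rw [Finset.filter_congr (fun τ _ => show τ a = b ∧ τ a' = b' ↔ b = τ a ∧ b' = τ a' by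
      simp only [eq_comm]), h1]
    -- The count is `k!` for a set of size `k + 2`, and `k + 2 ≤ 2 * (k + 1)` accounts for the
    -- factor `2`.
    obtain ⟨k, hk⟩ : ∃ k, Fintype.card α = k + 2 := ⟨_, (Nat.sub_add_cancel h2).symm⟩
    rw [hk]
    simp only [Nat.add_sub_cancel, Nat.factorial_succ]
    push_cast
    rw [le_div_iff₀ (by positivity)]
    have : (0 : ℝ) < k.factorial := by positivity
    nlinarith [mul_pos this this, (Nat.cast_nonneg k : (0 : ℝ) ≤ k),
      mul_nonneg (Nat.cast_nonneg k : (0 : ℝ) ≤ k) this.le,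
      mul_nonneg (mul_nonneg (Nat.cast_nonneg k : (0 : ℝ) ≤ k) (Nat.cast_nonneg k)) this.le]

/-- Pairs of bijections whose union covers two given edges. -/
lemma sum_sum_pow_agree_le (h : Fintype.card α = Fintype.card β) (a a' : α) (b b' : β)
    (hne : (a, b) ≠ (a', b')) (h2 : 2 ≤ Fintype.card α) {q : ℝ} (hq : 1 ≤ q) :
    ∑ σ : α ≃ β, ∑ τ : α ≃ β,
      (if (σ a = b ∨ τ a = b) ∧ (σ a' = b' ∨ τ a' = b') then q ^ agree σ τ else 0) ≤
      6 * q * Real.exp (q - 1) *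
        (((Fintype.card α).factorial : ℝ) ^ 2 / (Fintype.card α : ℝ) ^ 2) := by
  set m := Fintype.card α with hm
  have hmR : (2 : ℝ) ≤ m := by exact_mod_cast h2
  have hq0 : 0 ≤ q := by linarith
  -- The two edges are covered both by `σ`, both by `τ`, or one by each in either order. The four
  -- cases contribute `2`, `2`, `q` and `q`, whence `6 * q` because `q ≥ 1`.
  have hpt : ∀ σ τ : α ≃ β,
      (if (σ a = b ∨ τ a = b) ∧ (σ a' = b' ∨ τ a' = b') then q ^ agree σ τ else 0) ≤
      (if σ a = b ∧ σ a' = b' then q ^ agree σ τ else 0) +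
      (if τ a = b ∧ τ a' = b' then q ^ agree σ τ else 0) +
      ((if σ a = b then (if τ a' = b' then q ^ agree σ τ else 0) else 0) +
      (if σ a' = b' then (if τ a = b then q ^ agree σ τ else 0) else 0)) := by
    intro σ τ
    have : 0 ≤ q ^ agree σ τ := by positivity
    split_ifs <;> first | linarith | (exfalso; tauto)
  have s1 : ∑ σ : α ≃ β, ∑ τ : α ≃ β, (if σ a = b ∧ σ a' = b' then q ^ agree σ τ else 0) ≤
      2 * Real.exp (q - 1) * ((m.factorial : ℝ) ^ 2 / (m : ℝ) ^ 2) := by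
    have : ∀ σ : α ≃ β, ∑ τ : α ≃ β, (if σ a = b ∧ σ a' = b' then q ^ agree σ τ else 0) ≤
        if σ a = b ∧ σ a' = b' then Real.exp (q - 1) * (m.factorial : ℝ) else 0 := by
      intro σ
      split_ifs
      · exact sum_pow_agree_total_le σ hq
      · simp
    refine (Finset.sum_le_sum fun σ _ => this σ).trans ?_
    rw [← Finset.sum_filter, Finset.sum_const, nsmul_eq_mul]
    calc _ ≤ (2 * m.factorial / (m : ℝ) ^ 2) * (Real.exp (q - 1) * (m.factorial : ℝ)) :=
          mul_le_mul_of_nonneg_right (card_filter_apply_eq_and_le a a' b b' hne h2)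
            (by positivity)
      _ = _ := by ring
  have s3 : ∀ (a a' : α) (b b' : β), ∑ σ : α ≃ β, ∑ τ : α ≃ β,
      (if σ a = b then (if τ a' = b' then q ^ agree σ τ else 0) else 0) ≤
      q * Real.exp (q - 1) * ((m.factorial : ℝ) ^ 2 / (m : ℝ) ^ 2) := by
    intro a a' b b'
    have : ∀ σ : α ≃ β, ∑ τ : α ≃ β,
        (if σ a = b then (if τ a' = b' then q ^ agree σ τ else 0) else 0) ≤
        if σ a = b then q * Real.exp (q - 1) * (m.factorial / m : ℝ) else 0 := by
      intro σ
      split_ifs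
      · rw [← Finset.sum_filter]; exact sum_pow_agree_le σ a' b' hq
      · simp
    refine (Finset.sum_le_sum fun σ _ => this σ).trans ?_
    rw [← Finset.sum_filter, Finset.sum_const, nsmul_eq_mul, card_filter_apply_eq h]
    apply le_of_eq
    rw [← hm]
    ring
  have s2 : ∑ σ : α ≃ β, ∑ τ : α ≃ β, (if τ a = b ∧ τ a' = b' then q ^ agree σ τ else 0) ≤
      2 * Real.exp (q - 1) * ((m.factorial : ℝ) ^ 2 / (m : ℝ) ^ 2) := by
    rw [Finset.sum_comm]
    simpa only [agree_comm] using s1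
  calc _ ≤ _ := Finset.sum_le_sum fun σ _ => Finset.sum_le_sum fun τ _ => hpt σ τ
    _ = _ := by simp only [Finset.sum_add_distrib]
    _ ≤ 2 * Real.exp (q - 1) * ((m.factorial : ℝ) ^ 2 / (m : ℝ) ^ 2) +
        2 * Real.exp (q - 1) * ((m.factorial : ℝ) ^ 2 / (m : ℝ) ^ 2) +
        (q * Real.exp (q - 1) * ((m.factorial : ℝ) ^ 2 / (m : ℝ) ^ 2) +
        q * Real.exp (q - 1) * ((m.factorial : ℝ) ^ 2 / (m : ℝ) ^ 2)) :=
      add_le_add (add_le_add s1 s2) (add_le_add (s3 a a' b b') (s3 a' a b' b))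
    _ ≤ _ := by
      have : 0 ≤ Real.exp (q - 1) * ((m.factorial : ℝ) ^ 2 / (m : ℝ) ^ 2) := by positivity
      nlinarith

end Bijections

/-! ### Random `m`-subsets: inclusion probabilities and exponential moments. -/

section Subsets

variable {γ : Type*} [DecidableEq γ]

/-- The `m`-subsets of `U` containing `T`. -/
def supersets (U : Finset γ) (m : ℕ) (T : Finset γ) : Finset (Finset γ) :=
  (U.powersetCard m).filter (T ⊆ ·)

lemma supersets_empty (U : Finset γ) (m : ℕ) : supersets U m ∅ = U.powersetCard m := by
  simp [supersets]

lemma card_supersets {U T : Finset γ} (hT : T ⊆ U) {m : ℕ} (hm : T.card ≤ m) :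
    (supersets U m T).card = (U.card - T.card).choose (m - T.card) := by
  rw [← Finset.card_sdiff_of_subset hT, ← Finset.card_powersetCard]
  refine Finset.card_bij' (fun B _ => B \ T) (fun B _ => B ∪ T) ?_ ?_ ?_ ?_
  · intro B hB
    simp only [supersets, Finset.mem_filter, Finset.mem_powersetCard] at hB ⊢
    exact ⟨Finset.sdiff_subset_sdiff hB.1.1 le_rfl,
      by rw [Finset.card_sdiff_of_subset hB.2, hB.1.2]⟩
  · intro B hB
    simp only [supersets, Finset.mem_filter, Finset.mem_powersetCard] at hB ⊢
    have hd : Disjoint B T := Finset.disjoint_of_subset_left hB.1 Finset.sdiff_disjoint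
    refine ⟨⟨Finset.union_subset (hB.1.trans Finset.sdiff_subset) hT, ?_⟩,
      Finset.subset_union_right⟩
    rw [Finset.card_union_of_disjoint hd, hB.2]; omega
  · intro B hB
    simp only [supersets, Finset.mem_filter] at hB
    exact Finset.sdiff_union_of_subset hB.2
  · intro B hB
    simp only [Finset.mem_powersetCard] at hB
    have hd : Disjoint B T := Finset.disjoint_of_subset_left hB.1 Finset.sdiff_disjoint
    rw [Finset.union_sdiff_right, Finset.sdiff_eq_self_of_disjoint hd]

/-- With `k = |T|` and `n = |U|`, the ratio of the two binomial coefficients is `(m - k) / (n - k)`,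
at most `m / n`. -/
lemma card_supersets_insert_le {U T : Finset γ} (hT : T ⊆ U) {v : γ} (hv : v ∈ U) (hvT : v ∉ T)
    {m : ℕ} (hm : m ≤ U.card) :
    ((supersets U m (insert v T)).card : ℝ) ≤ (m / U.card : ℝ) * (supersets U m T).card := by
  by_cases hc : T.card + 1 ≤ m
  · have hcv : (insert v T).card = T.card + 1 := Finset.card_insert_of_notMem hvT
    rw [card_supersets (Finset.insert_subset hv hT) (by rw [hcv]; exact hc), hcv,
      card_supersets hT (by omega)]
    set k := T.card
    set n := U.card
    have hmR : (m : ℝ) ≤ n := by exact_mod_cast hm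
    obtain ⟨b, hb⟩ : ∃ b, m = k + 1 + b := ⟨_, (Nat.add_sub_cancel' hc).symm⟩
    obtain ⟨a, ha⟩ : ∃ a, n = k + 1 + a := ⟨n - (k + 1), by omega⟩
    rw [show n - (k + 1) = a by omega, show m - (k + 1) = b by omega,
      show n - k = a + 1 by omega, show m - k = b + 1 by omega]
    have h := Nat.add_one_mul_choose_eq a b
    have h' : ((a : ℝ) + 1) * (a.choose b : ℝ) = ((a + 1).choose (b + 1) : ℝ) * (b + 1) := by
      exact_mod_cast h
    have hnpos : (0 : ℝ) < n := by rw [ha]; positivity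
    rw [div_mul_eq_mul_div, le_div_iff₀ hnpos]
    have e1 : (n : ℝ) = k + 1 + a := by rw [ha]; push_cast; ring
    have e2 : (m : ℝ) = k + 1 + b := by rw [hb]; push_cast; ring
    have hba : (b : ℝ) ≤ a := by linarith
    have hle : (a.choose b : ℝ) ≤ ((a + 1).choose (b + 1) : ℝ) := by
      exact_mod_cast (Nat.choose_succ_succ a b).symm ▸ Nat.le_add_right _ _
    rw [e1, e2]
    have := mul_le_mul_of_nonneg_left hle (Nat.cast_nonneg k : (0 : ℝ) ≤ k)
    nlinarith
  · have : supersets U m (insert v T) = ∅ := by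
      refine Finset.filter_eq_empty_iff.2 fun B hB h => ?_
      have h1 := Finset.card_le_card h
      rw [Finset.card_insert_of_notMem hvT, (Finset.mem_powersetCard.1 hB).2] at h1
      omega
    rw [this]
    simp only [Finset.card_empty, Nat.cast_zero]
    positivity

/-- A uniformly random `m`-subset containing `T` also contains `S` with probability at most
`(m / n) ^ |S|`. -/
lemma card_supersets_union_le {U T : Finset γ} (hT : T ⊆ U) {S : Finset γ} (hS : S ⊆ U)
    (hd : Disjoint S T) {m : ℕ} (hm : m ≤ U.card) :
    ((supersets U m (S ∪ T)).card : ℝ) ≤ (m / U.card : ℝ) ^ S.card * (supersets U m T).card := by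
  induction S using Finset.induction_on with
  | empty => simp
  | insert v S hv ih =>
    have hvU : v ∈ U := hS (Finset.mem_insert_self v S)
    have hSU : S ⊆ U := (Finset.subset_insert v S).trans hS
    rw [Finset.disjoint_insert_left] at hd
    have h1 := card_supersets_insert_le (Finset.union_subset hSU hT) hvU
      (by simp [hv, hd.1]) hm
    rw [Finset.insert_union, Finset.card_insert_of_notMem hv, pow_succ', mul_assoc]
    exact h1.trans (mul_le_mul_of_nonneg_left (ih hSU hd.2) (by positivity))

lemma pow_card_inter_le {B F T : Finset γ} {D : ℝ} (hD : 1 ≤ D) :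
    D ^ (B ∩ F).card ≤ D ^ T.card * D ^ (B ∩ (F \ T)).card := by
  rw [← pow_add]
  refine pow_le_pow_right₀ hD ((Finset.card_le_card (t := T ∪ (B ∩ (F \ T))) fun x hx => ?_).trans
    (Finset.card_union_le _ _))
  simp only [Finset.mem_inter, Finset.mem_union, Finset.mem_sdiff] at hx ⊢
  tauto

/-- Exponential moments of the intersection of a random `m`-subset with a fixed set. -/
lemma sum_pow_card_inter_le {U T F : Finset γ} (hT : T ⊆ U) (hF : F ⊆ U) {m : ℕ}
    (hm : m ≤ U.card) {D : ℝ} (hD : 1 ≤ D) :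
    ∑ B ∈ supersets U m T, D ^ (B ∩ F).card ≤
      (U.powersetCard m).card * ((m / U.card : ℝ) ^ T.card * D ^ T.card *
        Real.exp ((D - 1) * (m / U.card) * F.card)) := by
  have hx : 0 ≤ (m / U.card : ℝ) := by positivity
  have hD0 : 0 ≤ D - 1 := by linarith
  set x : ℝ := (m / U.card : ℝ)
  -- The points of `T` cost at most `D ^ |T|`. The power over `F \ T` is expanded over subsets `S`,
  -- each weighing at most `((D - 1) * m / n) ^ |S|` relative to the number of admissible `B`; the
  -- sum is a power of `1 + (D - 1) * m / n`, bounded by an exponential.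
  have h1 : ∑ B ∈ supersets U m T, D ^ (B ∩ F).card ≤
      D ^ T.card * ∑ B ∈ supersets U m T, D ^ (B ∩ (F \ T)).card := by
    rw [Finset.mul_sum]
    exact Finset.sum_le_sum fun B _ => pow_card_inter_le hD
  have h2 : ∑ B ∈ supersets U m T, D ^ (B ∩ (F \ T)).card =
      ∑ S ∈ (F \ T).powerset, (D - 1) ^ S.card * ((supersets U m (S ∪ T)).card : ℝ) := by
    have : ∀ B ∈ supersets U m T, D ^ (B ∩ (F \ T)).card =
        ∑ S ∈ (F \ T).powerset, if S ⊆ B then (D - 1) ^ S.card else 0 := by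
      intro B _
      rw [pow_card_eq_sum_powerset, ← Finset.sum_filter]
      refine Finset.sum_congr ?_ fun _ _ => rfl
      ext S
      simp only [Finset.mem_powerset, Finset.mem_filter, Finset.subset_inter_iff]
      tauto
    rw [Finset.sum_congr rfl this, Finset.sum_comm]
    refine Finset.sum_congr rfl fun S _ => ?_
    rw [← Finset.sum_filter, Finset.sum_const, nsmul_eq_mul, mul_comm]
    congr 3
    ext B
    simp only [supersets, Finset.mem_filter, Finset.union_subset_iff]
    tauto
  have h3 : ∑ S ∈ (F \ T).powerset, (D - 1) ^ S.card * ((supersets U m (S ∪ T)).card : ℝ) ≤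
      (supersets U m T).card * ∑ S ∈ (F \ T).powerset, ((D - 1) * x) ^ S.card := by
    rw [Finset.mul_sum]
    refine Finset.sum_le_sum fun S hS => ?_
    have hS := Finset.mem_powerset.1 hS
    have := card_supersets_union_le hT ((hS.trans Finset.sdiff_subset).trans hF)
      (Finset.disjoint_of_subset_left hS Finset.sdiff_disjoint) hm
    calc _ ≤ (D - 1) ^ S.card * (x ^ S.card * (supersets U m T).card) :=
          mul_le_mul_of_nonneg_left this (by positivity)
      _ = _ := by rw [mul_pow]; ring
  have h4 : ∑ S ∈ (F \ T).powerset, ((D - 1) * x) ^ S.card ≤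
      Real.exp ((D - 1) * x * F.card) := by
    have := pow_card_eq_sum_powerset (F \ T) ((D - 1) * x + 1)
    rw [add_sub_cancel_right] at this
    rw [← this, mul_comm _ (F.card : ℝ), Real.exp_nat_mul]
    have hb : (1 : ℝ) ≤ (D - 1) * x + 1 := by nlinarith [mul_nonneg hD0 hx]
    calc _ ≤ ((D - 1) * x + 1) ^ F.card :=
          pow_le_pow_right₀ hb (Finset.card_le_card Finset.sdiff_subset)
      _ ≤ _ := pow_le_pow_left₀ (by linarith) (Real.add_one_le_exp _) _
  have h5 : ((supersets U m T).card : ℝ) ≤ x ^ T.card * (U.powersetCard m).card := by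
    have := card_supersets_union_le (Finset.empty_subset U) hT (Finset.disjoint_empty_right T) hm
    rwa [Finset.union_empty, supersets_empty] at this
  calc _ ≤ _ := h1
    _ ≤ D ^ T.card * ((supersets U m T).card * Real.exp ((D - 1) * x * F.card)) := by
      rw [h2]
      exact mul_le_mul_of_nonneg_left (h3.trans (mul_le_mul_of_nonneg_left h4 (by positivity)))
        (by positivity)
    _ ≤ D ^ T.card * ((x ^ T.card * (U.powersetCard m).card) *
        Real.exp ((D - 1) * x * F.card)) := by gcongr
    _ = _ := by ring

end Subsets

/-! ### Intersections of two random vertex sets. -/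

section Counting

variable {γ : Type*} [DecidableEq γ]

/-- Left vertex sets always contain `i`, so membership of `i` is free and only the points of `T \
{i}` cost a factor `m / n` each. -/
lemma card_supersets_singleton_filter_le {U : Finset γ} {i : γ} (hi : i ∈ U) {T : Finset γ}
    (hT : T ⊆ U) {m : ℕ} (hm : m ≤ U.card) :
    (((supersets U m {i}).filter (T ⊆ ·)).card : ℝ) ≤
      (m / U.card : ℝ) ^ (T \ {i}).card * (supersets U m {i}).card := by
  have h := card_supersets_union_le (Finset.singleton_subset_iff.2 hi)
    (Finset.sdiff_subset.trans hT) (Finset.sdiff_disjoint (t := T) (s := {i})) hm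
  refine le_trans (le_of_eq ?_) h
  congr 2
  ext A
  simp only [supersets, Finset.mem_filter, Finset.union_subset_iff, and_assoc]
  refine and_congr_right fun _ => ⟨fun h => ⟨Finset.sdiff_subset.trans h.2, h.1⟩, fun h =>
    ⟨h.2, fun x hx => ?_⟩⟩
  by_cases hxi : x = i
  · exact hxi ▸ h.2 (Finset.mem_singleton_self i)
  · exact h.1 (by simp [hx, hxi])

lemma card_inter_eq_sum (A F : Finset γ) :
    ((A ∩ F).card : ℝ) = ∑ u ∈ F, if u ∈ A then 1 else 0 := by
  rw [Finset.sum_boole, Finset.filter_mem_eq_inter, Finset.inter_comm]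

lemma card_offDiag_inter_eq_sum (A F : Finset γ) :
    ((A ∩ F).offDiag.card : ℝ) = ∑ u ∈ F.offDiag, if u.1 ∈ A ∧ u.2 ∈ A then 1 else 0 := by
  rw [Finset.sum_boole]
  congr 2
  ext u
  simp only [Finset.mem_offDiag, Finset.mem_inter, Finset.mem_filter]
  tauto

/-- Linearity of expectation: counts of points or pairs inside a random set are summed one point or
pair at a time. -/
lemma sum_sum_ite_eq {δ : Type*} (s : Finset (Finset γ)) (F : Finset δ) (T : δ → Finset γ)
    (g : Finset γ → ℝ) :
    ∑ A ∈ s, g A * ∑ u ∈ F, (if T u ⊆ A then (1 : ℝ) else 0) =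
      ∑ u ∈ F, ∑ A ∈ s.filter (T u ⊆ ·), g A := by
  simp_rw [Finset.mul_sum]
  rw [Finset.sum_comm]
  refine Finset.sum_congr rfl fun u _ => ?_
  rw [Finset.sum_filter]
  refine Finset.sum_congr rfl fun A _ => ?_
  split_ifs <;> simp

lemma pair_subset_iff (u : γ × γ) (A : Finset γ) :
    ({u.1, u.2} : Finset γ) ⊆ A ↔ u.1 ∈ A ∧ u.2 ∈ A := by
  simp [Finset.insert_subset_iff]

lemma sum_card_inter_le {U : Finset γ} {i : γ} (hi : i ∈ U) {F : Finset γ} (hF : F ⊆ U) {m : ℕ}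
    (hm : m ≤ U.card) :
    ∑ A ∈ supersets U m {i}, ((A ∩ F).card : ℝ) ≤
      (supersets U m {i}).card * (1 + F.card * (m / U.card)) := by
  have h := sum_sum_ite_eq (supersets U m {i}) F (fun u => {u}) fun _ => 1
  simp only [Finset.singleton_subset_iff, one_mul, Finset.sum_const, nsmul_eq_mul, mul_one] at h
  simp_rw [card_inter_eq_sum, h]
  have hx : 0 ≤ (m / U.card : ℝ) := by positivity
  set x : ℝ := m / U.card
  set N : ℝ := ((supersets U m {i}).card : ℝ)
  have hN : 0 ≤ N := Nat.cast_nonneg _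
  have hb : ∀ u ∈ F, (((supersets U m {i}).filter (u ∈ ·)).card : ℝ) ≤
      (if u = i then N else 0) + x * N := by
    intro u hu
    have := card_supersets_singleton_filter_le hi (Finset.singleton_subset_iff.2 (hF hu)) hm
    simp only [Finset.singleton_subset_iff] at this
    refine this.trans ?_
    split_ifs with hui
    · subst hui; simp only [sdiff_self, Finset.bot_eq_empty, Finset.card_empty, pow_zero, one_mul]
      nlinarith
    · rw [Finset.sdiff_eq_self_of_disjoint (by simpa using hui)]; simp [x, N]
  refine (Finset.sum_le_sum hb).trans ?_
  rw [Finset.sum_add_distrib, Finset.sum_const, nsmul_eq_mul]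
  have : ∑ u ∈ F, (if u = i then N else 0) ≤ N := by
    rw [Finset.sum_ite_eq' F i]; split_ifs <;> linarith
  nlinarith

/-- Once `A` is forced to contain `i` and `u`, these two vertices contribute at most `2` to the
intersection and every other point of `F` contributes `m / n`. -/
lemma sum_card_inter_mem_le {U : Finset γ} {i u : γ} (hi : i ∈ U) (hu : u ∈ U) {F : Finset γ}
    (hF : F ⊆ U) {m : ℕ} (hm : m ≤ U.card) :
    ∑ A ∈ (supersets U m {i}).filter (u ∈ ·), ((A ∩ F).card : ℝ) ≤
      (supersets U m {i}).card * ((if u = i then 1 else m / U.card : ℝ) *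
        (2 + F.card * (m / U.card))) := by
  have h := sum_sum_ite_eq ((supersets U m {i}).filter (u ∈ ·)) F (fun u => {u}) fun _ => 1
  simp only [Finset.singleton_subset_iff, one_mul, Finset.sum_const, nsmul_eq_mul, mul_one] at h
  simp_rw [card_inter_eq_sum, h]
  have hx : 0 ≤ (m / U.card : ℝ) := by positivity
  set x : ℝ := m / U.card
  set N : ℝ := ((supersets U m {i}).card : ℝ)
  have hN : 0 ≤ N := Nat.cast_nonneg _
  set r : ℝ := if u = i then 1 else x with hr
  have hr0 : 0 ≤ r := by rw [hr]; split_ifs <;> linarith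
  have hpair : ∀ w : γ, ((supersets U m {i}).filter (u ∈ ·)).filter (w ∈ ·) =
      (supersets U m {i}).filter (({u, w} : Finset γ) ⊆ ·) := by
    intro w
    rw [Finset.filter_filter]
    refine Finset.filter_congr fun A _ => ?_
    simp [Finset.insert_subset_iff]
  have hb : ∀ w ∈ F, ((((supersets U m {i}).filter (u ∈ ·)).filter (w ∈ ·)).card : ℝ) ≤
      (if w = i then r * N else 0) + (if w = u then r * N else 0) + r * x * N := by
    intro w hw
    have := card_supersets_singleton_filter_le hi (T := {u, w})
      (Finset.insert_subset hu (Finset.singleton_subset_iff.2 (hF hw))) hm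
    rw [hpair]
    refine this.trans ?_
    change x ^ _ * N ≤ _
    have hrN : 0 ≤ r * N := mul_nonneg hr0 hN
    have hrxN : 0 ≤ r * x * N := mul_nonneg (mul_nonneg hr0 hx) hN
    by_cases hui : u = i
    · have hr1 : r = 1 := by rw [hr, if_pos hui]
      subst hui
      by_cases hwi : w = u
      · subst hwi
        simp only [Finset.insert_eq_of_mem, Finset.mem_singleton, sdiff_self, Finset.bot_eq_empty,
          Finset.card_empty, pow_zero, if_true, hr1]
        nlinarith
      · have : (({u, w} : Finset γ) \ {u}).card = 1 := by
          rw [Finset.insert_sdiff_of_mem _ (Finset.mem_singleton_self u),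
            Finset.sdiff_eq_self_of_disjoint (by simpa using hwi)]
          simp
        rw [this]
        simp [hwi, hr1]
    · have hr1 : r = x := by rw [hr, if_neg hui]
      by_cases hwi : w = i
      · subst hwi
        have : (({u, w} : Finset γ) \ {w}).card = 1 := by
          rw [Finset.pair_comm, Finset.insert_sdiff_of_mem _ (Finset.mem_singleton_self w),
            Finset.sdiff_eq_self_of_disjoint (by simpa using hui)]
          simp
        rw [this, if_pos rfl, pow_one, hr1]
        rw [hr1] at hrN hrxN
        split_ifs <;> linarith
      · have hd : Disjoint ({u, w} : Finset γ) {i} := by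
          simp [Ne.symm hui, Ne.symm hwi]
        rw [Finset.sdiff_eq_self_of_disjoint hd]
        by_cases hwu : w = u
        · subst hwu
          simp only [Finset.insert_eq_of_mem, Finset.mem_singleton, Finset.card_singleton, pow_one,
            if_neg hwi, if_true]
          rw [hr1] at hrN hrxN ⊢
          linarith
        · rw [Finset.card_pair (Ne.symm hwu), if_neg hwi, if_neg hwu, hr1]
          apply le_of_eq; ring
  refine (Finset.sum_le_sum hb).trans ?_
  rw [Finset.sum_add_distrib, Finset.sum_add_distrib, Finset.sum_const, nsmul_eq_mul]
  have hrN : 0 ≤ r * N := mul_nonneg hr0 hN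
  have h1 : ∀ j, ∑ w ∈ F, (if w = j then r * N else 0) ≤ r * N := by
    intro j; rw [Finset.sum_ite_eq' F j]; split_ifs <;> linarith
  have := h1 i
  have := h1 u
  nlinarith

/-- Ordered pairs involving `i` cost one factor `m / n`, with two possible positions for `i`; all
other pairs cost `(m / n) ^ 2`. -/
lemma sum_card_offDiag_inter_le {U : Finset γ} {i : γ} (hi : i ∈ U) {F : Finset γ} (hF : F ⊆ U)
    {m : ℕ} (hm : m ≤ U.card) :
    ∑ A ∈ supersets U m {i}, ((A ∩ F).offDiag.card : ℝ) ≤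
      (supersets U m {i}).card * (2 * (F.card * (m / U.card)) + (F.card * (m / U.card)) ^ 2) := by
  have h := sum_sum_ite_eq (supersets U m {i}) F.offDiag (fun u => {u.1, u.2}) fun _ => 1
  simp only [pair_subset_iff, one_mul, Finset.sum_const, nsmul_eq_mul, mul_one] at h
  simp_rw [card_offDiag_inter_eq_sum, h]
  have hx : 0 ≤ (m / U.card : ℝ) := by positivity
  set x : ℝ := m / U.card
  set N : ℝ := ((supersets U m {i}).card : ℝ)
  have hN : 0 ≤ N := Nat.cast_nonneg _
  have hb : ∀ u ∈ F.offDiag,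
      (((supersets U m {i}).filter (fun A => u.1 ∈ A ∧ u.2 ∈ A)).card : ℝ) ≤
      (if u.1 = i then x * N else 0) + (if u.2 = i then x * N else 0) + x ^ 2 * N := by
    intro u hu
    simp only [Finset.mem_offDiag] at hu
    have := card_supersets_singleton_filter_le hi (T := {u.1, u.2})
      (Finset.insert_subset (hF hu.1) (Finset.singleton_subset_iff.2 (hF hu.2.1))) hm
    simp only [pair_subset_iff] at this
    refine this.trans ?_
    have hxN : 0 ≤ x * N := mul_nonneg hx hN
    have hxxN : 0 ≤ x ^ 2 * N := by positivity
    change x ^ _ * N ≤ _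
    by_cases h1 : u.1 = i
    · have h2 : u.2 ≠ i := fun h => hu.2.2 (h1.trans h.symm)
      have : (({u.1, u.2} : Finset γ) \ {i}).card = 1 := by
        rw [Finset.insert_sdiff_of_mem _ (by simp [h1]),
          Finset.sdiff_eq_self_of_disjoint (by simpa using h2)]
        simp
      rw [this, if_pos h1, pow_one, if_neg h2]; linarith
    · by_cases h2 : u.2 = i
      · have : (({u.1, u.2} : Finset γ) \ {i}).card = 1 := by
          rw [Finset.pair_comm, Finset.insert_sdiff_of_mem _ (by simp [h2]),
            Finset.sdiff_eq_self_of_disjoint (by simpa using h1)]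
          simp
        rw [this, if_neg h1, pow_one, if_pos h2]; linarith
      · rw [Finset.sdiff_eq_self_of_disjoint (by simp [Ne.symm h1, Ne.symm h2]), Finset.card_pair hu.2.2,
          if_neg h1, if_neg h2]
        linarith
  refine (Finset.sum_le_sum hb).trans ?_
  have hsub : F.offDiag ⊆ F ×ˢ F := fun u hu => by
    simp only [Finset.mem_offDiag] at hu; simp [hu.1, hu.2.1]
  have hxN : 0 ≤ x * N := mul_nonneg hx hN
  refine (Finset.sum_le_sum_of_subset_of_nonneg hsub fun u _ _ => ?_).trans ?_
  · split_ifs <;> positivity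
  rw [Finset.sum_add_distrib, Finset.sum_add_distrib, Finset.sum_const, nsmul_eq_mul,
    Finset.card_product]
  have h1 : ∑ w ∈ F, (if w = i then x * N else 0) ≤ x * N := by
    rw [Finset.sum_ite_eq' F i]; split_ifs <;> linarith
  have h2 := mul_le_mul_of_nonneg_left h1 (Nat.cast_nonneg F.card : (0 : ℝ) ≤ _)
  have h3 : ∑ u ∈ F ×ˢ F, (if u.1 = i then x * N else 0) =
      F.card * ∑ w ∈ F, (if w = i then x * N else 0) := by
    rw [Finset.sum_product_right]
    exact (Finset.sum_const (∑ w ∈ F, (if w = i then x * N else 0))).trans (nsmul_eq_mul _ _)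
  have h4 : ∑ u ∈ F ×ˢ F, (if u.2 = i then x * N else 0) =
      F.card * ∑ w ∈ F, (if w = i then x * N else 0) := by
    rw [Finset.sum_product]
    exact (Finset.sum_const (∑ w ∈ F, (if w = i then x * N else 0))).trans (nsmul_eq_mul _ _)
  rw [h3, h4]
  push_cast
  nlinarith

variable {U : Finset γ} {m : ℕ} {D : ℝ}

lemma sum_pow_mul_card_inter_le {F G : Finset γ} (hF : F ⊆ U) (hG : G ⊆ U)
    (hm : m ≤ U.card) (hD : 1 ≤ D) :
    ∑ B ∈ U.powersetCard m, D ^ (B ∩ F).card * ((B ∩ G).card : ℝ) ≤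
      (U.powersetCard m).card * (G.card * (m / U.card) * D *
        Real.exp ((D - 1) * (m / U.card) * F.card)) := by
  have h := sum_sum_ite_eq (U.powersetCard m) G (fun u => {u}) fun B => D ^ (B ∩ F).card
  simp only [Finset.singleton_subset_iff] at h
  simp_rw [card_inter_eq_sum _ G, h]
  have hb : ∀ u ∈ G, ∑ B ∈ (U.powersetCard m).filter (u ∈ ·), D ^ (B ∩ F).card ≤
      (U.powersetCard m).card * ((m / U.card : ℝ) * D *
        Real.exp ((D - 1) * (m / U.card) * F.card)) := by
    intro u hu
    have := sum_pow_card_inter_le (Finset.singleton_subset_iff.2 (hG hu)) hF hm hD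
    simpa only [supersets, Finset.singleton_subset_iff, Finset.card_singleton, pow_one] using this
  refine (Finset.sum_le_sum hb).trans (le_of_eq ?_)
  rw [Finset.sum_const, nsmul_eq_mul]; ring

lemma sum_pow_mul_card_offDiag_inter_le {F G : Finset γ} (hF : F ⊆ U) (hG : G ⊆ U)
    (hm : m ≤ U.card) (hD : 1 ≤ D) :
    ∑ B ∈ U.powersetCard m, D ^ (B ∩ F).card * ((B ∩ G).offDiag.card : ℝ) ≤
      (U.powersetCard m).card * ((G.card * (m / U.card) * D) ^ 2 *
        Real.exp ((D - 1) * (m / U.card) * F.card)) := by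
  have h := sum_sum_ite_eq (U.powersetCard m) G.offDiag (fun u => {u.1, u.2})
    fun B => D ^ (B ∩ F).card
  simp only [pair_subset_iff] at h
  simp_rw [card_offDiag_inter_eq_sum _ G, h]
  have hb : ∀ u ∈ G.offDiag,
      ∑ B ∈ (U.powersetCard m).filter (fun B => u.1 ∈ B ∧ u.2 ∈ B), D ^ (B ∩ F).card ≤
      (U.powersetCard m).card * (((m / U.card : ℝ) * D) ^ 2 *
        Real.exp ((D - 1) * (m / U.card) * F.card)) := by
    intro u hu
    simp only [Finset.mem_offDiag] at hu
    have := sum_pow_card_inter_le (T := {u.1, u.2})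
      (Finset.insert_subset (hG hu.1) (Finset.singleton_subset_iff.2 (hG hu.2.1))) hF hm hD
    simpa only [supersets, pair_subset_iff, Finset.card_pair hu.2.2, ← mul_pow] using this
  refine (Finset.sum_le_sum hb).trans ?_
  rw [Finset.sum_const, nsmul_eq_mul]
  have hc : (G.offDiag.card : ℝ) ≤ (G.card : ℝ) ^ 2 := by
    rw [Finset.offDiag_card, sq]; exact_mod_cast Nat.sub_le _ _
  refine (mul_le_mul_of_nonneg_right hc (by positivity)).trans (le_of_eq ?_)
  ring

/-- Two distinct points of a product differ in both coordinates, only in the first, or only in the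
second. -/
lemma card_offDiag_product (X Y : Finset γ) :
    ((X ×ˢ Y).offDiag.card : ℝ) = X.offDiag.card * Y.offDiag.card + X.offDiag.card * Y.card +
      X.card * Y.offDiag.card := by
  have h : ∀ {δ : Type _} [DecidableEq δ] (Z : Finset δ),
      (Z.offDiag.card : ℝ) = (Z.card : ℝ) * Z.card - Z.card := by
    intro δ _ Z
    rw [Finset.offDiag_card, Nat.cast_sub (Nat.le_mul_self _)]; push_cast; ring
  rw [h, h X, h Y, Finset.card_product]
  push_cast; ring

/-- The weighted number of pairs of common edges of two random vertex sets. -/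
lemma exists_sum_pow_mul_card_offDiag_le (D L : ℝ) (hD : 1 ≤ D) (hL : 0 ≤ L) :
    ∃ C : ℝ, 0 ≤ C ∧ ∀ {γ : Type} [DecidableEq γ] {U : Finset γ} {m : ℕ} {b : Finset γ} {i : γ},
      m ≤ U.card → 0 < U.card → b ⊆ U → i ∈ U → (m : ℝ) ^ 2 ≤ L * U.card →
      (m : ℝ) * b.card ≤ L * U.card →
      ∑ A ∈ supersets U m {i}, ∑ B ∈ U.powersetCard m,
        ∑ A' ∈ supersets U m {i}, ∑ B' ∈ U.powersetCard m,
          D ^ ((B ∩ b).card + (B' ∩ b).card + (B ∩ B').card) *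
            ((((A ∩ A') ×ˢ (B ∩ B')).offDiag.card : ℝ)) ≤
        (((supersets U m {i}).card : ℝ) * (U.powersetCard m).card) ^ 2 *
          (C * ((m : ℝ) ^ 2 / U.card) ^ 2) := by
  set E := Real.exp ((D ^ 2 - 1) * (2 * L)) * Real.exp ((D - 1) * L) with hE
  have hE0 : 0 ≤ E := by positivity
  -- One summand for each term of `card_offDiag_product`. With `y = m ^ 2 / n ≤ L` the terms have
  -- orders `y * y ^ 2`, `y * y` and `1 * y ^ 2`, and one factor `y` of the first is replaced by
  -- `L`. In `E`, the exponent `2 * L` bounds `m * |b ∪ B'| / n` and the exponent `L` bounds `m *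
  -- |b| / n`.
  refine ⟨(2 + L) * L * ((D ^ 2) ^ 2 * E) + (2 + L) * (D ^ 2 * E) + (1 + L) * ((D ^ 2) ^ 2 * E),
    by positivity, ?_⟩
  intro γ _ U m b i hm hU hb hi hmL hmb
  have hn : (0 : ℝ) < U.card := by exact_mod_cast hU
  set y : ℝ := (m : ℝ) ^ 2 / U.card with hy
  have hy0 : 0 ≤ y := by positivity
  have hyL : y ≤ L := (div_le_iff₀ hn).2 hmL
  have hmm : (m : ℝ) * (m / U.card) = y := by rw [hy]; ring
  have hD0 : 0 ≤ D := by linarith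
  have hD2 : 1 ≤ D ^ 2 := one_le_pow₀ hD
  set 𝒜 := supersets U m {i}
  set ℬ := U.powersetCard m
  have h𝒜U : ∀ A ∈ 𝒜, A ⊆ U ∧ A.card = m := fun A hA =>
    Finset.mem_powersetCard.1 (Finset.mem_filter.1 hA).1
  have hℬU : ∀ B ∈ ℬ, B ⊆ U ∧ B.card = m := fun B hB => Finset.mem_powersetCard.1 hB
  set a : ℝ := (𝒜.card : ℝ)
  set c : ℝ := (ℬ.card : ℝ)
  have ha0 : 0 ≤ a := Nat.cast_nonneg _
  have hc0 : 0 ≤ c := Nat.cast_nonneg _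
  set w : Finset γ → Finset γ → ℝ := fun B B' => D ^ ((B ∩ b).card + (B' ∩ b).card + (B ∩ B').card)
  have hw0 : ∀ B B', 0 ≤ w B B' := fun B B' => by positivity
  -- The weight involves right vertex sets only, so each term factors into a left sum and a right
  -- sum.
  have hsplit : ∑ A ∈ 𝒜, ∑ B ∈ ℬ, ∑ A' ∈ 𝒜, ∑ B' ∈ ℬ,
      w B B' * ((((A ∩ A') ×ˢ (B ∩ B')).offDiag.card : ℝ)) =
      (∑ A ∈ 𝒜, ∑ A' ∈ 𝒜, ((A ∩ A').offDiag.card : ℝ)) *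
        (∑ B ∈ ℬ, ∑ B' ∈ ℬ, w B B' * ((B ∩ B').offDiag.card : ℝ)) +
      (∑ A ∈ 𝒜, ∑ A' ∈ 𝒜, ((A ∩ A').offDiag.card : ℝ)) *
        (∑ B ∈ ℬ, ∑ B' ∈ ℬ, w B B' * ((B ∩ B').card : ℝ)) +
      (∑ A ∈ 𝒜, ∑ A' ∈ 𝒜, ((A ∩ A').card : ℝ)) *
        (∑ B ∈ ℬ, ∑ B' ∈ ℬ, w B B' * ((B ∩ B').offDiag.card : ℝ)) := by
    simp only [Finset.sum_mul_sum, ← Finset.sum_add_distrib]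
    refine Finset.sum_congr rfl fun A _ => Finset.sum_congr rfl fun B _ =>
      Finset.sum_congr rfl fun A' _ => Finset.sum_congr rfl fun B' _ => ?_
    rw [card_offDiag_product]; ring
  have hx1 : ∑ A ∈ 𝒜, ∑ A' ∈ 𝒜, ((A ∩ A').card : ℝ) ≤ a * (a * (1 + L)) := by
    rw [Finset.sum_comm]
    calc _ ≤ ∑ A' ∈ 𝒜, a * (1 + L) := Finset.sum_le_sum fun A' hA' => by
          have := sum_card_inter_le hi (h𝒜U A' hA').1 hm
          rw [(h𝒜U A' hA').2, hmm] at this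
          exact this.trans (by gcongr)
      _ = _ := by rw [Finset.sum_const, nsmul_eq_mul]
  have hx2 : ∑ A ∈ 𝒜, ∑ A' ∈ 𝒜, ((A ∩ A').offDiag.card : ℝ) ≤ a * (a * ((2 + L) * y)) := by
    rw [Finset.sum_comm]
    calc _ ≤ ∑ A' ∈ 𝒜, a * ((2 + L) * y) := Finset.sum_le_sum fun A' hA' => by
          have := sum_card_offDiag_inter_le hi (h𝒜U A' hA').1 hm
          rw [(h𝒜U A' hA').2, hmm] at this
          refine this.trans (mul_le_mul_of_nonneg_left ?_ ha0)
          nlinarith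
      _ = _ := by rw [Finset.sum_const, nsmul_eq_mul]
  -- For fixed `B'`, the intersections of `B` with `b` and with `B'` are both absorbed into one
  -- intersection with `b ∪ B'`, at the price of squaring `D`.
  have hwle : ∀ B B', w B B' ≤ D ^ (B' ∩ b).card * (D ^ 2) ^ (B ∩ (b ∪ B')).card := by
    intro B B'
    simp only [w]
    rw [← pow_mul, ← pow_add]
    refine pow_le_pow_right₀ hD ?_
    have h1 : (B ∩ b).card ≤ (B ∩ (b ∪ B')).card :=
      Finset.card_le_card (Finset.inter_subset_inter le_rfl Finset.subset_union_left)
    have h2 : (B ∩ B').card ≤ (B ∩ (b ∪ B')).card :=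
      Finset.card_le_card (Finset.inter_subset_inter le_rfl Finset.subset_union_right)
    omega
  have hexp : ∀ B' ∈ ℬ, Real.exp ((D ^ 2 - 1) * (m / U.card) * (b ∪ B').card) ≤
      Real.exp ((D ^ 2 - 1) * (2 * L)) := by
    intro B' hB'
    refine Real.exp_le_exp.2 ?_
    rw [mul_assoc]
    refine mul_le_mul_of_nonneg_left ?_ (by linarith)
    have h1 : ((b ∪ B').card : ℝ) ≤ b.card + m := by
      rw [← (hℬU B' hB').2]; exact_mod_cast Finset.card_union_le _ _
    rw [div_mul_eq_mul_div, div_le_iff₀ hn]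
    have := mul_le_mul_of_nonneg_left h1 (Nat.cast_nonneg m : (0 : ℝ) ≤ m)
    nlinarith
  have hDb : ∑ B' ∈ ℬ, D ^ (B' ∩ b).card ≤ c * Real.exp ((D - 1) * L) := by
    have := sum_pow_card_inter_le (Finset.empty_subset U) hb hm hD
    rw [supersets_empty, Finset.card_empty, pow_zero, pow_zero, one_mul, one_mul] at this
    refine this.trans (mul_le_mul_of_nonneg_left (Real.exp_le_exp.2 ?_) hc0)
    rw [mul_assoc]
    refine mul_le_mul_of_nonneg_left ?_ (by linarith)
    rw [div_mul_eq_mul_div, div_le_iff₀ hn]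
    exact hmb
  have hy1 : ∑ B ∈ ℬ, ∑ B' ∈ ℬ, w B B' * ((B ∩ B').card : ℝ) ≤ c * (c * (y * (D ^ 2 * E))) := by
    rw [Finset.sum_comm]
    calc _ ≤ ∑ B' ∈ ℬ, D ^ (B' ∩ b).card * (c * (y * D ^ 2 *
          Real.exp ((D ^ 2 - 1) * (2 * L)))) := Finset.sum_le_sum fun B' hB' => by
          have h1 := sum_pow_mul_card_inter_le (Finset.union_subset hb (hℬU B' hB').1)
            (hℬU B' hB').1 hm hD2
          rw [(hℬU B' hB').2, hmm] at h1
          calc _ ≤ ∑ B ∈ ℬ, D ^ (B' ∩ b).card *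
                ((D ^ 2) ^ (B ∩ (b ∪ B')).card * ((B ∩ B').card : ℝ)) :=
                Finset.sum_le_sum fun B _ => by
                  rw [← mul_assoc]
                  exact mul_le_mul_of_nonneg_right (hwle B B') (Nat.cast_nonneg _)
            _ ≤ _ := by
              rw [← Finset.mul_sum]
              refine mul_le_mul_of_nonneg_left (h1.trans ?_) (by positivity)
              have := hexp B' hB'
              gcongr
      _ ≤ (c * Real.exp ((D - 1) * L)) * (c * (y * D ^ 2 *
          Real.exp ((D ^ 2 - 1) * (2 * L)))) := by
          rw [← Finset.sum_mul]
          exact mul_le_mul_of_nonneg_right hDb (by positivity)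
      _ = _ := by rw [hE]; ring
  have hy2 : ∑ B ∈ ℬ, ∑ B' ∈ ℬ, w B B' * ((B ∩ B').offDiag.card : ℝ) ≤
      c * (c * (y ^ 2 * ((D ^ 2) ^ 2 * E))) := by
    rw [Finset.sum_comm]
    calc _ ≤ ∑ B' ∈ ℬ, D ^ (B' ∩ b).card * (c * ((y * D ^ 2) ^ 2 *
          Real.exp ((D ^ 2 - 1) * (2 * L)))) := Finset.sum_le_sum fun B' hB' => by
          have h1 := sum_pow_mul_card_offDiag_inter_le (Finset.union_subset hb (hℬU B' hB').1)
            (hℬU B' hB').1 hm hD2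
          rw [(hℬU B' hB').2, hmm] at h1
          calc _ ≤ ∑ B ∈ ℬ, D ^ (B' ∩ b).card *
                ((D ^ 2) ^ (B ∩ (b ∪ B')).card * ((B ∩ B').offDiag.card : ℝ)) :=
                Finset.sum_le_sum fun B _ => by
                  rw [← mul_assoc]
                  exact mul_le_mul_of_nonneg_right (hwle B B') (Nat.cast_nonneg _)
            _ ≤ _ := by
              rw [← Finset.mul_sum]
              refine mul_le_mul_of_nonneg_left (h1.trans ?_) (by positivity)
              have := hexp B' hB'
              gcongr
      _ ≤ (c * Real.exp ((D - 1) * L)) * (c * ((y * D ^ 2) ^ 2 *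
          Real.exp ((D ^ 2 - 1) * (2 * L)))) := by
          rw [← Finset.sum_mul]
          exact mul_le_mul_of_nonneg_right hDb (by positivity)
      _ = _ := by rw [hE]; ring
  have z1 : 0 ≤ ∑ B ∈ ℬ, ∑ B' ∈ ℬ, w B B' * ((B ∩ B').card : ℝ) :=
    Finset.sum_nonneg fun B _ => Finset.sum_nonneg fun B' _ => mul_nonneg (hw0 _ _) (by positivity)
  have z2 : 0 ≤ ∑ B ∈ ℬ, ∑ B' ∈ ℬ, w B B' * ((B ∩ B').offDiag.card : ℝ) :=
    Finset.sum_nonneg fun B _ => Finset.sum_nonneg fun B' _ => mul_nonneg (hw0 _ _) (by positivity)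
  rw [hsplit]
  clear_value a c y E w
  have f1 := mul_le_mul hx2 hy2 z2
    (show 0 ≤ a * (a * ((2 + L) * y)) by positivity)
  have f2 := mul_le_mul hx2 hy1 z1
    (show 0 ≤ a * (a * ((2 + L) * y)) by positivity)
  have f3 := mul_le_mul hx1 hy2 z2
    (show 0 ≤ a * (a * (1 + L)) by positivity)
  have f1' : a * (a * ((2 + L) * y)) * (c * (c * (y ^ 2 * ((D ^ 2) ^ 2 * E)))) ≤
      a * (a * ((2 + L) * L)) * (c * (c * (y ^ 2 * ((D ^ 2) ^ 2 * E)))) := by gcongr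
  calc _ ≤ _ := add_le_add (add_le_add (f1.trans f1') f2) f3
    _ = _ := by ring

end Counting

/-! ### The weight as a multilinear polynomial in the centered edges. -/

section Expansion

/-- The edges of the perfect matching of `A` and `B` given by a bijection. -/
def edgeSet {A B : Finset ℕ} (σ : ↥A ≃ ↥B) : Finset (ℕ × ℕ) :=
  Finset.univ.image fun u : ↥A => ((u : ℕ), ((σ u : ↥B) : ℕ))

lemma mem_edgeSet {A B : Finset ℕ} (σ : ↥A ≃ ↥B) (e : ℕ × ℕ) :
    e ∈ edgeSet σ ↔ ∃ u : ↥A, (u : ℕ) = e.1 ∧ ((σ u : ↥B) : ℕ) = e.2 := by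
  simp only [edgeSet, Finset.mem_image, Finset.mem_univ, true_and, Prod.ext_iff]

lemma mk_mem_edgeSet {A B : Finset ℕ} (σ : ↥A ≃ ↥B) (a : ↥A) (b : ↥B) :
    ((a : ℕ), (b : ℕ)) ∈ edgeSet σ ↔ σ a = b := by
  rw [mem_edgeSet]
  constructor
  · rintro ⟨u, hu, hb⟩
    rw [← Subtype.ext hu]
    exact Subtype.ext hb
  · rintro rfl; exact ⟨a, rfl, rfl⟩

lemma edgeSet_subset {A B : Finset ℕ} (σ : ↥A ≃ ↥B) : edgeSet σ ⊆ A ×ˢ B := by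
  intro e he
  obtain ⟨u, h1, h2⟩ := (mem_edgeSet σ e).1 he
  rw [Finset.mem_product, ← h1, ← h2]
  exact ⟨u.2, (σ u).2⟩

lemma edgeSet_injOn_fst {A B : Finset ℕ} (σ : ↥A ≃ ↥B) :
    Function.Injective fun u : ↥A => ((u : ℕ), ((σ u : ↥B) : ℕ)) := fun _ _ h =>
  Subtype.ext (Prod.ext_iff.1 h).1

lemma prod_edgeSet {A B : Finset ℕ} (σ : ↥A ≃ ↥B) (f : ℕ × ℕ → ℝ) :
    ∏ e ∈ edgeSet σ, f e = ∏ u : ↥A, f (u, σ u) := by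
  rw [edgeSet, Finset.prod_image fun _ _ _ _ h => edgeSet_injOn_fst σ h]

lemma card_edgeSet {A B : Finset ℕ} (σ : ↥A ≃ ↥B) : (edgeSet σ).card = A.card := by
  rw [edgeSet, Finset.card_image_of_injective _ (edgeSet_injOn_fst σ)]
  simp

lemma card_edgeSet_inter {A B : Finset ℕ} (σ τ : ↥A ≃ ↥B) :
    (edgeSet σ ∩ edgeSet τ).card = agree σ τ := by
  have : edgeSet σ ∩ edgeSet τ = (Finset.univ.filter fun u => σ u = τ u).image
      fun u : ↥A => ((u : ℕ), ((σ u : ↥B) : ℕ)) := by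
    ext e
    simp only [Finset.mem_inter, mem_edgeSet, Finset.mem_image, Finset.mem_filter,
      Finset.mem_univ, true_and, Prod.ext_iff]
    constructor
    · rintro ⟨⟨u, h1, h2⟩, v, h3, h4⟩
      have : v = u := Subtype.ext (h3.trans h1.symm)
      subst this
      exact ⟨v, Subtype.ext (h2.trans h4.symm), h1, h2⟩
    · rintro ⟨u, h, h1, h2⟩
      exact ⟨⟨u, h1, h2⟩, u, h1, by rw [← h]; exact h2⟩
  rw [this, Finset.card_image_of_injective _ (edgeSet_injOn_fst σ), agree]

/-- A matching has at most one edge at every right vertex. -/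
lemma card_edgeSet_inter_le {A B : Finset ℕ} (σ : ↥A ≃ ↥B) (Q : Finset (ℕ × ℕ)) (b : Finset ℕ)
    (hQ : ∀ e ∈ Q, e.2 ∈ b) : (edgeSet σ ∩ Q).card ≤ (B ∩ b).card := by
  refine Finset.card_le_card_of_injOn Prod.snd (fun e he => ?_) fun e he e' he' h => ?_
  · have he := Finset.mem_inter.1 he
    exact Finset.mem_inter.2
      ⟨(Finset.mem_product.1 (edgeSet_subset σ he.1)).2, hQ e he.2⟩
  · obtain ⟨u, h1, h2⟩ := (mem_edgeSet σ e).1 (Finset.mem_inter.1 he).1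
    obtain ⟨v, h3, h4⟩ := (mem_edgeSet σ e').1 (Finset.mem_inter.1 he').1
    have huv : u = v := σ.injective (Subtype.ext (by rw [h2, h4]; exact h))
    exact Prod.ext (by rw [← h1, ← h3, huv]) h

/-- A pair of vertex sets with two bijections between them. -/
abbrev Config : Type :=
  Σ AB : Finset ℕ × Finset ℕ, (↥AB.1 ≃ ↥AB.2) × (↥AB.1 ≃ ↥AB.2)

/-- The configurations contributing to the weight of the vertex `i`. -/
def configs (n m i : ℕ) : Finset Config :=
  (supersets (side n) m {i} ×ˢ (side n).powersetCard m).sigma fun _ => Finset.univ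

lemma sum_configs (n m i : ℕ) (f : Config → ℝ) :
    ∑ κ ∈ configs n m i, f κ = ∑ A ∈ supersets (side n) m {i},
      ∑ B ∈ (side n).powersetCard m, ∑ σ : ↥A ≃ ↥B, ∑ τ : ↥A ≃ ↥B, f ⟨(A, B), (σ, τ)⟩ := by
  rw [configs, Finset.sum_sigma, Finset.sum_product]
  refine Finset.sum_congr rfl fun A _ => Finset.sum_congr rfl fun B _ => ?_
  rw [← Finset.univ_product_univ, Finset.sum_product]

/-- The union of the two matchings of a configuration. -/
def Config.edges (κ : Config) : Finset (ℕ × ℕ) := edgeSet κ.2.1 ∪ edgeSet κ.2.2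

/-- The weight of a configuration, `q` to the number of doubled edges plus the number of edges
in the planted set `Q`. -/
noncomputable def Config.wt (q : ℝ) (Q : Finset (ℕ × ℕ)) (κ : Config) : ℝ :=
  q ^ agree κ.2.1 κ.2.2 * q ^ (κ.edges ∩ Q).card

/-- The normalization of the weights. -/
noncomputable def normConst (n m : ℕ) : ℝ :=
  ((n - 1).choose (m - 1) : ℝ) * (n.choose m : ℝ) * (m.factorial : ℝ) ^ 2

/-- The coefficient of the monomial `S` in the expansion of the weight of the vertex `i`. -/
noncomputable def coef (n m : ℕ) (q : ℝ) (Q : Finset (ℕ × ℕ)) (i : ℕ) (S : Finset (ℕ × ℕ)) : ℝ :=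
  (normConst n m)⁻¹ * ∑ κ ∈ configs n m i, if S ⊆ κ.edges \ Q then κ.wt q Q else 0

lemma edges_subset {n m i : ℕ} {κ : Config} (hκ : κ ∈ configs n m i) :
    κ.edges ⊆ side n ×ˢ side n := by
  simp only [configs, supersets, Finset.mem_sigma, Finset.mem_product, Finset.mem_filter,
    Finset.mem_powersetCard, Finset.mem_univ, and_true] at hκ
  exact Finset.union_subset
    ((edgeSet_subset _).trans (Finset.product_subset_product hκ.1.1.1 hκ.2.1))
    ((edgeSet_subset _).trans (Finset.product_subset_product hκ.1.1.1 hκ.2.1))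

/-- Planted edges are deterministic, so no monomial involves them. -/
lemma coef_eq_zero {n m i : ℕ} {q : ℝ} {Q S : Finset (ℕ × ℕ)} (h : ¬ Disjoint S Q) :
    coef n m q Q i S = 0 := by
  rw [coef, Finset.sum_eq_zero, mul_zero]
  intro κ _
  rw [if_neg]
  exact fun hS => h (Finset.disjoint_of_subset_left hS Finset.sdiff_disjoint)

/-- Idempotency of indicators merges the factors at a common edge. -/
lemma prod_mul_prod_eq_prod_union {ι : Type*} [DecidableEq ι] (s t : Finset ι) {f : ι → ℝ}
    (hf : ∀ e, f e = 0 ∨ f e = 1) : (∏ e ∈ s, f e) * ∏ e ∈ t, f e = ∏ e ∈ s ∪ t, f e := by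
  rw [← Finset.prod_union_inter, ← Finset.sdiff_union_of_subset
    (Finset.inter_subset_left.trans Finset.subset_union_left : s ∩ t ⊆ s ∪ t),
    Finset.prod_union Finset.sdiff_disjoint, mul_assoc, ← Finset.prod_mul_distrib]
  congr 1
  refine Finset.prod_congr rfl fun e _ => ?_
  rcases hf e with h | h <;> simp [h]

/-- Edge indicators for the planted set `Q` and the edges `η` present before planting. -/
noncomputable def plantedIndicator (Q : Finset (ℕ × ℕ)) (η : ℕ × ℕ → Bool) (e : ℕ × ℕ) : ℝ :=
  if e ∈ Q ∨ η e = true then 1 else 0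

/-- The centered and normalized edge variable. -/
noncomputable def centeredEdge (p : ℝ) (b : Bool) : ℝ := ((if b then 1 else 0) - p) / p

/-- Each factor `p⁻¹ * ξ_e` is `p⁻¹` on `Q` and one plus the centered variable off `Q`; the second
product is expanded over subsets. -/
lemma prod_plantedIndicator {p : ℝ} (hp : p ≠ 0) (Q H : Finset (ℕ × ℕ)) (η : ℕ × ℕ → Bool) :
    (p⁻¹) ^ H.card * ∏ e ∈ H, plantedIndicator Q η e = p⁻¹ ^ (H ∩ Q).card *
      ∑ S ∈ (H \ Q).powerset, ∏ e ∈ S, centeredEdge p (η e) := by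
  rw [← Finset.prod_one_add, ← Finset.prod_const, ← Finset.prod_mul_distrib,
    ← Finset.sdiff_union_inter H Q, Finset.prod_union (Finset.disjoint_sdiff_inter H Q), mul_comm]
  rw [Finset.sdiff_union_inter H Q]
  congr 1
  · rw [← Finset.prod_const]
    refine Finset.prod_congr rfl fun e he => ?_
    simp [plantedIndicator, (Finset.mem_inter.1 he).2]
  · refine Finset.prod_congr rfl fun e he => ?_
    simp only [plantedIndicator, (Finset.mem_sdiff.1 he).2, false_or, centeredEdge]
    split_ifs <;> field_simp <;> ring

/-- The weight as a polynomial in the centered edge variables. -/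
lemma weight_eq_multilinear {p : ℝ} (hp : p ≠ 0) (n m i : ℕ) (Q : Finset (ℕ × ℕ))
    (η : ℕ × ℕ → Bool) :
    weight n m p (fun u v => plantedIndicator Q η (u, v)) i =
      multilinear (side n ×ˢ side n) (coef n m p⁻¹ Q i) fun e => centeredEdge p (η e) := by
  have hf01 : ∀ e, plantedIndicator Q η e = 0 ∨ plantedIndicator Q η e = 1 := fun e => by
    unfold plantedIndicator; split_ifs <;> simp
  have key : ∀ κ ∈ configs n m i,
      (p⁻¹) ^ (2 * m) * ((∏ e ∈ edgeSet κ.2.1, plantedIndicator Q η e) *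
        ∏ e ∈ edgeSet κ.2.2, plantedIndicator Q η e) =
      ∑ S ∈ (side n ×ˢ side n).powerset, (if S ⊆ κ.edges \ Q then κ.wt p⁻¹ Q else 0) *
        ∏ e ∈ S, centeredEdge p (η e) := by
    intro κ hκ
    -- Two matchings have `2 * m` edges with multiplicity. One factor `p⁻¹` goes to each edge of the
    -- union, and the surplus is one factor per doubled edge.
    have hcard : 2 * m = agree κ.2.1 κ.2.2 + κ.edges.card := by
      have h1 := Finset.card_union_add_card_inter (edgeSet κ.2.1) (edgeSet κ.2.2)
      rw [card_edgeSet_inter, card_edgeSet, card_edgeSet] at h1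
      simp only [configs, supersets, Finset.mem_sigma, Finset.mem_product, Finset.mem_filter,
        Finset.mem_powersetCard] at hκ
      rw [hκ.1.1.1.2] at h1
      unfold Config.edges
      omega
    rw [prod_mul_prod_eq_prod_union _ _ hf01, hcard, pow_add, mul_assoc]
    change _ * (_ * ∏ e ∈ κ.edges, _) = _
    rw [prod_plantedIndicator hp, ← mul_assoc]
    simp only [ite_mul, zero_mul]
    rw [← Finset.sum_filter, Finset.mul_sum]
    refine Finset.sum_congr ?_ fun _ _ => rfl
    ext S
    simp only [Finset.mem_powerset, Finset.mem_filter]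
    exact ⟨fun h => ⟨h.trans (Finset.sdiff_subset.trans (edges_subset hκ)), h⟩, fun h => h.2⟩
  have h1 : weight n m p (fun u v => plantedIndicator Q η (u, v)) i =
      (normConst n m)⁻¹ * ∑ κ ∈ configs n m i, (p⁻¹) ^ (2 * m) *
        ((∏ e ∈ edgeSet κ.2.1, plantedIndicator Q η e) *
          ∏ e ∈ edgeSet κ.2.2, plantedIndicator Q η e) := by
    rw [sum_configs, weight, normConst]
    simp only [prod_edgeSet, matchingSum, mul_pow, ← Finset.mul_sum, ← Finset.sum_mul, ← sq]
    have hA : (((side n).powersetCard m).filter fun A => i ∈ A) = supersets (side n) m {i} := by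
      simp [supersets]
    rw [hA]
    have hm0 : (m.factorial : ℝ) ≠ 0 := by positivity
    rw [mul_inv _ ((m.factorial : ℝ) ^ 2), mul_assoc, ← mul_assoc (((m.factorial : ℝ) ^ 2)⁻¹)]
    congr 2
    rw [mul_comm (2 : ℕ) m, pow_mul, inv_pow p m]
    field_simp
  rw [h1, Finset.sum_congr rfl key, Finset.sum_comm, Finset.mul_sum, multilinear]
  refine Finset.sum_congr rfl fun S _ => ?_
  rw [coef, ← Finset.sum_mul, mul_assoc]

/-- Second moment method for the terms of degree at least two. -/
lemma sum_sq_coeff_le {ι κ : Type*} [DecidableEq ι] (F : Finset ι) (I : Finset κ) (w : κ → ℝ)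
    (hw : ∀ k, 0 ≤ w k) (G : κ → Finset ι) {t : ℝ} (ht : 0 ≤ t) :
    ∑ S ∈ F.powerset with 2 ≤ S.card, t ^ S.card * (∑ k ∈ I, if S ⊆ G k then w k else 0) ^ 2 ≤
      ∑ k ∈ I, ∑ k' ∈ I, w k * w k' *
        ((G k ∩ G k').offDiag.card * (1 + t) ^ (G k ∩ G k').card) := by
  -- Squaring gives a sum over pairs of configurations, in which `S` must lie in the common part of
  -- both.
  have h1 : ∀ S : Finset ι, (∑ k ∈ I, if S ⊆ G k then w k else 0) ^ 2 =
      ∑ k ∈ I, ∑ k' ∈ I, w k * w k' * (if S ⊆ G k ∩ G k' then 1 else 0) := by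
    intro S
    rw [sq, Finset.sum_mul_sum]
    refine Finset.sum_congr rfl fun k _ => Finset.sum_congr rfl fun k' _ => ?_
    by_cases h : S ⊆ G k <;> by_cases h' : S ⊆ G k' <;> simp [Finset.subset_inter_iff, h, h']
  simp_rw [h1, Finset.mul_sum]
  rw [Finset.sum_comm]
  refine Finset.sum_le_sum fun k _ => ?_
  rw [Finset.sum_comm]
  refine Finset.sum_le_sum fun k' _ => ?_
  set N := G k ∩ G k'
  have h2 : ∀ S : Finset ι, t ^ S.card * (w k * w k' * if S ⊆ N then 1 else 0) =
      w k * w k' * (if S ⊆ N then t ^ S.card else 0) := by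
    intro S; split_ifs <;> ring
  simp_rw [h2]
  rw [← Finset.mul_sum]
  refine mul_le_mul_of_nonneg_left ?_ (mul_nonneg (hw _) (hw _))
  rw [← Finset.sum_filter, Finset.filter_filter]
  -- A set with fewer than two points has no admissible subset. Otherwise the number of ordered
  -- pairs is at least one and may replace the indicator of `2 ≤ N.card`; unlike that indicator, it
  -- can be summed pair by pair.
  rcases Nat.lt_or_ge N.card 2 with hN | hN
  · rw [Finset.sum_eq_zero]
    · positivity
    · intro S hS
      simp only [Finset.mem_filter] at hS
      have := Finset.card_le_card hS.2.2
      omega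
  · have hone : (1 : ℝ) ≤ N.offDiag.card := by
      have : 1 ≤ N.offDiag.card := by
        rw [Finset.offDiag_card]
        have : 2 * N.card ≤ N.card * N.card := Nat.mul_le_mul_right _ hN
        omega
      exact_mod_cast this
    have h3 := pow_card_eq_sum_powerset N (1 + t)
    rw [add_sub_cancel_left] at h3
    rw [h3]
    calc _ ≤ ∑ S ∈ N.powerset, t ^ S.card := by
          refine Finset.sum_le_sum_of_subset_of_nonneg (fun S hS => ?_) fun _ _ _ => by positivity
          simp only [Finset.mem_filter] at hS
          exact Finset.mem_powerset.2 hS.2.2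
      _ ≤ _ := le_mul_of_one_le_left (Finset.sum_nonneg fun _ _ => by positivity) hone

end Expansion

/-! ### Negligibility of the terms of degree at least two. -/

section HigherOrder

lemma card_side (n : ℕ) : (side n).card = n := by simp [side]

lemma card_supersets_side {n m i : ℕ} (hi : i ∈ side n) (hm : 1 ≤ m) :
    (supersets (side n) m {i}).card = (n - 1).choose (m - 1) := by
  rw [card_supersets (Finset.singleton_subset_iff.2 hi) (by simpa using hm), card_side,
    Finset.card_singleton]

lemma normConst_eq {n m i : ℕ} (hi : i ∈ side n) (hm : 1 ≤ m) :
    normConst n m = ((supersets (side n) m {i}).card : ℝ) * ((side n).powersetCard m).card *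
      (m.factorial : ℝ) ^ 2 := by
  rw [normConst, card_supersets_side hi hm, Finset.card_powersetCard, card_side]

lemma normConst_pos {n m : ℕ} (hm : m ≤ n) : 0 < normConst n m := by
  have h1 : 0 < (n - 1).choose (m - 1) := Nat.choose_pos (by omega)
  have h2 : 0 < n.choose m := Nat.choose_pos hm
  unfold normConst
  have h1' : (0 : ℝ) < ((n - 1).choose (m - 1) : ℝ) := by exact_mod_cast h1
  have h2' : (0 : ℝ) < (n.choose m : ℝ) := by exact_mod_cast h2
  positivity

lemma mk_mem_edges {A B : Finset ℕ} (σ τ : ↥A ≃ ↥B) (a : ↥A) (b : ↥B) :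
    ((a : ℕ), (b : ℕ)) ∈ Config.edges ⟨(A, B), (σ, τ)⟩ ↔ σ a = b ∨ τ a = b := by
  rw [Config.edges, Finset.mem_union, mk_mem_edgeSet, mk_mem_edgeSet]

lemma card_edges_inter_le (κ : Config) (Q : Finset (ℕ × ℕ)) (b : Finset ℕ)
    (hQ : ∀ e ∈ Q, e.2 ∈ b) : (κ.edges ∩ Q).card ≤ 2 * (κ.1.2 ∩ b).card := by
  rw [Config.edges, Finset.union_inter_distrib_right, two_mul]
  exact (Finset.card_union_le _ _).trans
    (add_le_add (card_edgeSet_inter_le _ Q b hQ) (card_edgeSet_inter_le _ Q b hQ))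

lemma edges_subset_product (κ : Config) : κ.edges ⊆ κ.1.1 ×ˢ κ.1.2 :=
  Finset.union_subset (edgeSet_subset _) (edgeSet_subset _)

/-- Pairs of edges covered by a configuration with prescribed vertex sets. -/
lemma sum_pow_agree_pair_le {m : ℕ} (hm : 2 ≤ m) {A B : Finset ℕ} (hA : A.card = m)
    (hB : B.card = m) {q : ℝ} (hq : 1 ≤ q) {e e' : ℕ × ℕ} (hne : e ≠ e') (he : e ∈ A ×ˢ B)
    (he' : e' ∈ A ×ˢ B) :
    ∑ σ : ↥A ≃ ↥B, ∑ τ : ↥A ≃ ↥B,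
      (if e ∈ Config.edges ⟨(A, B), (σ, τ)⟩ ∧ e' ∈ Config.edges ⟨(A, B), (σ, τ)⟩ then
        q ^ agree σ τ else 0) ≤
      6 * q * Real.exp (q - 1) * ((m.factorial : ℝ) ^ 2 / (m : ℝ) ^ 2) := by
  rw [Finset.mem_product] at he he'
  have hcA : Fintype.card ↥A = m := by simp [hA]
  have hcB : Fintype.card ↥B = m := by simp [hB]
  have h := sum_sum_pow_agree_le (α := ↥A) (β := ↥B) (hcA.trans hcB.symm) ⟨e.1, he.1⟩ ⟨e'.1, he'.1⟩
    ⟨e.2, he.2⟩ ⟨e'.2, he'.2⟩ (by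
      intro h
      simp only [Prod.mk.injEq, Subtype.mk.injEq] at h
      exact hne (Prod.ext h.1 h.2)) (by rw [hcA]; exact hm) hq
  rw [hcA] at h
  refine le_trans (le_of_eq ?_) h
  refine Finset.sum_congr rfl fun σ _ => Finset.sum_congr rfl fun τ _ => ?_
  have h1 := mk_mem_edges σ τ ⟨e.1, he.1⟩ ⟨e.2, he.2⟩
  have h2 := mk_mem_edges σ τ ⟨e'.1, he'.1⟩ ⟨e'.2, he'.2⟩
  simp only [Prod.mk.eta] at h1 h2
  simp only [h1, h2]

/-- Decoupling of edges and vertices. A matching meets each right vertex once, so all powers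
counting planted or common edges are bounded through `B`, `B'` and `b` alone. The remaining
dependence on the bijections is a sum over pairs of edges available to both configurations. -/
lemma pair_weight_le {q t : ℝ} (hq : 1 ≤ q) (ht : 0 ≤ t) (Q : Finset (ℕ × ℕ)) (b : Finset ℕ)
    (hQ : ∀ e ∈ Q, e.2 ∈ b) (κ κ' : Config) :
    κ.wt q Q * κ'.wt q Q * ((((κ.edges \ Q) ∩ (κ'.edges \ Q)).offDiag.card : ℝ) *
      (1 + t) ^ ((κ.edges \ Q) ∩ (κ'.edges \ Q)).card) ≤
    (q ^ 2 * (1 + t) ^ 2) ^ ((κ.1.2 ∩ b).card + (κ'.1.2 ∩ b).card + (κ.1.2 ∩ κ'.1.2).card) *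
      ∑ x ∈ ((κ.1.1 ∩ κ'.1.1) ×ˢ (κ.1.2 ∩ κ'.1.2)).offDiag,
        (if x.1 ∈ κ.edges ∧ x.2 ∈ κ.edges then q ^ agree κ.2.1 κ.2.2 else 0) *
        (if x.1 ∈ κ'.edges ∧ x.2 ∈ κ'.edges then q ^ agree κ'.2.1 κ'.2.2 else 0) := by
  have ht1 : 1 ≤ 1 + t := by linarith
  have hq2 : 1 ≤ q ^ 2 := one_le_pow₀ hq
  have ht2 : 1 ≤ (1 + t) ^ 2 := one_le_pow₀ ht1
  have hq0 : 0 ≤ q := by linarith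
  have hN : ((κ.edges \ Q) ∩ (κ'.edges \ Q)).card ≤ 2 * (κ.1.2 ∩ κ'.1.2).card := by
    refine (Finset.card_le_card (Finset.inter_subset_inter Finset.sdiff_subset
      (Finset.sdiff_subset.trans (edges_subset_product κ')))).trans ?_
    exact card_edges_inter_le κ _ _ fun e he => (Finset.mem_product.1 he).2
  have h1 : q ^ (κ.edges ∩ Q).card * q ^ (κ'.edges ∩ Q).card *
      (1 + t) ^ ((κ.edges \ Q) ∩ (κ'.edges \ Q)).card ≤
      (q ^ 2 * (1 + t) ^ 2) ^
        ((κ.1.2 ∩ b).card + (κ'.1.2 ∩ b).card + (κ.1.2 ∩ κ'.1.2).card) := by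
    rw [mul_pow, ← pow_mul, ← pow_mul, ← pow_add]
    refine mul_le_mul (pow_le_pow_right₀ hq ?_) (pow_le_pow_right₀ ht1 ?_) (by positivity)
      (by positivity)
    · have := card_edges_inter_le κ Q b hQ
      have := card_edges_inter_le κ' Q b hQ
      omega
    · omega
  have h2 : (((κ.edges \ Q) ∩ (κ'.edges \ Q)).offDiag.card : ℝ) *
      (q ^ agree κ.2.1 κ.2.2 * q ^ agree κ'.2.1 κ'.2.2) ≤
      ∑ x ∈ ((κ.1.1 ∩ κ'.1.1) ×ˢ (κ.1.2 ∩ κ'.1.2)).offDiag,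
        (if x.1 ∈ κ.edges ∧ x.2 ∈ κ.edges then q ^ agree κ.2.1 κ.2.2 else 0) *
        (if x.1 ∈ κ'.edges ∧ x.2 ∈ κ'.edges then q ^ agree κ'.2.1 κ'.2.2 else 0) := by
    rw [← nsmul_eq_mul, ← Finset.sum_const]
    calc _ = ∑ x ∈ ((κ.edges \ Q) ∩ (κ'.edges \ Q)).offDiag,
        (if x.1 ∈ κ.edges ∧ x.2 ∈ κ.edges then q ^ agree κ.2.1 κ.2.2 else 0) *
        (if x.1 ∈ κ'.edges ∧ x.2 ∈ κ'.edges then q ^ agree κ'.2.1 κ'.2.2 else 0) := by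
          refine Finset.sum_congr rfl fun x hx => ?_
          simp only [Finset.mem_offDiag, Finset.mem_inter, Finset.mem_sdiff] at hx
          rw [if_pos ⟨hx.1.1.1, hx.2.1.1.1⟩, if_pos ⟨hx.1.2.1, hx.2.1.2.1⟩]
      _ ≤ _ := by
        refine Finset.sum_le_sum_of_subset_of_nonneg (fun x hx => ?_) fun x _ _ => ?_
        · simp only [Finset.mem_offDiag, Finset.mem_inter, Finset.mem_sdiff] at hx
          have a1 := Finset.mem_product.1 (edges_subset_product κ hx.1.1.1)
          have a2 := Finset.mem_product.1 (edges_subset_product κ' hx.1.2.1)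
          have a3 := Finset.mem_product.1 (edges_subset_product κ hx.2.1.1.1)
          have a4 := Finset.mem_product.1 (edges_subset_product κ' hx.2.1.2.1)
          simp only [Finset.mem_offDiag, Finset.mem_product, Finset.mem_inter]
          exact ⟨⟨⟨a1.1, a2.1⟩, a1.2, a2.2⟩, ⟨⟨a3.1, a4.1⟩, a3.2, a4.2⟩, hx.2.2⟩
        · split_ifs <;> positivity
  have h3 := mul_le_mul h1 h2 (by positivity) (by positivity)
  refine le_trans (le_of_eq ?_) h3
  unfold Config.wt
  ring

/-- The terms of degree at least two in the expansion of the weights are negligible. -/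
lemma exists_sum_sq_coef_le (q t L : ℝ) (hq : 1 ≤ q) (ht : 0 ≤ t) (hL : 0 ≤ L) :
    ∃ C : ℝ, 0 ≤ C ∧ ∀ {n m i : ℕ} {b : Finset ℕ} {Q : Finset (ℕ × ℕ)}, 2 ≤ m → m ≤ n →
      i ∈ side n → b ⊆ side n → (∀ e ∈ Q, e.2 ∈ b) → (m : ℝ) ^ 2 ≤ L * n →
      (m : ℝ) * b.card ≤ L * n →
      ∑ S ∈ (side n ×ˢ side n).powerset with 2 ≤ S.card, t ^ S.card * coef n m q Q i S ^ 2 ≤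
        C / (n : ℝ) ^ 2 := by
  have hD : 1 ≤ q ^ 2 * (1 + t) ^ 2 :=
    one_le_mul_of_one_le_of_one_le (one_le_pow₀ hq) (one_le_pow₀ (by linarith))
  obtain ⟨C, hC, hmain⟩ := exists_sum_pow_mul_card_offDiag_le (q ^ 2 * (1 + t) ^ 2) L hD hL
  set D := q ^ 2 * (1 + t) ^ 2
  have hq0 : 0 ≤ q := by linarith
  refine ⟨C * (6 * q * Real.exp (q - 1)) ^ 2, by positivity, ?_⟩
  intro n m i b Q hm2 hmn hi hb hQ hmL hmb
  have hn0 : 0 < n := by omega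
  have hnR : (0 : ℝ) < n := by exact_mod_cast hn0
  have hmR : (0 : ℝ) < m := by exact_mod_cast (by omega : 0 < m)
  have hmain := @hmain ℕ _ (side n) m b i (by rwa [card_side]) (by rwa [card_side]) hb hi
    (by rwa [card_side]) (by rwa [card_side])
  have hwt : ∀ κ : Config, 0 ≤ κ.wt q Q := fun κ => by unfold Config.wt; positivity
  have hsec := sum_sq_coeff_le (side n ×ˢ side n) (configs n m i) (Config.wt q Q) hwt
    (fun κ => κ.edges \ Q) ht
  have hN := normConst_pos hmn
  have hlhs : ∑ S ∈ (side n ×ˢ side n).powerset with 2 ≤ S.card,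
      t ^ S.card * coef n m q Q i S ^ 2 = (normConst n m)⁻¹ ^ 2 *
      ∑ S ∈ (side n ×ˢ side n).powerset with 2 ≤ S.card, t ^ S.card *
        (∑ κ ∈ configs n m i, if S ⊆ κ.edges \ Q then κ.wt q Q else 0) ^ 2 := by
    rw [Finset.mul_sum]
    refine Finset.sum_congr rfl fun S _ => ?_
    rw [coef]; ring
  set 𝒜 := supersets (side n) m {i}
  set ℬ := (side n).powersetCard m
  set R := 6 * q * Real.exp (q - 1) * ((m.factorial : ℝ) ^ 2 / (m : ℝ) ^ 2) with hR
  have hR0 : 0 ≤ R := by positivity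
  have hpairs : ∑ κ ∈ configs n m i, ∑ κ' ∈ configs n m i, κ.wt q Q * κ'.wt q Q *
      ((((κ.edges \ Q) ∩ (κ'.edges \ Q)).offDiag.card : ℝ) *
        (1 + t) ^ ((κ.edges \ Q) ∩ (κ'.edges \ Q)).card) ≤
      ∑ A ∈ 𝒜, ∑ B ∈ ℬ, ∑ A' ∈ 𝒜, ∑ B' ∈ ℬ,
        D ^ ((B ∩ b).card + (B' ∩ b).card + (B ∩ B').card) *
          ((((A ∩ A') ×ˢ (B ∩ B')).offDiag.card : ℝ)) * R ^ 2 := by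
    refine (Finset.sum_le_sum fun κ _ => Finset.sum_le_sum fun κ' _ =>
      pair_weight_le hq ht Q b hQ κ κ').trans ?_
    simp only [sum_configs]
    refine Finset.sum_le_sum fun A hA => Finset.sum_le_sum fun B hB => ?_
    have hAm : A.card = m := (Finset.mem_powersetCard.1 (Finset.mem_filter.1 hA).1).2
    have hBm : B.card = m := (Finset.mem_powersetCard.1 hB).2
    have hswap : ∀ f : (↥A ≃ ↥B) → (↥A ≃ ↥B) → Finset ℕ → Finset ℕ → ℝ,
        ∑ σ, ∑ τ, ∑ A' ∈ 𝒜, ∑ B' ∈ ℬ, f σ τ A' B' =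
        ∑ A' ∈ 𝒜, ∑ B' ∈ ℬ, ∑ σ, ∑ τ, f σ τ A' B' := by
      intro f
      have : ∀ σ, ∑ τ, ∑ A' ∈ 𝒜, ∑ B' ∈ ℬ, f σ τ A' B' =
          ∑ A' ∈ 𝒜, ∑ B' ∈ ℬ, ∑ τ, f σ τ A' B' := fun σ => by
        rw [Finset.sum_comm]
        exact Finset.sum_congr rfl fun A' _ => Finset.sum_comm
      simp_rw [this]
      rw [Finset.sum_comm]
      exact Finset.sum_congr rfl fun A' _ => Finset.sum_comm
    rw [hswap]
    refine Finset.sum_le_sum fun A' hA' => Finset.sum_le_sum fun B' hB' => ?_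
    have hAm' : A'.card = m := (Finset.mem_powersetCard.1 (Finset.mem_filter.1 hA').1).2
    have hBm' : B'.card = m := (Finset.mem_powersetCard.1 hB').2
    simp only [← Finset.mul_sum, mul_assoc]
    refine mul_le_mul_of_nonneg_left ?_ (by positivity)
    -- For a fixed pair of edges the two configurations decouple, and the sum over four bijections
    -- is a product of two sums over pairs.
    have hex : ∀ g : (↥A ≃ ↥B) → (↥A ≃ ↥B) → (ℕ × ℕ) × (ℕ × ℕ) → ℝ,
        ∀ h : (↥A' ≃ ↥B') → (↥A' ≃ ↥B') → (ℕ × ℕ) × (ℕ × ℕ) → ℝ,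
        ∀ O : Finset ((ℕ × ℕ) × (ℕ × ℕ)),
        ∑ σ, ∑ τ, ∑ σ', ∑ τ', ∑ x ∈ O, g σ τ x * h σ' τ' x =
        ∑ x ∈ O, (∑ σ, ∑ τ, g σ τ x) * ∑ σ', ∑ τ', h σ' τ' x := by
      intro g h O
      simp only [Finset.sum_mul]
      simp only [Finset.mul_sum]
      rw [Finset.sum_comm (s := O)]
      refine Finset.sum_congr rfl fun σ _ => ?_
      rw [Finset.sum_comm (s := O)]
      refine Finset.sum_congr rfl fun τ _ => ?_
      rw [Finset.sum_comm (s := O)]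
      exact Finset.sum_congr rfl fun σ' _ => Finset.sum_comm
    rw [hex (fun σ τ x => if x.1 ∈ Config.edges ⟨(A, B), (σ, τ)⟩ ∧
      x.2 ∈ Config.edges ⟨(A, B), (σ, τ)⟩ then q ^ agree σ τ else 0)
      (fun σ τ x => if x.1 ∈ Config.edges ⟨(A', B'), (σ, τ)⟩ ∧
      x.2 ∈ Config.edges ⟨(A', B'), (σ, τ)⟩ then q ^ agree σ τ else 0)]
    rw [← nsmul_eq_mul, ← Finset.sum_const]
    refine Finset.sum_le_sum fun x hx => ?_
    simp only [Finset.mem_offDiag, Finset.mem_product, Finset.mem_inter] at hx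
    have b1 := sum_pow_agree_pair_le hm2 hAm hBm hq hx.2.2
      (Finset.mem_product.2 ⟨hx.1.1.1, hx.1.2.1⟩) (Finset.mem_product.2 ⟨hx.2.1.1.1, hx.2.1.2.1⟩)
    have b2 := sum_pow_agree_pair_le hm2 hAm' hBm' hq hx.2.2
      (Finset.mem_product.2 ⟨hx.1.1.2, hx.1.2.2⟩) (Finset.mem_product.2 ⟨hx.2.1.1.2, hx.2.1.2.2⟩)
    rw [sq R]
    refine mul_le_mul b1 b2 (Finset.sum_nonneg fun _ _ => Finset.sum_nonneg fun _ _ => ?_) hR0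
    split_ifs <;> positivity
  simp only [← Finset.sum_mul] at hpairs
  rw [hlhs]
  -- `R ^ 2` is of order `(m!) ^ 4 / m ^ 4` and the vertex count supplies `(m ^ 2 / n) ^ 2`; after
  -- normalization the powers of `m` cancel and `n⁻²` remains.
  have hfin := hsec.trans (hpairs.trans (mul_le_mul_of_nonneg_right hmain (sq_nonneg R)))
  refine (mul_le_mul_of_nonneg_left hfin (by positivity)).trans (le_of_eq ?_)
  have hnc : normConst n m = (𝒜.card : ℝ) * ℬ.card * (m.factorial : ℝ) ^ 2 :=
    normConst_eq hi (by omega)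
  rw [hnc] at hN ⊢
  rw [card_side]
  have hac : (𝒜.card : ℝ) * ℬ.card ≠ 0 := fun h0 => by
    rw [h0, zero_mul] at hN; exact lt_irrefl _ hN
  have h𝒜 := left_ne_zero_of_mul hac
  have hℬ := right_ne_zero_of_mul hac
  have hf : (m.factorial : ℝ) ≠ 0 := by positivity
  rw [hR]
  field_simp

end HigherOrder

/-! ### Asymptotics of the coefficients of degree one. -/

section Linear

/-- Inclusion-exclusion: pairs with `σ` through the edge, and pairs with `τ` through it, each carry
exactly half of the main term. Pairs with both through it are smaller by a factor of order `1 / m`.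
-/
lemma abs_sum_sum_or_sub_le {α β : Type*} [Fintype α] [Fintype β] [DecidableEq α] [DecidableEq β]
    (h : Fintype.card α = Fintype.card β) (a : α) (b : β) {q : ℝ} (hq : 1 ≤ q) :
    |∑ σ : α ≃ β, ∑ τ : α ≃ β, (if σ a = b ∨ τ a = b then q ^ agree σ τ else 0) -
      2 * (((Fintype.card α).factorial : ℝ) ^ 2 / Fintype.card α) *
        expTrunc (Fintype.card α) (q - 1)| ≤
      q * Real.exp (q - 1) *
        (((Fintype.card α).factorial : ℝ) ^ 2 / (Fintype.card α : ℝ) ^ 2) := by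
  set m := Fintype.card α with hm
  have hq0 : 0 ≤ q := by linarith
  have h1 : ∑ σ : α ≃ β, ∑ τ : α ≃ β, (if σ a = b then q ^ agree σ τ else 0) =
      ((m.factorial : ℝ) ^ 2 / m) * expTrunc m (q - 1) := by
    have : ∀ σ : α ≃ β, ∑ τ : α ≃ β, (if σ a = b then q ^ agree σ τ else 0) =
        if σ a = b then (m.factorial : ℝ) * expTrunc m (q - 1) else 0 := by
      intro σ
      split_ifs
      · exact sum_pow_agree σ q
      · simp
    simp_rw [this]
    rw [← Finset.sum_filter, Finset.sum_const, nsmul_eq_mul, card_filter_apply_eq h, ← hm]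
    ring
  have h2 : ∑ σ : α ≃ β, ∑ τ : α ≃ β, (if τ a = b then q ^ agree σ τ else 0) =
      ((m.factorial : ℝ) ^ 2 / m) * expTrunc m (q - 1) := by
    rw [Finset.sum_comm, ← h1]
    simp only [agree_comm]
  have h3 : ∑ σ : α ≃ β, ∑ τ : α ≃ β,
      (if σ a = b then (if τ a = b then q ^ agree σ τ else 0) else 0) ≤
      q * Real.exp (q - 1) * ((m.factorial : ℝ) ^ 2 / (m : ℝ) ^ 2) := by
    have : ∀ σ : α ≃ β, ∑ τ : α ≃ β,
        (if σ a = b then (if τ a = b then q ^ agree σ τ else 0) else 0) ≤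
        if σ a = b then q * Real.exp (q - 1) * (m.factorial / m : ℝ) else 0 := by
      intro σ
      split_ifs
      · rw [← Finset.sum_filter]; exact sum_pow_agree_le σ a b hq
      · simp
    refine (Finset.sum_le_sum fun σ _ => this σ).trans ?_
    rw [← Finset.sum_filter, Finset.sum_const, nsmul_eq_mul, card_filter_apply_eq h]
    apply le_of_eq
    rw [← hm]
    ring
  have h3' : 0 ≤ ∑ σ : α ≃ β, ∑ τ : α ≃ β,
      (if σ a = b then (if τ a = b then q ^ agree σ τ else 0) else 0) :=
    Finset.sum_nonneg fun σ _ => Finset.sum_nonneg fun τ _ => by split_ifs <;> positivity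
  have h4 : ∑ σ : α ≃ β, ∑ τ : α ≃ β, (if σ a = b ∨ τ a = b then q ^ agree σ τ else 0) =
      ∑ σ : α ≃ β, ∑ τ : α ≃ β, (if σ a = b then q ^ agree σ τ else 0) +
      ∑ σ : α ≃ β, ∑ τ : α ≃ β, (if τ a = b then q ^ agree σ τ else 0) -
      ∑ σ : α ≃ β, ∑ τ : α ≃ β,
        (if σ a = b then (if τ a = b then q ^ agree σ τ else 0) else 0) := by
    simp only [← Finset.sum_add_distrib, ← Finset.sum_sub_distrib]
    refine Finset.sum_congr rfl fun σ _ => Finset.sum_congr rfl fun τ _ => ?_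
    by_cases hs : σ a = b <;> by_cases ht : τ a = b <;> simp [hs, ht]
  rw [h4, h1, h2]
  rw [show ((m.factorial : ℝ) ^ 2 / m) * expTrunc m (q - 1) +
    ((m.factorial : ℝ) ^ 2 / m) * expTrunc m (q - 1) -
    ∑ σ : α ≃ β, ∑ τ : α ≃ β,
        (if σ a = b then (if τ a = b then q ^ agree σ τ else 0) else 0) -
    2 * ((m.factorial : ℝ) ^ 2 / m) * expTrunc m (q - 1) = - ∑ σ : α ≃ β, ∑ τ : α ≃ β,
        (if σ a = b then (if τ a = b then q ^ agree σ τ else 0) else 0) by ring, abs_neg,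
    abs_of_nonneg h3']
  exact h3

/-- Bernoulli's inequality for `q⁻¹`, multiplied by `q ^ k`. -/
lemma pow_sub_one_le_mul_pow {q : ℝ} (hq : 1 ≤ q) (k : ℕ) : q ^ k - 1 ≤ k * q ^ k * q := by
  have h0 : 0 < q := by linarith
  have hb := one_add_mul_le_pow (a := q⁻¹ - 1) (by
    have : 0 < q⁻¹ := inv_pos.2 h0
    linarith) k
  have e : (1 + (q⁻¹ - 1)) ^ k = (q ^ k)⁻¹ := by rw [add_sub_cancel, inv_pow]
  rw [e] at hb
  have hk : 0 < q ^ k := by positivity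
  have h1 := mul_le_mul_of_nonneg_right hb hk.le
  rw [inv_mul_cancel₀ hk.ne'] at h1
  have h2 : 0 ≤ q⁻¹ := (inv_pos.2 h0).le
  have h3 : (0 : ℝ) ≤ k * q ^ k := by positivity
  nlinarith [mul_nonneg h3 h2, mul_le_mul_of_nonneg_left hq h3]

/-- The excess weight due to planting is bounded by a count of planted edges in the configuration.
Written as a sum over edges, it can be combined with the bound on configurations covering two given
edges. -/
lemma wt_sub_le {q : ℝ} (hq : 1 ≤ q) {K : ℕ} {b : Finset ℕ} (κ : Config) :
    κ.wt q (side K ×ˢ b) - q ^ agree κ.2.1 κ.2.2 ≤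
      q * (q ^ 2) ^ (κ.1.2 ∩ b).card * ∑ e ∈ (κ.1.1 ∩ side K) ×ˢ (κ.1.2 ∩ b),
        if e ∈ κ.edges then q ^ agree κ.2.1 κ.2.2 else 0 := by
  have hq0 : 0 ≤ q := by linarith
  set X := (κ.edges ∩ side K ×ˢ b).card with hX
  have h1 : X ≤ 2 * (κ.1.2 ∩ b).card :=
    card_edges_inter_le κ _ b fun e he => (Finset.mem_product.1 he).2
  have h2 := pow_sub_one_le_mul_pow hq X
  have h3 : ∑ e ∈ (κ.1.1 ∩ side K) ×ˢ (κ.1.2 ∩ b),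
      (if e ∈ κ.edges then q ^ agree κ.2.1 κ.2.2 else 0) = X * q ^ agree κ.2.1 κ.2.2 := by
    rw [← Finset.sum_filter, Finset.sum_const, nsmul_eq_mul, hX]
    congr 3
    ext e
    simp only [Finset.mem_filter, Finset.mem_inter, Finset.mem_product]
    constructor
    · rintro ⟨⟨⟨h1, h2⟩, h3, h4⟩, h5⟩; exact ⟨h5, h2, h4⟩
    · rintro ⟨h5, h2, h4⟩
      have := Finset.mem_product.1 (edges_subset_product κ h5)
      exact ⟨⟨⟨this.1, h2⟩, this.2, h4⟩, h5⟩
  have h4 : q ^ X ≤ (q ^ 2) ^ (κ.1.2 ∩ b).card := by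
    rw [← pow_mul]; exact pow_le_pow_right₀ hq h1
  rw [h3]
  have ha : 0 ≤ q ^ agree κ.2.1 κ.2.2 := by positivity
  calc κ.wt q (side K ×ˢ b) - q ^ agree κ.2.1 κ.2.2 = q ^ agree κ.2.1 κ.2.2 * (q ^ X - 1) := by
        rw [Config.wt]; ring
    _ ≤ q ^ agree κ.2.1 κ.2.2 * (X * (q ^ 2) ^ (κ.1.2 ∩ b).card * q) := by
        refine mul_le_mul_of_nonneg_left (h2.trans ?_) ha
        gcongr
    _ = _ := by ring

/-- The contribution of prescribed vertex sets to a coefficient of degree one. -/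
lemma abs_inner_sum_sub_le {m K : ℕ} (hm : 2 ≤ m) {A B b : Finset ℕ} (hA : A.card = m)
    (hB : B.card = m) {q : ℝ} (hq : 1 ≤ q) {e : ℕ × ℕ} (he : e ∈ A ×ˢ B)
    (heQ : e ∉ side K ×ˢ b) :
    |∑ σ : ↥A ≃ ↥B, ∑ τ : ↥A ≃ ↥B, (if {e} ⊆ Config.edges ⟨(A, B), (σ, τ)⟩ \ side K ×ˢ b then
        Config.wt q (side K ×ˢ b) ⟨(A, B), (σ, τ)⟩ else 0) -
      2 * ((m.factorial : ℝ) ^ 2 / m) * expTrunc m (q - 1)| ≤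
      6 * q ^ 2 * Real.exp (q - 1) * ((m.factorial : ℝ) ^ 2 / (m : ℝ) ^ 2) *
        (1 + (A ∩ side K).card * (2 * q ^ 2) ^ (B ∩ b).card) := by
  have hq0 : 0 ≤ q := by linarith
  have heAB := Finset.mem_product.1 he
  have hcA : Fintype.card ↥A = m := by simp [hA]
  have hcB : Fintype.card ↥B = m := by simp [hB]
  set F : ℝ := (m.factorial : ℝ) ^ 2 / (m : ℝ) ^ 2 with hF
  have hF0 : 0 ≤ F := by positivity
  have hs := abs_sum_sum_or_sub_le (α := ↥A) (β := ↥B) (hcA.trans hcB.symm) ⟨e.1, heAB.1⟩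
    ⟨e.2, heAB.2⟩ hq
  rw [hcA] at hs
  have hmem : ∀ σ τ : ↥A ≃ ↥B, e ∈ Config.edges ⟨(A, B), (σ, τ)⟩ ↔
      σ ⟨e.1, heAB.1⟩ = ⟨e.2, heAB.2⟩ ∨ τ ⟨e.1, heAB.1⟩ = ⟨e.2, heAB.2⟩ := fun σ τ =>
    mk_mem_edges σ τ ⟨e.1, heAB.1⟩ ⟨e.2, heAB.2⟩
  simp only [← hmem] at hs
  have hsub : ∀ σ τ : ↥A ≃ ↥B, {e} ⊆ Config.edges ⟨(A, B), (σ, τ)⟩ \ side K ×ˢ b ↔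
      e ∈ Config.edges ⟨(A, B), (σ, τ)⟩ := fun σ τ => by
    rw [Finset.singleton_subset_iff, Finset.mem_sdiff]; exact and_iff_left heQ
  simp only [hsub]
  set z := (B ∩ b).card
  -- Replacing the weight by `q ^ agree` costs one further covered edge, which lies in `Q` and hence
  -- differs from `e`; covering both is rarer by a factor of order `1 / m`.
  have hd : |∑ σ : ↥A ≃ ↥B, ∑ τ : ↥A ≃ ↥B, (if e ∈ Config.edges ⟨(A, B), (σ, τ)⟩ then
        Config.wt q (side K ×ˢ b) ⟨(A, B), (σ, τ)⟩ else 0) -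
      ∑ σ : ↥A ≃ ↥B, ∑ τ : ↥A ≃ ↥B, (if e ∈ Config.edges ⟨(A, B), (σ, τ)⟩ then
        q ^ agree σ τ else 0)| ≤
      q * (q ^ 2) ^ z * (((A ∩ side K).card * z) * (6 * q * Real.exp (q - 1) * F)) := by
    simp only [← Finset.sum_sub_distrib]
    rw [abs_of_nonneg]
    · calc _ ≤ ∑ σ : ↥A ≃ ↥B, ∑ τ : ↥A ≃ ↥B, q * (q ^ 2) ^ z *
          ∑ e' ∈ (A ∩ side K) ×ˢ (B ∩ b), (if e ∈ Config.edges ⟨(A, B), (σ, τ)⟩ ∧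
            e' ∈ Config.edges ⟨(A, B), (σ, τ)⟩ then q ^ agree σ τ else 0) := by
            refine Finset.sum_le_sum fun σ _ => Finset.sum_le_sum fun τ _ => ?_
            by_cases h : e ∈ Config.edges ⟨(A, B), (σ, τ)⟩
            · simp only [h, if_true, true_and]
              exact wt_sub_le hq ⟨(A, B), (σ, τ)⟩
            · simp [h]
        _ = q * (q ^ 2) ^ z * ∑ e' ∈ (A ∩ side K) ×ˢ (B ∩ b), ∑ σ : ↥A ≃ ↥B, ∑ τ : ↥A ≃ ↥B,
            (if e ∈ Config.edges ⟨(A, B), (σ, τ)⟩ ∧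
            e' ∈ Config.edges ⟨(A, B), (σ, τ)⟩ then q ^ agree σ τ else 0) := by
            simp only [← Finset.mul_sum]
            congr 1
            rw [Finset.sum_comm (s := (A ∩ side K) ×ˢ (B ∩ b))]
            exact Finset.sum_congr rfl fun σ _ => Finset.sum_comm
        _ ≤ q * (q ^ 2) ^ z * ∑ e' ∈ (A ∩ side K) ×ˢ (B ∩ b),
            (6 * q * Real.exp (q - 1) * F) := by
            refine mul_le_mul_of_nonneg_left (Finset.sum_le_sum fun e' he' => ?_) (by positivity)
            have he' := Finset.mem_product.1 he'
            refine sum_pow_agree_pair_le hm hA hB hq (fun h => heQ ?_) he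
              (Finset.mem_product.2 ⟨(Finset.mem_inter.1 he'.1).1, (Finset.mem_inter.1 he'.2).1⟩)
            rw [h]
            exact Finset.mem_product.2 ⟨(Finset.mem_inter.1 he'.1).2, (Finset.mem_inter.1 he'.2).2⟩
        _ = _ := by
            rw [Finset.sum_const, Finset.card_product, nsmul_eq_mul]; push_cast; rfl
    · refine Finset.sum_nonneg fun σ _ => Finset.sum_nonneg fun τ _ => ?_
      split_ifs
      · rw [Config.wt, sub_nonneg]
        exact le_mul_of_one_le_right (by positivity) (one_le_pow₀ hq)
      · simp
  -- The polynomial factor is absorbed by `z ≤ 2 ^ z`.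
  have hz : (z : ℝ) * (q ^ 2) ^ z ≤ (2 * q ^ 2) ^ z := by
    rw [mul_pow]
    refine mul_le_mul_of_nonneg_right ?_ (by positivity)
    exact_mod_cast (Nat.lt_two_pow_self (n := z)).le
  have hE : 0 ≤ Real.exp (q - 1) * F := by positivity
  have hfin : q * (q ^ 2) ^ z * (((A ∩ side K).card * z) * (6 * q * Real.exp (q - 1) * F)) ≤
      6 * q ^ 2 * Real.exp (q - 1) * F * ((A ∩ side K).card * (2 * q ^ 2) ^ z) := by
    calc _ = 6 * q ^ 2 * Real.exp (q - 1) * F * ((A ∩ side K).card * (z * (q ^ 2) ^ z)) := by ring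
      _ ≤ _ := by gcongr
  have hq6 : q * Real.exp (q - 1) * F ≤ 6 * q ^ 2 * Real.exp (q - 1) * F := by
    have : q ≤ 6 * q ^ 2 := by nlinarith
    gcongr
  calc _ ≤ _ := abs_sub_le _ _ _
    _ ≤ _ := add_le_add hd hs
    _ ≤ 6 * q ^ 2 * Real.exp (q - 1) * F * ((A ∩ side K).card * (2 * q ^ 2) ^ z) +
      6 * q ^ 2 * Real.exp (q - 1) * F := add_le_add hfin hq6
    _ = _ := by ring

/-- The order of magnitude of `n` times the linear coefficient of an edge at `u`. -/
noncomputable def rowScale (n m i u : ℕ) : ℝ := if u = i then 1 else (m : ℝ) / n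

/-- The limiting linear coefficients. -/
noncomputable def linCoef (n m i : ℕ) (q : ℝ) (u : ℕ) : ℝ :=
  2 * Real.exp (q - 1) * ((if u = i then (1 : ℝ) else 0) / n + m / (n : ℝ) ^ 2)

/-- The probability that a random left vertex set through `i` also contains `u`. -/
noncomputable def hitProb (n m i u : ℕ) : ℝ :=
  if u = i then 1 else ((m : ℝ) - 1) / ((n : ℝ) - 1)

lemma card_supersets_filter_mem {n m i u : ℕ} (hm : 2 ≤ m) (hmn : m ≤ n) (hi : i ∈ side n)
    (hu : u ∈ side n) :
    (((supersets (side n) m {i}).filter (u ∈ ·)).card : ℝ) =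
      hitProb n m i u * (supersets (side n) m {i}).card := by
  rw [hitProb]
  split_ifs with h
  · subst h
    rw [one_mul, Finset.filter_true_of_mem]
    intro A hA
    simpa using (Finset.mem_filter.1 hA).2
  · have : (supersets (side n) m {i}).filter (u ∈ ·) = supersets (side n) m {u, i} := by
      ext A
      simp only [supersets, Finset.mem_filter, Finset.insert_subset_iff,
        Finset.singleton_subset_iff]
      tauto
    rw [this, card_supersets (Finset.insert_subset hu (Finset.singleton_subset_iff.2 hi))
      (by rwa [Finset.card_pair h]), card_supersets_side hi (by omega), card_side,
      Finset.card_pair h]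
    obtain ⟨k, rfl⟩ : ∃ k, m = k + 2 := ⟨m - 2, by omega⟩
    obtain ⟨l, rfl⟩ : ∃ l, n = l + 2 := ⟨n - 2, by omega⟩
    have h1 := Nat.add_one_mul_choose_eq l k
    have h1' : ((l : ℝ) + 1) * (l.choose k : ℝ) = ((l + 1).choose (k + 1) : ℝ) * (k + 1) := by
      exact_mod_cast h1
    simp only [Nat.add_sub_cancel, show k + 2 - 1 = k + 1 by omega,
      show l + 2 - 1 = l + 1 by omega]
    push_cast
    have hl : (0 : ℝ) < (l : ℝ) + 1 := by positivity
    rw [show (k : ℝ) + 2 - 1 = k + 1 by ring, show (l : ℝ) + 2 - 1 = l + 1 by ring,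
      div_mul_eq_mul_div, eq_div_iff hl.ne']
    linarith

lemma card_powersetCard_filter_mem {n m v : ℕ} (hm : 1 ≤ m) (hmn : m ≤ n) (hv : v ∈ side n) :
    ((((side n).powersetCard m).filter (v ∈ ·)).card : ℝ) =
      (m / n : ℝ) * ((side n).powersetCard m).card := by
  have : ((side n).powersetCard m).filter (v ∈ ·) = supersets (side n) m {v} := by
    simp [supersets]
  rw [this, card_supersets_side hv hm, Finset.card_powersetCard, card_side]
  obtain ⟨k, rfl⟩ : ∃ k, m = k + 1 := ⟨m - 1, by omega⟩
  obtain ⟨l, rfl⟩ : ∃ l, n = l + 1 := ⟨n - 1, by omega⟩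
  have h1 := Nat.add_one_mul_choose_eq l k
  have h1' : ((l : ℝ) + 1) * (l.choose k : ℝ) = ((l + 1).choose (k + 1) : ℝ) * (k + 1) := by
    exact_mod_cast h1
  have hl : (0 : ℝ) < (l : ℝ) + 1 := by positivity
  simp only [Nat.add_sub_cancel]
  push_cast
  rw [div_mul_eq_mul_div, eq_div_iff hl.ne']
  linarith

lemma rowScale_nonneg (n m i u : ℕ) : 0 ≤ rowScale n m i u := by
  unfold rowScale; split_ifs <;> positivity

lemma hitProb_nonneg {n m : ℕ} (i u : ℕ) (hm : 2 ≤ m) (hmn : m ≤ n) : 0 ≤ hitProb n m i u := by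
  unfold hitProb
  have : (2 : ℝ) ≤ m := by exact_mod_cast hm
  have : (m : ℝ) ≤ n := by exact_mod_cast hmn
  split_ifs
  · norm_num
  · exact div_nonneg (by linarith) (by linarith)

/-- For `u ≠ i` the difference of `m / n` and `(m - 1) / (n - 1)` is at most `1 / n`, a fraction `1
/ m` of `rowScale`. -/
lemma hitProb_sub_le {n m i u : ℕ} (hm : 2 ≤ m) (hmn : m ≤ n) :
    |hitProb n m i u - rowScale n m i u| ≤ rowScale n m i u / m := by
  have h1 : (2 : ℝ) ≤ m := by exact_mod_cast hm
  have h2 : (m : ℝ) ≤ n := by exact_mod_cast hmn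
  unfold hitProb rowScale
  split_ifs
  · simp
  · have hn1 : (0 : ℝ) < (n : ℝ) - 1 := by linarith
    have hn : (0 : ℝ) < n := by linarith
    have e : ((m : ℝ) - 1) / ((n : ℝ) - 1) - m / n = - ((n - m) / (n * (n - 1))) := by
      field_simp; ring
    rw [e, abs_neg, abs_of_nonneg (div_nonneg (by linarith) (by positivity))]
    have e2 : (m : ℝ) / n / m = 1 / n := by field_simp
    rw [e2, div_le_div_iff₀ (by positivity) hn]
    nlinarith

lemma hitProb_le {n m i u : ℕ} (hm : 2 ≤ m) (hmn : m ≤ n) :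
    hitProb n m i u ≤ 2 * rowScale n m i u := by
  have h := (abs_le.1 (hitProb_sub_le (i := i) (u := u) hm hmn)).2
  have h1 : (2 : ℝ) ≤ m := by exact_mod_cast hm
  have : rowScale n m i u / m ≤ rowScale n m i u :=
    div_le_self (rowScale_nonneg _ _ _ _) (by linarith)
  linarith

/-- The coefficients of degree one in terms of the probability of covering an edge. -/
lemma exists_abs_coef_singleton_sub_le (q L : ℝ) (hq : 1 ≤ q) (hL : 0 ≤ L) :
    ∃ C : ℝ, 0 ≤ C ∧ ∀ {n m i K : ℕ} {b : Finset ℕ} {u v : ℕ}, 2 ≤ m → m ≤ n → K ≤ n →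
      i ∈ side n → b ⊆ side n → (m : ℝ) * K ≤ L * n → (m : ℝ) * b.card ≤ L * n →
      u ∈ side n → v ∈ side n → (u, v) ∉ side K ×ˢ b →
      |coef n m q (side K ×ˢ b) i {(u, v)} - 2 * expTrunc m (q - 1) * hitProb n m i u / n| ≤
        C * rowScale n m i u / (m * n) := by
  set D := 2 * q ^ 2 with hD
  have hq2 : 1 ≤ q ^ 2 := one_le_pow₀ hq
  have hD1 : 1 ≤ D := by linarith
  have hq0 : 0 ≤ q := by linarith
  set E := Real.exp ((D - 1) * L) with hE
  -- The prefactor is that of the error for fixed vertex sets. The first `2` comes from `hitProb ≤ 2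
  -- * rowScale`, the factor `2 + L` from `A ∩ side K` with `i`, `u ∈ A`, and `D * E` from the
  -- exponential moment of `B ∩ b` with `v ∈ B`.
  refine ⟨6 * q ^ 2 * Real.exp (q - 1) * (2 + (2 + L) * (D * E)), by positivity, ?_⟩
  intro n m i K b u v hm hmn hKn hi hb hmK hmb hu hv huv
  have hmR : (0 : ℝ) < m := by exact_mod_cast (by omega : 0 < m)
  have hnR : (0 : ℝ) < n := by exact_mod_cast (by omega : 0 < n)
  have hN := normConst_pos hmn
  have hnc := normConst_eq (m := m) hi (by omega)
  have hcu := card_supersets_filter_mem hm hmn hi hu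
  have hcv := card_powersetCard_filter_mem (by omega : 1 ≤ m) hmn hv
  set 𝒜 := supersets (side n) m {i}
  set ℬ := (side n).powersetCard m
  set F : ℝ := (m.factorial : ℝ) ^ 2 with hF
  have hF0 : 0 < F := by positivity
  set f : Finset ℕ → Finset ℕ → ℝ := fun A B => ∑ σ : ↥A ≃ ↥B, ∑ τ : ↥A ≃ ↥B,
    (if {(u, v)} ⊆ Config.edges ⟨(A, B), (σ, τ)⟩ \ side K ×ˢ b then
        Config.wt q (side K ×ˢ b) ⟨(A, B), (σ, τ)⟩ else 0) with hf
  have hzero : ∀ A B, ¬ (u ∈ A ∧ v ∈ B) → f A B = 0 := by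
    intro A B h
    refine Finset.sum_eq_zero fun σ _ => Finset.sum_eq_zero fun τ _ => if_neg fun hs => h ?_
    have := edges_subset_product _ (Finset.mem_sdiff.1 (Finset.singleton_subset_iff.1 hs)).1
    exact Finset.mem_product.1 this
  have hcoef : coef n m q (side K ×ˢ b) i {(u, v)} =
      (normConst n m)⁻¹ * ∑ A ∈ 𝒜.filter (u ∈ ·), ∑ B ∈ ℬ.filter (v ∈ ·), f A B := by
    rw [coef, sum_configs, Finset.sum_filter]
    congr 1
    refine Finset.sum_congr rfl fun A _ => ?_
    rw [Finset.sum_filter]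
    split_ifs with hA
    · refine Finset.sum_congr rfl fun B _ => ?_
      split_ifs with hB
      · rfl
      · exact hzero A B fun h => hB h.2
    · exact Finset.sum_eq_zero fun B _ => hzero A B fun h => hA h.1
  set c0 : ℝ := 2 * (F / m) * expTrunc m (q - 1) with hc0
  set a : ℝ := (𝒜.card : ℝ) with ha
  set c : ℝ := (ℬ.card : ℝ) with hc
  have hac : 0 < a * c := by
    rw [hnc] at hN
    exact pos_of_mul_pos_left hN hF0.le
  have ha0 : 0 ≤ a := Nat.cast_nonneg _
  have hc0' : 0 ≤ c := Nat.cast_nonneg _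
  -- The main term is what results when every admissible pair `A ∋ u`, `B ∋ v` contributes the same
  -- constant `c0`.
  have hmain : 2 * expTrunc m (q - 1) * hitProb n m i u / n =
      (normConst n m)⁻¹ * ∑ A ∈ 𝒜.filter (u ∈ ·), ∑ B ∈ ℬ.filter (v ∈ ·), c0 := by
    rw [Finset.sum_const, Finset.sum_const, nsmul_eq_mul, nsmul_eq_mul, hcu, hcv, hnc, hc0]
    have := left_ne_zero_of_mul hac.ne'
    have := right_ne_zero_of_mul hac.ne'
    field_simp
  rw [hcoef, hmain, ← mul_sub, abs_mul, abs_of_pos (inv_pos.2 hN), ← Finset.sum_sub_distrib]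
  simp only [← Finset.sum_sub_distrib]
  set G : ℝ := 6 * q ^ 2 * Real.exp (q - 1) * (F / (m : ℝ) ^ 2) with hG
  have hG0 : 0 ≤ G := by positivity
  have hsum : |∑ A ∈ 𝒜.filter (u ∈ ·), ∑ B ∈ ℬ.filter (v ∈ ·), (f A B - c0)| ≤
      ∑ A ∈ 𝒜.filter (u ∈ ·), ∑ B ∈ ℬ.filter (v ∈ ·),
        G * (1 + (A ∩ side K).card * D ^ (B ∩ b).card) := by
    refine (Finset.abs_sum_le_sum_abs _ _).trans (Finset.sum_le_sum fun A hA =>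
      (Finset.abs_sum_le_sum_abs _ _).trans (Finset.sum_le_sum fun B hB => ?_))
    have hA' := Finset.mem_filter.1 hA
    have hB' := Finset.mem_filter.1 hB
    exact abs_inner_sum_sub_le hm (Finset.mem_powersetCard.1 (Finset.mem_filter.1 hA'.1).1).2
      (Finset.mem_powersetCard.1 hB'.1).2 hq (Finset.mem_product.2 ⟨hA'.2, hB'.2⟩) huv
  have hAsum : ∑ A ∈ 𝒜.filter (u ∈ ·), ((A ∩ side K).card : ℝ) ≤
      a * (rowScale n m i u * (2 + L)) := by
    have hK : side K ⊆ side n := Finset.Icc_subset_Icc le_rfl hKn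
    have := sum_card_inter_mem_le (m := m) hi hu hK (by rwa [card_side])
    rw [card_side, card_side] at this
    refine this.trans (mul_le_mul_of_nonneg_left ?_ ha0)
    refine mul_le_mul_of_nonneg_left ?_ (rowScale_nonneg n m i u)
    have : (K : ℝ) * (m / n) ≤ L := by
      rw [← mul_div_assoc, div_le_iff₀ hnR]; linarith
    linarith
  have hBsum : ∑ B ∈ ℬ.filter (v ∈ ·), D ^ (B ∩ b).card ≤ c * (m / n * D * E) := by
    have := sum_pow_card_inter_le (m := m) (Finset.singleton_subset_iff.2 hv) hb
      (by rwa [card_side]) hD1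
    simp only [supersets, Finset.singleton_subset_iff, Finset.card_singleton, pow_one,
      card_side] at this
    refine this.trans (mul_le_mul_of_nonneg_left ?_ hc0')
    refine mul_le_mul_of_nonneg_left (Real.exp_le_exp.2 ?_) (by positivity)
    rw [mul_assoc]
    refine mul_le_mul_of_nonneg_left ?_ (by linarith)
    rw [div_mul_eq_mul_div, div_le_iff₀ hnR]; exact hmb
  have hr0 := rowScale_nonneg n m i u
  have hL2 : 0 ≤ 2 + L := by linarith
  have hE0 : 0 ≤ E := Real.exp_nonneg _
  have hfD : ∀ B : Finset ℕ, 0 ≤ D ^ (B ∩ b).card := fun B => pow_nonneg (by linarith) _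
  clear_value a c G E
  have htot : ∑ A ∈ 𝒜.filter (u ∈ ·), ∑ B ∈ ℬ.filter (v ∈ ·),
        G * (1 + (A ∩ side K).card * D ^ (B ∩ b).card) ≤
      G * (a * c * (m / n) * rowScale n m i u * (2 + (2 + L) * (D * E))) := by
    simp only [← Finset.mul_sum, Finset.sum_add_distrib, ← Finset.sum_mul]
    refine mul_le_mul_of_nonneg_left ?_ hG0
    simp only [Finset.sum_const, nsmul_eq_mul, mul_one]
    rw [hcu, hcv]
    have h1 : hitProb n m i u * a * (m / n * c) ≤ 2 * rowScale n m i u * a * (m / n * c) := by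
      have := hitProb_le (i := i) (u := u) hm hmn
      gcongr
    have h2 := mul_le_mul hAsum hBsum (Finset.sum_nonneg fun B _ => hfD B)
      (mul_nonneg ha0 (mul_nonneg hr0 hL2))
    calc _ ≤ 2 * rowScale n m i u * a * (m / n * c) +
          a * (rowScale n m i u * (2 + L)) * (c * (m / n * D * E)) := add_le_add h1 h2
      _ = _ := by ring
  refine (mul_le_mul_of_nonneg_left (hsum.trans htot) (inv_nonneg.2 hN.le)).trans (le_of_eq ?_)
  rw [hnc, hG]
  have := left_ne_zero_of_mul hac.ne'
  have := right_ne_zero_of_mul hac.ne'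
  field_simp

/-- The coefficients of degree one are asymptotic to `linCoef`. -/
lemma exists_abs_coef_sub_linCoef_le (q L : ℝ) (hq : 1 ≤ q) (hL : 0 ≤ L) :
    ∃ C : ℝ, 0 ≤ C ∧ ∀ {n m i K : ℕ} {b : Finset ℕ} {u v : ℕ}, 2 ≤ m → m ≤ n → K ≤ n →
      i ∈ side n → b ⊆ side n → (m : ℝ) * K ≤ L * n → (m : ℝ) * b.card ≤ L * n →
      u ∈ side n → v ∈ side n → (u, v) ∉ side K ×ˢ b →
      |coef n m q (side K ×ˢ b) i {(u, v)} - linCoef n m i q u| ≤ rowScale n m i u / n *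
        (C / m + C * (m / n) + 4 * |expTrunc m (q - 1) - Real.exp (q - 1)|) := by
  obtain ⟨C, hC, h⟩ := exists_abs_coef_singleton_sub_le q L hq hL
  set e := Real.exp (q - 1)
  have he : 0 < e := Real.exp_pos _
  refine ⟨C + 2 * e, by positivity, ?_⟩
  intro n m i K b u v hm hmn hKn hi hb hmK hmb hu hv huv
  have h1 := h hm hmn hKn hi hb hmK hmb hu hv huv
  have hmR : (0 : ℝ) < m := by exact_mod_cast (by omega : 0 < m)
  have hnR : (0 : ℝ) < n := by exact_mod_cast (by omega : 0 < n)
  set r := rowScale n m i u with hr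
  have hr0 : 0 ≤ r := rowScale_nonneg n m i u
  set δ := |expTrunc m (q - 1) - e|
  have hδ : 0 ≤ δ := abs_nonneg _
  have hp0 := hitProb_nonneg i u hm hmn
  have h2 : |2 * expTrunc m (q - 1) * hitProb n m i u / n - 2 * e * hitProb n m i u / n| ≤
      r / n * (4 * δ) := by
    rw [show 2 * expTrunc m (q - 1) * hitProb n m i u / n - 2 * e * hitProb n m i u / n =
      (expTrunc m (q - 1) - e) * (2 * hitProb n m i u / n) by ring, abs_mul,
      abs_of_nonneg (show 0 ≤ 2 * hitProb n m i u / n by positivity)]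
    have := hitProb_le (i := i) (u := u) hm hmn
    calc δ * (2 * hitProb n m i u / n) ≤ δ * (2 * (2 * r) / n) := by gcongr
      _ = _ := by ring
  have h3 : |2 * e * hitProb n m i u / n - 2 * e * r / n| ≤ r / n * (2 * e / m) := by
    rw [show 2 * e * hitProb n m i u / n - 2 * e * r / n = (hitProb n m i u - r) * (2 * e / n) by
      ring, abs_mul, abs_of_nonneg (show 0 ≤ 2 * e / n by positivity)]
    calc _ ≤ r / m * (2 * e / n) :=
          mul_le_mul_of_nonneg_right (hitProb_sub_le hm hmn) (by positivity)
      _ = _ := by ring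
  -- Off the row `u = i` both expressions coincide; on that row `linCoef` has the extra term `m / n
  -- ^ 2`.
  have h4 : |2 * e * r / n - linCoef n m i q u| ≤ r / n * (2 * e * (m / n)) := by
    rw [linCoef, hr, rowScale]
    split_ifs with hui
    · rw [show 2 * e * 1 / n - 2 * Real.exp (q - 1) * (1 / n + m / (n : ℝ) ^ 2) =
        -(2 * e * (m / (n : ℝ) ^ 2)) by simp only [e]; ring, abs_neg,
        abs_of_nonneg (by positivity)]
      apply le_of_eq; field_simp
    · rw [show 2 * e * (m / n) / n - 2 * Real.exp (q - 1) * (0 / n + m / (n : ℝ) ^ 2) = 0 by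
        simp only [e]; field_simp; ring, abs_zero]
      positivity
  have hA := abs_sub_le (coef n m q (side K ×ˢ b) i {(u, v)})
    (2 * expTrunc m (q - 1) * hitProb n m i u / n) (linCoef n m i q u)
  have hB := abs_sub_le (2 * expTrunc m (q - 1) * hitProb n m i u / n)
    (2 * e * hitProb n m i u / n) (linCoef n m i q u)
  have hC' := abs_sub_le (2 * e * hitProb n m i u / n) (2 * e * r / n) (linCoef n m i q u)
  have e1 : C * r / (m * n) = r / n * (C / m) := by field_simp
  have e2 : r / n * ((C + 2 * e) / m + (C + 2 * e) * (m / n) + 4 * δ) =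
      r / n * (C / m) + r / n * (2 * e / m) + r / n * (2 * e * (m / n)) + r / n * (4 * δ) +
        r / n * (C * (m / n)) := by ring
  have e3 : 0 ≤ r / n * (C * (m / n)) := by positivity
  rw [e2]
  rw [e1] at h1
  linarith

end Linear

/-! ### The error of the linear approximation. -/

section ErrorPolynomial

lemma sum_product_fst {ι κ : Type*} (s : Finset ι) (t : Finset κ) (f : ι → ℝ) :
    ∑ e ∈ s ×ˢ t, f e.1 = t.card * ∑ u ∈ s, f u := by
  rw [Finset.sum_product, Finset.mul_sum]
  refine Finset.sum_congr rfl fun u _ => ?_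
  simp

/-- The coefficients of a linear form. -/
noncomputable def linearCoeffs {ι : Type*} (g : ι → ℝ) (S : Finset ι) : ℝ :=
  if S.card = 1 then ∑ e ∈ S, g e else 0

lemma sum_powerset_card_one {ι : Type*} (F : Finset ι) (f : Finset ι → ℝ) :
    ∑ S ∈ F.powerset with S.card = 1, f S = ∑ e ∈ F, f {e} := by
  rw [← Finset.powersetCard_eq_filter, Finset.powersetCard_one, Finset.sum_map]
  rfl

lemma multilinear_linearCoeffs {ι : Type*} (F : Finset ι) (g : ι → ℝ) (x : ι → ℝ) :
    multilinear F (linearCoeffs g) x = ∑ e ∈ F, g e * x e := by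
  have : ∀ S : Finset ι, linearCoeffs g S * ∏ e ∈ S, x e =
      if S.card = 1 then (∑ e ∈ S, g e) * ∏ e ∈ S, x e else 0 := fun S => by
    rw [linearCoeffs]; split_ifs <;> simp
  rw [multilinear, Finset.sum_congr rfl fun S _ => this S, ← Finset.sum_filter,
    sum_powerset_card_one]
  simp

lemma sum_sq_linearCoeffs {ι : Type*} (F : Finset ι) (g : ι → ℝ) (t : ℝ) :
    ∑ S ∈ F.powerset, t ^ S.card * linearCoeffs g S ^ 2 = t * ∑ e ∈ F, g e ^ 2 := by
  have : ∀ S : Finset ι, t ^ S.card * linearCoeffs g S ^ 2 =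
      if S.card = 1 then t ^ S.card * (∑ e ∈ S, g e) ^ 2 else 0 := fun S => by
    rw [linearCoeffs]; split_ifs <;> simp
  rw [Finset.sum_congr rfl fun S _ => this S, ← Finset.sum_filter, sum_powerset_card_one,
    Finset.mul_sum]
  simp

/-- The coefficients of the difference between the rescaled centered weight and its linear
approximation. -/
noncomputable def errCoef (n m K : ℕ) (q : ℝ) (b : Finset ℕ) (i : ℕ) (S : Finset (ℕ × ℕ)) : ℝ :=
  √n * ((if S = ∅ then 0 else coef n m q (side K ×ˢ b) i S) -
    linearCoeffs (fun e => linCoef n m i q e.1) S)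

lemma multilinear_errCoef (n m K : ℕ) (q : ℝ) (b : Finset ℕ) (i : ℕ) (x : ℕ × ℕ → ℝ) :
    multilinear (side n ×ˢ side n) (errCoef n m K q b i) x =
      √n * (multilinear (side n ×ˢ side n) (coef n m q (side K ×ˢ b) i) x -
        coef n m q (side K ×ˢ b) i ∅) -
      √n * ∑ e ∈ side n ×ˢ side n, linCoef n m i q e.1 * x e := by
  rw [← multilinear_linearCoeffs]
  unfold multilinear errCoef
  have h0 : (∅ : Finset (ℕ × ℕ)) ∈ (side n ×ˢ side n).powerset := Finset.empty_mem_powerset _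
  have h1 : ∑ S ∈ (side n ×ˢ side n).powerset, coef n m q (side K ×ˢ b) i S * ∏ e ∈ S, x e -
      coef n m q (side K ×ˢ b) i ∅ = ∑ S ∈ (side n ×ˢ side n).powerset,
        (if S = ∅ then 0 else coef n m q (side K ×ˢ b) i S) * ∏ e ∈ S, x e := by
    rw [← Finset.add_sum_erase _ _ h0, ← Finset.add_sum_erase (a := ∅) _ (fun S =>
      (if S = ∅ then 0 else coef n m q (side K ×ˢ b) i S) * ∏ e ∈ S, x e) h0]
    simp only [Finset.prod_empty, mul_one, if_true, zero_add, add_sub_cancel_left]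
    refine Finset.sum_congr rfl fun S hS => ?_
    rw [if_neg (Finset.ne_of_mem_erase hS)]
  rw [h1, ← mul_sub, ← Finset.sum_sub_distrib, Finset.mul_sum]
  refine Finset.sum_congr rfl fun S _ => ?_
  ring

/-- The subtracted linear form affects only singletons and the empty set is excluded, so the sum
separates by degree. -/
lemma sum_sq_errCoef (n m K : ℕ) (q : ℝ) (b : Finset ℕ) (i : ℕ) (t : ℝ) :
    ∑ S ∈ (side n ×ˢ side n).powerset, t ^ S.card * errCoef n m K q b i S ^ 2 =
      n * (∑ S ∈ (side n ×ˢ side n).powerset with 2 ≤ S.card,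
        t ^ S.card * coef n m q (side K ×ˢ b) i S ^ 2) +
      n * (t * ∑ e ∈ side n ×ˢ side n,
        (coef n m q (side K ×ˢ b) i {e} - linCoef n m i q e.1) ^ 2) := by
  have h1 : ∀ S : Finset (ℕ × ℕ), t ^ S.card * errCoef n m K q b i S ^ 2 =
      n * (if 2 ≤ S.card then t ^ S.card * coef n m q (side K ×ˢ b) i S ^ 2 else 0) +
      n * (if S.card = 1 then t ^ S.card * (coef n m q (side K ×ˢ b) i S -
        ∑ e ∈ S, linCoef n m i q e.1) ^ 2 else 0) := by
    intro S
    rw [errCoef, linearCoeffs, mul_pow, Real.sq_sqrt (Nat.cast_nonneg n)]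
    rcases Nat.lt_or_ge S.card 1 with h | h
    · have : S = ∅ := Finset.card_eq_zero.1 (by omega)
      subst this
      simp
    · have hne : S ≠ ∅ := fun h0 => by simp [h0] at h
      rw [if_neg hne]
      by_cases h2 : 2 ≤ S.card
      · rw [if_neg (by omega), if_pos h2, if_neg (by omega)]; ring
      · rw [if_pos (by omega), if_neg h2, if_pos (by omega)]; ring
  rw [Finset.sum_congr rfl fun S _ => h1 S, Finset.sum_add_distrib, ← Finset.mul_sum,
    ← Finset.mul_sum, ← Finset.sum_filter, ← Finset.sum_filter, sum_powerset_card_one,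
    Finset.mul_sum (a := t)]
  simp

/-- The row `u = i` contributes one, and the other rows together at most `n * (m / n) ^ 2 ≤ L`. -/
lemma sum_side_rowScale_sq_le {n m i : ℕ} {L : ℝ} (hn : 0 < n) (hmL : (m : ℝ) ^ 2 ≤ L * n) :
    ∑ u ∈ side n, rowScale n m i u ^ 2 ≤ 1 + L := by
  have hnR : (0 : ℝ) < n := by exact_mod_cast hn
  have h1 : ∀ u, rowScale n m i u ^ 2 ≤ (if u = i then 1 else 0) + ((m : ℝ) / n) ^ 2 := by
    intro u
    unfold rowScale
    split_ifs
    · nlinarith [sq_nonneg ((m : ℝ) / n)]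
    · simp
  refine (Finset.sum_le_sum fun u _ => h1 u).trans ?_
  rw [Finset.sum_add_distrib, Finset.sum_ite_eq', Finset.sum_const, card_side, nsmul_eq_mul]
  refine add_le_add (by split_ifs <;> norm_num) ?_
  rw [div_pow, ← mul_div_assoc, div_le_iff₀ (by positivity)]
  nlinarith

lemma linCoef_sq_le (n m i : ℕ) (q : ℝ) (u : ℕ) :
    linCoef n m i q u ^ 2 ≤ 16 * Real.exp (q - 1) ^ 2 * ((rowScale n m i u) ^ 2 / (n : ℝ) ^ 2 +
      (m : ℝ) ^ 2 / (n : ℝ) ^ 4) := by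
  unfold linCoef rowScale
  set e := Real.exp (q - 1)
  have he : 0 ≤ e ^ 2 := sq_nonneg _
  split_ifs with h
  · have : (1 / (n : ℝ) + m / (n : ℝ) ^ 2) ^ 2 ≤ 2 * (1 ^ 2 / (n : ℝ) ^ 2 +
      (m : ℝ) ^ 2 / (n : ℝ) ^ 4) := by
      have := add_sq_le (a := 1 / (n : ℝ)) (b := m / (n : ℝ) ^ 2)
      calc _ ≤ _ := this
        _ = _ := by ring
    have h0 : 0 ≤ 1 ^ 2 / (n : ℝ) ^ 2 + (m : ℝ) ^ 2 / (n : ℝ) ^ 4 := by positivity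
    calc _ = 4 * e ^ 2 * (1 / (n : ℝ) + m / (n : ℝ) ^ 2) ^ 2 := by ring
      _ ≤ 4 * e ^ 2 * (2 * (1 ^ 2 / (n : ℝ) ^ 2 + (m : ℝ) ^ 2 / (n : ℝ) ^ 4)) := by gcongr
      _ ≤ _ := by nlinarith [mul_nonneg he h0]
  · have h0 : 0 ≤ (m / (n : ℝ)) ^ 2 / (n : ℝ) ^ 2 := by positivity
    have h1 : 0 ≤ (m : ℝ) ^ 2 / (n : ℝ) ^ 4 := by positivity
    calc _ = 4 * e ^ 2 * ((m : ℝ) ^ 2 / (n : ℝ) ^ 4) := by ring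
      _ ≤ _ := by nlinarith [mul_nonneg he h0, mul_nonneg he h1]

/-- The squared coefficients of the linear approximation. -/
lemma sum_linCoef_sq_le {n m i K : ℕ} {b : Finset ℕ} {q L : ℝ} (hn : 0 < n) (hKn : K ≤ n)
    (hmL : (m : ℝ) ^ 2 ≤ L * n) :
    n * ∑ e ∈ side K ×ˢ b, linCoef n m i q e.1 ^ 2 ≤
      16 * Real.exp (q - 1) ^ 2 * (1 + 2 * L) * (b.card / n) := by
  have hnR : (0 : ℝ) < n := by exact_mod_cast hn
  have h1 : ∑ e ∈ side K ×ˢ b, linCoef n m i q e.1 ^ 2 =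
      b.card * ∑ u ∈ side K, linCoef n m i q u ^ 2 :=
    sum_product_fst _ _ fun u => linCoef n m i q u ^ 2
  have h2 : ∑ u ∈ side K, linCoef n m i q u ^ 2 ≤
      16 * Real.exp (q - 1) ^ 2 * ((1 + 2 * L) / (n : ℝ) ^ 2) := by
    have hK : side K ⊆ side n := Finset.Icc_subset_Icc le_rfl hKn
    calc _ ≤ ∑ u ∈ side n, linCoef n m i q u ^ 2 :=
          Finset.sum_le_sum_of_subset_of_nonneg hK fun _ _ _ => sq_nonneg _
      _ ≤ ∑ u ∈ side n, 16 * Real.exp (q - 1) ^ 2 * ((rowScale n m i u) ^ 2 / (n : ℝ) ^ 2 +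
          (m : ℝ) ^ 2 / (n : ℝ) ^ 4) := Finset.sum_le_sum fun u _ => linCoef_sq_le n m i q u
      _ = 16 * Real.exp (q - 1) ^ 2 * ((∑ u ∈ side n, (rowScale n m i u) ^ 2) / (n : ℝ) ^ 2 +
          n * ((m : ℝ) ^ 2 / (n : ℝ) ^ 4)) := by
          rw [← Finset.mul_sum, Finset.sum_add_distrib, Finset.sum_div, Finset.sum_const,
            card_side, nsmul_eq_mul]
      _ ≤ 16 * Real.exp (q - 1) ^ 2 * ((1 + L) / (n : ℝ) ^ 2 + L / (n : ℝ) ^ 2) := by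
          refine mul_le_mul_of_nonneg_left (add_le_add ?_ ?_) (by positivity)
          · exact div_le_div_of_nonneg_right (sum_side_rowScale_sq_le hn hmL) (by positivity)
          · rw [← mul_div_assoc, div_le_div_iff₀ (by positivity) (by positivity)]
            calc (n : ℝ) * (m : ℝ) ^ 2 * (n : ℝ) ^ 2 ≤ n * (L * n) * (n : ℝ) ^ 2 := by gcongr
              _ = _ := by ring
      _ = _ := by ring
  rw [h1]
  calc _ = (n : ℝ) * b.card * ∑ u ∈ side K, linCoef n m i q u ^ 2 := by ring
    _ ≤ (n : ℝ) * b.card * (16 * Real.exp (q - 1) ^ 2 * ((1 + 2 * L) / (n : ℝ) ^ 2)) := by gcongr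
    _ = _ := by field_simp

/-- The error polynomial is small. -/
lemma exists_sum_sq_errCoef_le (q t L : ℝ) (hq : 1 ≤ q) (ht : 0 ≤ t) (hL : 0 ≤ L) :
    ∃ C : ℝ, 0 ≤ C ∧ ∀ {n m i K : ℕ} {b : Finset ℕ}, 2 ≤ m → m ≤ n → K ≤ n →
      i ∈ side n → b ⊆ side n → (m : ℝ) ^ 2 ≤ L * n → (m : ℝ) * K ≤ L * n →
      (m : ℝ) * b.card ≤ L * n →
      ∑ S ∈ (side n ×ˢ side n).powerset, t ^ S.card * errCoef n m K q b i S ^ 2 ≤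
        C * (1 / n + b.card / n +
          (1 / m + m / n + |expTrunc m (q - 1) - Real.exp (q - 1)|) ^ 2) := by
  obtain ⟨C₁, hC₁, h₁⟩ := exists_sum_sq_coef_le q t L hq ht hL
  obtain ⟨C₂, hC₂, h₂⟩ := exists_abs_coef_sub_linCoef_le q L hq hL
  set E := Real.exp (q - 1)
  refine ⟨C₁ + t * (16 * E ^ 2 * (1 + 2 * L)) + t * ((1 + L) * (C₂ + 4) ^ 2), by positivity, ?_⟩
  intro n m i K b hm hmn hKn hi hb hmL hmK hmb
  have hn : 0 < n := by omega
  have hmR : (0 : ℝ) < m := by exact_mod_cast (by omega : 0 < m)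
  have hnR : (0 : ℝ) < n := by exact_mod_cast hn
  set δ := |expTrunc m (q - 1) - E|
  have hδ : 0 ≤ δ := abs_nonneg _
  set ε : ℝ := 1 / m + m / n + δ with hε
  have hε0 : 0 ≤ ε := by positivity
  have hKside : side K ⊆ side n := Finset.Icc_subset_Icc le_rfl hKn
  rw [sum_sq_errCoef]
  have f1 : n * (∑ S ∈ (side n ×ˢ side n).powerset with 2 ≤ S.card,
        t ^ S.card * coef n m q (side K ×ˢ b) i S ^ 2) ≤ C₁ * (1 / n) := by
    have := h₁ (Q := side K ×ˢ b) hm hmn hi hb (fun e he => (Finset.mem_product.1 he).2) hmL hmb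
    calc _ ≤ n * (C₁ / (n : ℝ) ^ 2) := by gcongr
      _ = _ := by field_simp
  have hsub : side K ×ˢ b ⊆ side n ×ˢ side n := Finset.product_subset_product hKside hb
  -- On planted edges the true coefficient vanishes, so the error is the whole of `linCoef`; the
  -- small number of columns in `b` makes it `O(|b| / n)`.
  have f2 : n * ∑ e ∈ side K ×ˢ b, (coef n m q (side K ×ˢ b) i {e} - linCoef n m i q e.1) ^ 2 ≤
      16 * E ^ 2 * (1 + 2 * L) * (b.card / n) := by
    refine le_trans (le_of_eq ?_) (sum_linCoef_sq_le (i := i) hn hKn hmL)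
    congr 1
    refine Finset.sum_congr rfl fun e he => ?_
    rw [coef_eq_zero (by simpa using he)]
    ring
  -- Off the planted edges each coefficient is accurate up to a fraction of order `ε` of `rowScale /
  -- n`, and the squares of `rowScale` are summable.
  have f3 : n * ∑ e ∈ (side n ×ˢ side n) \ (side K ×ˢ b),
      (coef n m q (side K ×ˢ b) i {e} - linCoef n m i q e.1) ^ 2 ≤
      (1 + L) * (C₂ + 4) ^ 2 * ε ^ 2 := by
    have hpt : ∀ e ∈ (side n ×ˢ side n) \ (side K ×ˢ b),
        (coef n m q (side K ×ˢ b) i {e} - linCoef n m i q e.1) ^ 2 ≤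
        rowScale n m i e.1 ^ 2 * (((C₂ + 4) * ε) ^ 2 / (n : ℝ) ^ 2) := by
      intro e he
      have he := Finset.mem_sdiff.1 he
      have he1 := Finset.mem_product.1 he.1
      have := h₂ (u := e.1) (v := e.2) hm hmn hKn hi hb hmK hmb he1.1 he1.2 he.2
      have hr := rowScale_nonneg n m i e.1
      rw [← sq_abs]
      have hle : C₂ / m + C₂ * (m / n) + 4 * δ ≤ (C₂ + 4) * ε := by
        have a1 : 0 ≤ 1 / (m : ℝ) := by positivity
        have a2 : 0 ≤ (m : ℝ) / n := by positivity
        have a3 : C₂ / m = C₂ * (1 / m) := by ring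
        rw [hε, a3]
        nlinarith [mul_nonneg hC₂ hδ]
      calc _ ≤ (rowScale n m i e.1 / n * ((C₂ + 4) * ε)) ^ 2 := by
            refine pow_le_pow_left₀ (abs_nonneg _) (this.trans ?_) 2
            exact mul_le_mul_of_nonneg_left hle (by positivity)
        _ = _ := by ring
    calc _ ≤ (n : ℝ) * ∑ e ∈ (side n ×ˢ side n) \ (side K ×ˢ b),
          rowScale n m i e.1 ^ 2 * (((C₂ + 4) * ε) ^ 2 / (n : ℝ) ^ 2) :=
          mul_le_mul_of_nonneg_left (Finset.sum_le_sum hpt) hnR.le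
      _ ≤ (n : ℝ) * ∑ e ∈ side n ×ˢ side n,
          rowScale n m i e.1 ^ 2 * (((C₂ + 4) * ε) ^ 2 / (n : ℝ) ^ 2) := by
          refine mul_le_mul_of_nonneg_left (Finset.sum_le_sum_of_subset_of_nonneg
            Finset.sdiff_subset fun _ _ _ => by positivity) hnR.le
      _ = n * (n * (∑ u ∈ side n, rowScale n m i u ^ 2) *
          (((C₂ + 4) * ε) ^ 2 / (n : ℝ) ^ 2)) := by
          rw [← Finset.sum_mul, sum_product_fst _ _ fun u => rowScale n m i u ^ 2, card_side]
      _ ≤ n * (n * (1 + L) * (((C₂ + 4) * ε) ^ 2 / (n : ℝ) ^ 2)) := by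
          have := sum_side_rowScale_sq_le (i := i) hn hmL
          gcongr
      _ = _ := by field_simp
  rw [← Finset.sum_sdiff hsub]
  have hb0 : (0 : ℝ) ≤ b.card / n := by positivity
  have hn1 : (0 : ℝ) ≤ 1 / n := by positivity
  have g2 := mul_le_mul_of_nonneg_left f2 ht
  have g3 := mul_le_mul_of_nonneg_left f3 ht
  set c2 := t * (16 * E ^ 2 * (1 + 2 * L)) with hc2
  set c3 := t * ((1 + L) * (C₂ + 4) ^ 2) with hc3
  have hc20 : 0 ≤ c2 := by positivity
  have hc30 : 0 ≤ c3 := by positivity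
  have g2' : t * (16 * E ^ 2 * (1 + 2 * L) * (b.card / n)) = c2 * (b.card / n) := by
    rw [hc2]; ring
  have g3' : t * ((1 + L) * (C₂ + 4) ^ 2 * ε ^ 2) = c3 * ε ^ 2 := by rw [hc3]; ring
  rw [g2'] at g2
  rw [g3'] at g3
  have hε2 := sq_nonneg ε
  clear_value c2 c3 ε
  have a1 := mul_le_mul_of_nonneg_left
    (show (1 : ℝ) / n ≤ 1 / n + b.card / n + ε ^ 2 by linarith) hC₁
  have a2 := mul_le_mul_of_nonneg_left
    (show (b.card : ℝ) / n ≤ 1 / n + b.card / n + ε ^ 2 by linarith) hc20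
  have a3 := mul_le_mul_of_nonneg_left
    (show ε ^ 2 ≤ 1 / n + b.card / n + ε ^ 2 by linarith) hc30
  rw [add_mul, add_mul]
  have h₃ := add_le_add (add_le_add (f1.trans a1) (g2.trans a2)) (g3.trans a3)
  refine le_trans (le_of_eq ?_) h₃
  ring

end ErrorPolynomial

/-! ### Invariance of the constant term under relabelling of right vertices. -/

section Symmetry

/-- Relabelling of the right vertices of a bijection. -/
def relabel {A B : Finset ℕ} (π : Equiv.Perm ℕ) : (↥A ≃ ↥B) ≃ (↥A ≃ ↥(B.map π.toEmbedding)) :=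
  Equiv.equivCongr (Equiv.refl _) (π.subtypeEquiv fun v => by simp)

lemma relabel_apply {A B : Finset ℕ} (π : Equiv.Perm ℕ) (σ : ↥A ≃ ↥B) (u : ↥A) :
    ((relabel π σ u : ↥(B.map π.toEmbedding)) : ℕ) = π (σ u) := rfl

lemma agree_relabel {A B : Finset ℕ} (π : Equiv.Perm ℕ) (σ τ : ↥A ≃ ↥B) :
    agree (relabel π σ) (relabel π τ) = agree σ τ := by
  unfold agree
  congr 1
  ext u
  simp only [Finset.mem_filter, Finset.mem_univ, true_and, Subtype.ext_iff, relabel_apply,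
    π.injective.eq_iff]

lemma edgeSet_relabel {A B : Finset ℕ} (π : Equiv.Perm ℕ) (σ : ↥A ≃ ↥B) :
    edgeSet (relabel π σ) = (edgeSet σ).image (Prod.map id π) := by
  rw [edgeSet, edgeSet, Finset.image_image]
  rfl

lemma wt_relabel {A B : Finset ℕ} (π : Equiv.Perm ℕ) (σ τ : ↥A ≃ ↥B) (q : ℝ) (K : ℕ)
    (b : Finset ℕ) :
    Config.wt q (side K ×ˢ b.map π.toEmbedding)
      ⟨(A, B.map π.toEmbedding), (relabel π σ, relabel π τ)⟩ =
    Config.wt q (side K ×ˢ b) ⟨(A, B), (σ, τ)⟩ := by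
  have hinj : Function.Injective (Prod.map (id : ℕ → ℕ) π) :=
    Function.injective_id.prodMap π.injective
  have hcard : (Config.edges ⟨(A, B.map π.toEmbedding), (relabel π σ, relabel π τ)⟩ ∩
      side K ×ˢ b.map π.toEmbedding).card =
      (Config.edges ⟨(A, B), (σ, τ)⟩ ∩ side K ×ˢ b).card := by
    simp only [Config.edges, edgeSet_relabel]
    rw [← Finset.image_union]
    refine Eq.trans (congrArg Finset.card (Finset.ext fun e => ?_))
      (Finset.card_image_of_injective _ hinj)
    rw [Finset.mem_inter, Finset.mem_image, Finset.mem_image]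
    constructor
    · rintro ⟨⟨x, hx, rfl⟩, h⟩
      have h := Finset.mem_product.1 h
      obtain ⟨v, hv, hv'⟩ := Finset.mem_map.1 h.2
      have hv' : v = x.2 := π.injective hv'
      exact ⟨x, Finset.mem_inter.2 ⟨hx, Finset.mem_product.2 ⟨h.1, hv' ▸ hv⟩⟩, rfl⟩
    · rintro ⟨x, hx, rfl⟩
      have hx := Finset.mem_inter.1 hx
      have h := Finset.mem_product.1 hx.2
      exact ⟨⟨x, hx.1, rfl⟩, Finset.mem_product.2 ⟨h.1, Finset.mem_map_of_mem _ h.2⟩⟩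
  simp only [Config.wt, agree_relabel, hcard]

lemma sum_wt_relabel (A B : Finset ℕ) (π : Equiv.Perm ℕ) (q : ℝ) (K : ℕ) (b : Finset ℕ) :
    ∑ σ : ↥A ≃ ↥B, ∑ τ : ↥A ≃ ↥B, Config.wt q (side K ×ˢ b) ⟨(A, B), (σ, τ)⟩ =
    ∑ σ : ↥A ≃ ↥(B.map π.toEmbedding), ∑ τ : ↥A ≃ ↥(B.map π.toEmbedding),
      Config.wt q (side K ×ˢ b.map π.toEmbedding) ⟨(A, B.map π.toEmbedding), (σ, τ)⟩ :=
  Fintype.sum_equiv (relabel π) _ _ fun σ => Fintype.sum_equiv (relabel π) _ _ fun τ =>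
    (wt_relabel π σ τ q K b).symm

/-- A permutation of the right side permutes the sets `B` and carries pairs of matchings to pairs
with the same agreements and the same number of planted edges. -/
lemma coef_empty_map (n m i K : ℕ) (q : ℝ) (b : Finset ℕ) (π : Equiv.Perm ℕ)
    (hπ : (side n).map π.toEmbedding = side n) :
    coef n m q (side K ×ˢ b.map π.toEmbedding) i ∅ = coef n m q (side K ×ˢ b) i ∅ := by
  simp only [coef, sum_configs, Finset.empty_subset, if_true]
  refine congrArg _ (Finset.sum_congr rfl fun A _ => ?_)
  have hinj : Function.Injective fun B : Finset ℕ => B.map π.toEmbedding :=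
    Finset.map_injective _
  have himage : (side n).powersetCard m =
      ((side n).powersetCard m).image fun B : Finset ℕ => B.map π.toEmbedding := by
    conv_lhs => rw [← hπ, Finset.powersetCard_map, Finset.map_eq_image]
    rfl
  rw [himage, Finset.sum_image fun _ _ _ _ h => hinj h, ← himage]
  exact Finset.sum_congr rfl fun B _ => (sum_wt_relabel A B π q K b).symm

/-- A bijection from `b` to `b'` is extended to a permutation of `side n`, then by the identity to
all labels. -/
lemma exists_perm_map_eq {n : ℕ} {b b' : Finset ℕ} (hb : b ⊆ side n) (hb' : b' ⊆ side n)
    (hc : b.card = b'.card) : ∃ π : Equiv.Perm ℕ, (side n).map π.toEmbedding = side n ∧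
      b.map π.toEmbedding = b' := by
  have hcard : ∀ c : Finset ℕ, c ⊆ side n →
      Fintype.card {x : ↥(side n) // (x : ℕ) ∈ c} = c.card := by
    intro c hcs
    rw [Fintype.card_subtype]
    refine Finset.card_bij (fun x _ => (x : ℕ)) (fun x hx => (Finset.mem_filter.1 hx).2)
      (fun x _ y _ h => Subtype.ext h) fun y hy => ⟨⟨y, hcs hy⟩, by simpa using hy, rfl⟩
  let e : {x : ↥(side n) // (x : ℕ) ∈ b} ≃ {x : ↥(side n) // (x : ℕ) ∈ b'} :=
    Fintype.equivOfCardEq (by rw [hcard b hb, hcard b' hb', hc])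
  let ρ : Equiv.Perm ↥(side n) := e.extendSubtype
  let π : Equiv.Perm ℕ := Equiv.Perm.ofSubtype ρ
  have hπ : ∀ x (hx : x ∈ side n), π x = ρ ⟨x, hx⟩ := fun x hx =>
    Equiv.Perm.ofSubtype_apply_of_mem ρ hx
  refine ⟨π, ?_, ?_⟩
  · refine Finset.eq_of_subset_of_card_le (fun y hy => ?_) (by simp)
    obtain ⟨x, hx, rfl⟩ := Finset.mem_map.1 hy
    change π x ∈ side n
    rw [hπ x hx]
    exact (ρ ⟨x, hx⟩).2
  · refine Finset.eq_of_subset_of_card_le (fun y hy => ?_) (by simp [hc])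
    obtain ⟨x, hx, rfl⟩ := Finset.mem_map.1 hy
    change π x ∈ b'
    rw [hπ x (hb hx)]
    exact e.extendSubtype_mem ⟨x, hb hx⟩ hx

/-- The mean of the weight does not depend on the right side of the planted biclique. -/
lemma coef_empty_eq (n m i K : ℕ) (q : ℝ) {b b' : Finset ℕ} (hb : b ⊆ side n) (hb' : b' ⊆ side n)
    (hc : b.card = b'.card) :
    coef n m q (side K ×ˢ b) i ∅ = coef n m q (side K ×ˢ b') i ∅ := by
  obtain ⟨π, h1, rfl⟩ := exists_perm_map_eq hb hb' hc
  exact (coef_empty_map n m i K q b π h1).symm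

end Symmetry

/-! ### Restriction of polynomials to a finite index type. -/

section Transfer

variable {ι : Type*}

lemma sum_powerset_eq_sum_subtype (F : Finset ι) (f : Finset ι → ℝ) :
    ∑ S ∈ F.powerset, f S =
      ∑ S ∈ (Finset.univ : Finset ↥F).powerset, f (S.map (Function.Embedding.subtype _)) := by
  conv_lhs => rw [← Finset.attach_map_val (s := F)]
  refine (Finset.sum_bij (fun S _ => S.map (Function.Embedding.subtype _)) (fun S hS => ?_)
    (fun S _ T _ h => Finset.map_injective _ h) (fun T hT => ?_) fun _ _ => rfl).symm
  · exact Finset.mem_powerset.2 (Finset.map_subset_map.2 (Finset.mem_powerset.1 hS))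
  · obtain ⟨S, hS, rfl⟩ := Finset.subset_map_iff.1 (Finset.mem_powerset.1 hT)
    exact ⟨S, Finset.mem_powerset.2 (Finset.subset_univ _), rfl⟩

/-- Independence is given only for edges within the vertex range, as a family indexed by a subtype;
moment estimates are applied there. -/
lemma multilinear_eq_multilinear_subtype (F : Finset ι) (c : Finset ι → ℝ) (x : ι → ℝ) :
    multilinear F c x = multilinear (Finset.univ : Finset ↥F)
      (fun S => c (S.map (Function.Embedding.subtype _))) fun e => x e := by
  rw [multilinear, sum_powerset_eq_sum_subtype, multilinear]
  refine Finset.sum_congr rfl fun S _ => ?_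
  rw [Finset.prod_map]
  rfl

end Transfer

/-! ### The planted model: moments and conditioning on the biclique. -/

section Model

/-- The centered and normalized variable of the edge `e`. -/
noncomputable def edgeVar {Ω : Type*} (p : ℝ) (η : ℕ → ℕ → Ω → Bool) (ω : Ω) (e : ℕ × ℕ) : ℝ :=
  centeredEdge p (η e.1 e.2 ω)

lemma weight_edgeIndicator {Ω : Type*} {p : ℝ} (hp : p ≠ 0) (n m K i : ℕ) (η : ℕ → ℕ → Ω → Bool)
    (B₀ : Ω → Finset ℕ) (ω : Ω) :
    weight n m p (edgeIndicator K η B₀ ω) i =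
      multilinear (side n ×ˢ side n) (coef n m p⁻¹ (side K ×ˢ B₀ ω) i) (edgeVar p η ω) := by
  refine Eq.trans ?_ (weight_eq_multilinear hp n m i _ fun e => η e.1 e.2 ω)
  congr 1
  funext u v
  simp only [edgeIndicator, plantedIndicator, Finset.mem_product]

/-- The value of the centered edge variables for given edges. -/
noncomputable def extendVar (p : ℝ) (F : Finset (ℕ × ℕ)) (y : ↥F → Bool) (e : ℕ × ℕ) : ℝ :=
  if he : e ∈ F then centeredEdge p (y ⟨e, he⟩) else 0

/-- The polynomial factors through a finite Boolean array, which gives measurability and permits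
conditioning on `B₀`. -/
lemma multilinear_edgeVar {Ω : Type*} (p : ℝ) (F : Finset (ℕ × ℕ)) (c : Finset (ℕ × ℕ) → ℝ)
    (η : ℕ → ℕ → Ω → Bool) (ω : Ω) : multilinear F c (edgeVar p η ω) =
      multilinear F c (extendVar p F fun e => η e.1.1 e.1.2 ω) :=
  multilinear_congr c fun e he => by simp [extendVar, he, edgeVar]

variable {Ω : Type*} [MeasurableSpace Ω] {P : Measure Ω} {n K : ℕ}
  {p : ℝ} {η : ℕ → ℕ → Ω → Bool} {B₀ : Ω → Finset ℕ}

lemma abs_centeredEdge_le (hp0 : 0 < p) (hp1 : p < 1) (b : Bool) : |centeredEdge p b| ≤ p⁻¹ := by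
  rw [centeredEdge, abs_div, abs_of_pos hp0, div_eq_mul_inv]
  refine mul_le_of_le_one_left (by positivity) (abs_le.2 ?_)
  split_ifs <;> constructor <;> linarith

namespace IsPlantedModel

lemma measurable_edgeVar (h : IsPlantedModel P n K p η B₀) (e : ↥(side n ×ˢ side n)) :
    Measurable fun ω => edgeVar p η ω e := by
  have he := Finset.mem_product.1 e.2
  exact (Measurable.of_discrete (f := centeredEdge p)).comp
    (h.measurable_edge _ he.1 _ he.2)

lemma iIndepFun_edgeVar (h : IsPlantedModel P n K p η B₀) :
    iIndepFun (fun (e : ↥(side n ×ˢ side n)) ω => edgeVar p η ω e) P :=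
  h.indep_edge.comp (fun _ => centeredEdge p) fun _ => Measurable.of_discrete

variable [IsProbabilityMeasure P]

lemma integral_edge (h : IsPlantedModel P n K p η B₀) (f : Bool → ℝ)
    (e : ↥(side n ×ˢ side n)) :
    ∫ ω, f (η e.1.1 e.1.2 ω) ∂P = p * f true + (1 - p) * f false := by
  have he := Finset.mem_product.1 e.2
  have hms : MeasurableSet {ω | η e.1.1 e.1.2 ω = true} :=
    h.measurable_edge _ he.1 _ he.2 (measurableSet_singleton true)
  have : ∀ ω, f (η e.1.1 e.1.2 ω) =
      f false + {ω | η e.1.1 e.1.2 ω = true}.indicator (fun _ => f true - f false) ω := by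
    intro ω
    cases hb : η e.1.1 e.1.2 ω <;> simp [Set.indicator, hb]
  simp_rw [this]
  rw [integral_add (integrable_const _) ((integrable_const _).indicator hms),
    integral_indicator_const _ hms, h.bernoulli_edge _ he.1 _ he.2]
  simp
  ring

lemma integral_edgeVar (h : IsPlantedModel P n K p η B₀) (hp : p ≠ 0)
    (e : ↥(side n ×ˢ side n)) : ∫ ω, edgeVar p η ω e ∂P = 0 := by
  refine (h.integral_edge (centeredEdge p) e).trans ?_
  simp only [centeredEdge, if_true]
  field_simp
  simp

lemma integral_edgeVar_sq (h : IsPlantedModel P n K p η B₀) (hp : p ≠ 0)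
    (e : ↥(side n ×ˢ side n)) : ∫ ω, edgeVar p η ω e ^ 2 ∂P = p⁻¹ - 1 := by
  refine (h.integral_edge (fun b => centeredEdge p b ^ 2) e).trans ?_
  simp only [centeredEdge, if_true]
  field_simp
  simp
  ring

/-- Moments of polynomials in the edge variables. -/
lemma integral_multilinear_le {r : ℕ} {t : ℝ} (hp0 : 0 < p) (hp1 : p < 1)
    (ht : ∀ {ι : Type} [DecidableEq ι] (x : ι → Ω → ℝ), iIndepFun x P →
      (∀ e, Measurable (x e)) → (∀ e ω, |x e ω| ≤ p⁻¹) → (∀ e, ∫ ω, x e ω ∂P = 0) →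
      ∀ (F : Finset ι) (c : Finset ι → ℝ), ∫ ω, multilinear F c (fun e => x e ω) ^ (2 * r) ∂P ≤
        (∑ S ∈ F.powerset, t ^ S.card * c S ^ 2) ^ r)
    (h : IsPlantedModel P n K p η B₀) (c : Finset (ℕ × ℕ) → ℝ) :
    ∫ ω, multilinear (side n ×ˢ side n) c (edgeVar p η ω) ^ (2 * r) ∂P ≤
      (∑ S ∈ (side n ×ˢ side n).powerset, t ^ S.card * c S ^ 2) ^ r := by
  simp_rw [multilinear_eq_multilinear_subtype (side n ×ˢ side n) c]
  rw [sum_powerset_eq_sum_subtype]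
  refine (ht _ h.iIndepFun_edgeVar h.measurable_edgeVar (fun e ω => abs_centeredEdge_le hp0 hp1 _)
    (h.integral_edgeVar hp0.ne') Finset.univ _).trans (le_of_eq ?_)
  simp

/-- By independence every nonempty monomial has a factor of mean zero. -/
lemma integral_multilinear (hp0 : 0 < p) (hp1 : p < 1) (h : IsPlantedModel P n K p η B₀)
    (c : Finset (ℕ × ℕ) → ℝ) :
    ∫ ω, multilinear (side n ×ˢ side n) c (edgeVar p η ω) ∂P = c ∅ := by
  simp_rw [multilinear_eq_multilinear_subtype (side n ×ˢ side n) c]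
  simp only [multilinear]
  have hprod : ∀ S : Finset ↥(side n ×ˢ side n), ∀ ω, ∏ e ∈ S, edgeVar p η ω e =
      ∏ e, (fun y => if e ∈ S then y else 1) (edgeVar p η ω e) := fun S ω => by
    rw [Finset.prod_ite_mem, Finset.univ_inter]
  have hint : ∀ S : Finset ↥(side n ×ˢ side n), ∫ ω, ∏ e ∈ S, edgeVar p η ω e ∂P =
      if S = ∅ then 1 else 0 := by
    intro S
    simp_rw [hprod S]
    rw [h.iIndepFun_edgeVar.integral_fun_prod_comp (f := fun e y => if e ∈ S then y else 1)
      (fun e => (h.measurable_edgeVar e).aemeasurable)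
      (fun e => by split_ifs <;> fun_prop)]
    split_ifs with hS
    · subst hS; simp
    · obtain ⟨e, he⟩ := Finset.nonempty_iff_ne_empty.2 hS
      refine Finset.prod_eq_zero (Finset.mem_univ e) ?_
      simp [he, h.integral_edgeVar hp0.ne']
  have hintegrable : ∀ S : Finset ↥(side n ×ˢ side n),
      Integrable (fun ω => ∏ e ∈ S, edgeVar p η ω e) P := fun S =>
    integrable_of_abs_le (C := ∏ _e ∈ S, p⁻¹)
      (Finset.measurable_prod S fun e _ => h.measurable_edgeVar e).aestronglyMeasurable fun ω => by
      rw [Finset.abs_prod]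
      exact Finset.prod_le_prod (fun _ _ => abs_nonneg _)
        fun _ _ => abs_centeredEdge_le hp0 hp1 _
  rw [integral_finsetSum _ fun S _ => (hintegrable S).const_mul _]
  simp_rw [integral_const_mul, hint]
  rw [Finset.sum_eq_single ∅ (fun S _ hS => by simp [hS]) (by simp)]
  simp

/-- The prescribed probabilities of the `n.choose K` sets already sum to one. -/
lemma ae_mem_powersetCard (h : IsPlantedModel P n K p η B₀) (hK : K ≤ n) :
    ∀ᵐ ω ∂P, B₀ ω ∈ (side n).powersetCard K := by
  set T := (side n).powersetCard K with hT
  have hU : {ω | B₀ ω ∈ T} = ⋃ b ∈ T, {ω | B₀ ω = b} := by ext; simp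
  have hms : ∀ b, MeasurableSet {ω | B₀ ω = b} := fun b =>
    h.measurable_right (measurableSet_singleton b)
  have hmU : MeasurableSet {ω | B₀ ω ∈ T} := by
    rw [hU]; exact Finset.measurableSet_biUnion T fun b _ => hms b
  have hpos : ((n.choose K : ℕ) : ℝ) ≠ 0 := by exact_mod_cast (Nat.choose_pos hK).ne'
  have hreal : P.real {ω | B₀ ω ∈ T} = 1 := by
    rw [hU, measureReal_biUnion_finset _ fun b _ => hms b]
    · rw [Finset.sum_congr rfl fun b hb => h.uniform_right b hb, Finset.sum_const,
        Finset.card_powersetCard, card_side, nsmul_eq_mul, mul_inv_cancel₀ hpos]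
    · intro b _ b' _ hbb
      exact Set.disjoint_left.2 fun ω hω hω' => hbb (hω.symm.trans hω')
  have h1 : P {ω | B₀ ω ∈ T} = 1 := by
    rwa [measureReal_def, ENNReal.toReal_eq_one_iff] at hreal
  exact (mem_ae_iff_prob_eq_one hmU).2 h1

/-- Conditioning on the right side of the biclique. -/
lemma integral_right (h : IsPlantedModel P n K p η B₀) (hK : K ≤ n)
    (g : Finset ℕ → (↥(side n ×ˢ side n) → Bool) → ℝ) :
    ∫ ω, g (B₀ ω) (fun e => η e.1.1 e.1.2 ω) ∂P =
      ((n.choose K : ℕ) : ℝ)⁻¹ * ∑ b ∈ (side n).powersetCard K,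
        ∫ ω, g b (fun e => η e.1.1 e.1.2 ω) ∂P := by
  set Y : Ω → ↥(side n ×ˢ side n) → Bool := fun ω e => η e.1.1 e.1.2 ω with hY
  have hYm : Measurable Y := measurable_pi_lambda _ fun e =>
    h.measurable_edge _ (Finset.mem_product.1 e.2).1 _ (Finset.mem_product.1 e.2).2
  set T := (side n).powersetCard K with hT
  have hms : ∀ b, MeasurableSet {ω | B₀ ω = b} := fun b =>
    h.measurable_right (measurableSet_singleton b)
  have hmem : ∀ᵐ ω ∂P, B₀ ω ∈ T := h.ae_mem_powersetCard hK
  have hgb : ∀ b, ∃ C, ∀ y, |g b y| ≤ C := fun b => by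
    obtain ⟨C, hC⟩ := (Set.finite_range fun y => |g b y|).bddAbove
    exact ⟨C, fun y => hC ⟨y, rfl⟩⟩
  have hgm : ∀ b, Measurable (g b) := fun b => Measurable.of_discrete
  have hgi : ∀ b, Integrable (fun ω => g b (Y ω)) P := fun b => by
    obtain ⟨C, hC⟩ := hgb b
    exact integrable_of_abs_le ((hgm b).comp hYm).aestronglyMeasurable fun ω => hC _
  -- Almost surely exactly one indicator is nonzero; each summand then factors by independence of
  -- the edges and `B₀`.
  have hae : (fun ω => g (B₀ ω) (Y ω)) =ᵐ[P]
      fun ω => ∑ b ∈ T, {ω | B₀ ω = b}.indicator (fun ω => g b (Y ω)) ω := by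
    filter_upwards [hmem] with ω hω
    rw [Finset.sum_eq_single (B₀ ω) (fun b _ hb => Set.indicator_of_notMem (fun h => hb h.symm) _)
      fun h => absurd hω h]
    rw [Set.indicator_of_mem (by simp)]
  rw [integral_congr_ae hae, integral_finsetSum _ fun b _ => (hgi b).indicator (hms b),
    Finset.mul_sum]
  refine Finset.sum_congr rfl fun b hb => ?_
  have := h.indep_right.integral_fun_comp_mul_comp (f := g b)
    (g := Set.indicator {b} fun _ => (1 : ℝ)) hYm.aemeasurable h.measurable_right.aemeasurable
    (hgm b).aestronglyMeasurable
    (measurable_const.indicator (measurableSet_singleton b)).aestronglyMeasurable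
  have h2 : ∫ ω, Set.indicator {b} (fun _ => (1 : ℝ)) (B₀ ω) ∂P = ((n.choose K : ℕ) : ℝ)⁻¹ := by
    rw [← h.uniform_right b hb, ← integral_indicator_one (hms b)]
    rfl
  rw [h2] at this
  rw [mul_comm, ← this]
  refine integral_congr_ae (Filter.Eventually.of_forall fun ω => ?_)
  by_cases hω : B₀ ω = b <;> simp [Set.indicator, hω, hY]

end IsPlantedModel

/-- The linear approximation of the rescaled centered weight of the vertex `i`. -/
noncomputable def linForm (n m : ℕ) (p : ℝ) (η : ℕ → ℕ → Ω → Bool) (i : ℕ) (ω : Ω) : ℝ :=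
  √n * ∑ e ∈ side n ×ˢ side n, linCoef n m i p⁻¹ e.1 * edgeVar p η ω e

/-- Moments of the linear approximation. -/
lemma integral_linForm_pow_le {r : ℕ} {t : ℝ}
    (ht : ∀ c : Finset (ℕ × ℕ) → ℝ,
      ∫ ω, multilinear (side n ×ˢ side n) c (edgeVar p η ω) ^ (2 * r) ∂P ≤
        (∑ S ∈ (side n ×ˢ side n).powerset, t ^ S.card * c S ^ 2) ^ r) (m i : ℕ) :
    ∫ ω, linForm n m p η i ω ^ (2 * r) ∂P ≤
      (t * (n * ∑ e ∈ side n ×ˢ side n, linCoef n m i p⁻¹ e.1 ^ 2)) ^ r := by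
  have h1 := ht (linearCoeffs fun e => √n * linCoef n m i p⁻¹ e.1)
  simp_rw [multilinear_linearCoeffs, sum_sq_linearCoeffs] at h1
  refine le_trans (le_of_eq ?_) (h1.trans (le_of_eq ?_))
  · refine integral_congr_ae (Filter.Eventually.of_forall fun ω => ?_)
    simp only [linForm, Finset.mul_sum, mul_assoc]
  · simp_rw [mul_pow, Real.sq_sqrt (Nat.cast_nonneg n), ← Finset.mul_sum, mul_pow]

namespace IsPlantedModel

lemma measurable_weight (hp : p ≠ 0) (h : IsPlantedModel P n K p η B₀) (m i : ℕ) :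
    Measurable fun ω => weight n m p (edgeIndicator K η B₀ ω) i := by
  have hYm : Measurable fun ω (e : ↥(side n ×ˢ side n)) => η e.1.1 e.1.2 ω :=
    measurable_pi_lambda _ fun e =>
      h.measurable_edge _ (Finset.mem_product.1 e.2).1 _ (Finset.mem_product.1 e.2).2
  have hg : ∀ G : Finset ℕ → (↥(side n ×ˢ side n) → Bool) → ℝ,
      Measurable fun ω => G (B₀ ω) fun e => η e.1.1 e.1.2 ω := fun G =>
    (Measurable.of_discrete (f := Function.uncurry G)).comp (h.measurable_right.prodMk hYm)
  simp only [weight_edgeIndicator hp, multilinear_edgeVar]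
  exact hg fun b y => multilinear (side n ×ˢ side n) (coef n m p⁻¹ (side K ×ˢ b) i)
    (extendVar p (side n ×ˢ side n) y)

lemma measurable_linForm (h : IsPlantedModel P n K p η B₀) (m i : ℕ) :
    Measurable (linForm n m p η i) :=
  (Finset.measurable_sum _ fun e he => (h.measurable_edgeVar ⟨e, he⟩).const_mul _).const_mul _

lemma measurable_rescaledVector (hp : p ≠ 0) (h : IsPlantedModel P n K p η B₀) (m : ℕ) {ℓ : ℕ}
    (i : Fin ℓ → ℕ) : Measurable (rescaledVector P n m K p η B₀ i) := by
  refine (WithLp.measurable_toLp 2 _).comp (measurable_pi_lambda _ fun j => ?_)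
  exact ((h.measurable_weight hp m (i j)).sub_const _).const_mul _

variable [IsProbabilityMeasure P]

/-- Given `B₀ = b` the mean is the constant coefficient, which is the same for all `b` of size `K`;
`side K` serves as representative. -/
lemma integral_weight (hp0 : 0 < p) (hp1 : p < 1) (h : IsPlantedModel P n K p η B₀) (hK : K ≤ n)
    (m i : ℕ) : ∫ ω, weight n m p (edgeIndicator K η B₀ ω) i ∂P =
      coef n m p⁻¹ (side K ×ˢ side K) i ∅ := by
  have hsub : side K ⊆ side n := Finset.Icc_subset_Icc_right hK
  simp_rw [weight_edgeIndicator hp0.ne', multilinear_edgeVar]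
  rw [h.integral_right hK fun b y => multilinear (side n ×ˢ side n)
    (coef n m p⁻¹ (side K ×ˢ b) i) (extendVar p (side n ×ˢ side n) y)]
  simp_rw [← multilinear_edgeVar]
  rw [Finset.sum_congr rfl (g := fun _ => coef n m p⁻¹ (side K ×ˢ side K) i ∅) fun b hb => ?_]
  · rw [Finset.sum_const, Finset.card_powersetCard, card_side, nsmul_eq_mul,
      inv_mul_cancel_left₀]
    exact_mod_cast (Nat.choose_pos hK).ne'
  · have hb := Finset.mem_powersetCard.1 hb
    rw [h.integral_multilinear hp0 hp1]
    exact coef_empty_eq n m i K _ hb.1 hsub (by rw [hb.2, card_side])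

lemma rescaled_sub_linForm_ae (hp0 : 0 < p) (hp1 : p < 1) (h : IsPlantedModel P n K p η B₀)
    (hK : K ≤ n) (m i : ℕ) :
    (fun ω => √n * centeredWeight P n m K p η B₀ i ω - linForm n m p η i ω) =ᵐ[P] fun ω =>
      multilinear (side n ×ˢ side n) (errCoef n m K p⁻¹ (B₀ ω) i) (edgeVar p η ω) := by
  have hsub : side K ⊆ side n := Finset.Icc_subset_Icc_right hK
  filter_upwards [h.ae_mem_powersetCard hK] with ω hω
  have hω := Finset.mem_powersetCard.1 hω
  rw [multilinear_errCoef, centeredWeight, weight_edgeIndicator hp0.ne',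
    h.integral_weight hp0 hp1 hK, linForm,
    coef_empty_eq n m i K _ hsub hω.1 (by rw [hω.2, card_side])]

/-- Moments of the error of the linear approximation. -/
lemma integral_rescaled_sub_linForm_pow_le {r : ℕ} {t B : ℝ} (hp0 : 0 < p) (hp1 : p < 1)
    (ht0 : 0 ≤ t)
    (ht : ∀ c : Finset (ℕ × ℕ) → ℝ,
      ∫ ω, multilinear (side n ×ˢ side n) c (edgeVar p η ω) ^ (2 * r) ∂P ≤
        (∑ S ∈ (side n ×ˢ side n).powerset, t ^ S.card * c S ^ 2) ^ r)
    (h : IsPlantedModel P n K p η B₀) (hK : K ≤ n) (m i : ℕ)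
    (hB : ∀ b ∈ (side n).powersetCard K,
      ∑ S ∈ (side n ×ˢ side n).powerset, t ^ S.card * errCoef n m K p⁻¹ b i S ^ 2 ≤ B) :
    ∫ ω, (√n * centeredWeight P n m K p η B₀ i ω - linForm n m p η i ω) ^ (2 * r) ∂P ≤ B ^ r := by
  have hae := h.rescaled_sub_linForm_ae hp0 hp1 hK m i
  rw [integral_congr_ae (hae.mono fun ω hω => congrArg (· ^ (2 * r)) hω)]
  simp_rw [multilinear_edgeVar]
  -- Given `B₀ = b` the error is a polynomial with deterministic coefficients, and the bound `B` is
  -- uniform in `b`.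
  rw [h.integral_right hK fun b y => multilinear (side n ×ˢ side n)
    (errCoef n m K p⁻¹ b i) (extendVar p (side n ×ˢ side n) y) ^ (2 * r)]
  simp_rw [← multilinear_edgeVar]
  have hpos : (0 : ℝ) < ((n.choose K : ℕ) : ℝ) := by exact_mod_cast Nat.choose_pos hK
  calc _ ≤ ((n.choose K : ℕ) : ℝ)⁻¹ * ∑ _b ∈ (side n).powersetCard K, B ^ r := by
        refine mul_le_mul_of_nonneg_left (Finset.sum_le_sum fun b hb => (ht _).trans ?_)
          (by positivity)
        exact pow_le_pow_left₀ (Finset.sum_nonneg fun _ _ => by positivity) (hB b hb) r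
    _ = _ := by
        rw [Finset.sum_const, Finset.card_powersetCard, card_side, nsmul_eq_mul,
          inv_mul_cancel_left₀ hpos.ne']

end IsPlantedModel

end Model

/-! ### A quantitative central limit theorem for linear forms. -/

section CentralLimit

/-- Telescoping: factors are exchanged one at a time while all others have norm at most one. -/
lemma norm_prod_sub_prod_le {ι : Type*} (s : Finset ι) (f g : ι → ℂ) (hf : ∀ i ∈ s, ‖f i‖ ≤ 1)
    (hg : ∀ i ∈ s, ‖g i‖ ≤ 1) : ‖∏ i ∈ s, f i - ∏ i ∈ s, g i‖ ≤ ∑ i ∈ s, ‖f i - g i‖ := by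
  classical
  induction s using Finset.induction_on with
  | empty => simp
  | insert a s ha ih =>
    rw [Finset.prod_insert ha, Finset.prod_insert ha, Finset.sum_insert ha]
    have ih := ih (fun i hi => hf i (Finset.mem_insert_of_mem hi))
      fun i hi => hg i (Finset.mem_insert_of_mem hi)
    have hP : ‖∏ i ∈ s, f i‖ ≤ 1 := by
      rw [norm_prod]
      exact Finset.prod_le_one (fun _ _ => norm_nonneg _)
        fun i hi => hf i (Finset.mem_insert_of_mem hi)
    have hga := hg a (Finset.mem_insert_self a s)
    have h1 : f a * ∏ i ∈ s, f i - g a * ∏ i ∈ s, g i =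
        (f a - g a) * ∏ i ∈ s, f i + g a * (∏ i ∈ s, f i - ∏ i ∈ s, g i) := by ring
    rw [h1]
    refine (norm_add_le _ _).trans (add_le_add ?_ ?_)
    · rw [norm_mul]; exact mul_le_of_le_one_right (norm_nonneg _) hP
    · rw [norm_mul]; exact (mul_le_of_le_one_left (norm_nonneg _) hga).trans ih

variable {Ω : Type*} [MeasurableSpace Ω] {P : Measure Ω} [IsProbabilityMeasure P]

/-- Second order expansion of the characteristic function of a bounded centered variable. -/
lemma norm_integral_exp_sub_exp_le {x : Ω → ℝ} (hx : Measurable x) {M v a : ℝ}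
    (hM : ∀ ω, |x ω| ≤ M) (h1 : ∫ ω, x ω ∂P = 0) (h2 : ∫ ω, x ω ^ 2 ∂P = v) (ha : |a| * M ≤ 1) :
    ‖∫ ω, Complex.exp ((a * x ω : ℝ) * Complex.I) ∂P - Complex.exp ((-(v * a ^ 2 / 2) : ℝ))‖ ≤
      2 * (|a| * M) ^ 3 := by
  have hM0 : 0 ≤ M := by
    obtain ⟨ω⟩ : Nonempty Ω := nonempty_of_isProbabilityMeasure P
    exact (abs_nonneg _).trans (hM ω)
  have hx2 : Integrable (fun ω => x ω ^ 2) P :=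
    integrable_of_abs_le (C := M ^ 2) (hx.pow_const 2).aestronglyMeasurable fun ω => by
      rw [abs_pow]; exact pow_le_pow_left₀ (abs_nonneg _) (hM ω) 2
  have hx1 : Integrable x P := integrable_of_abs_le hx.aestronglyMeasurable hM
  have hv0 : 0 ≤ v := h2 ▸ integral_nonneg fun ω => sq_nonneg _
  have hvM : v ≤ M ^ 2 := by
    rw [← h2]
    refine (integral_mono hx2 (integrable_const (M ^ 2)) fun ω => ?_).trans (by simp)
    exact sq_le_sq' (abs_le.1 (hM ω)).1 (abs_le.1 (hM ω)).2
  set w := |a| * M with hw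
  have hw0 : 0 ≤ w := by positivity
  -- The second order Taylor polynomial of the exponential; its integral `1 - v * a ^ 2 / 2` uses
  -- only the first two moments.
  set T : Ω → ℂ := fun ω => ((1 - a ^ 2 / 2 * x ω ^ 2 : ℝ) : ℂ) + ((a * x ω : ℝ) : ℂ) * Complex.I
    with hT
  have hTi : Integrable T P :=
    (((integrable_const (1 : ℝ)).sub (hx2.const_mul _)).ofReal).add
      (((hx1.const_mul a).ofReal).mul_const _)
  have hTint : ∫ ω, T ω ∂P = ((1 - v * a ^ 2 / 2 : ℝ) : ℂ) := by
    rw [hT, integral_add (((integrable_const (1 : ℝ)).sub (hx2.const_mul _)).ofReal)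
      (((hx1.const_mul a).ofReal).mul_const _), integral_mul_const, integral_complex_ofReal,
      integral_complex_ofReal, integral_const_mul, h1,
      integral_sub (integrable_const _) (hx2.const_mul _), integral_const_mul, h2]
    simp
    ring
  have hei : Integrable (fun ω => Complex.exp ((a * x ω : ℝ) * Complex.I)) P := by
    refine Integrable.of_bound (C := 1) (Measurable.aestronglyMeasurable (by fun_prop))
      (Filter.Eventually.of_forall fun ω => ?_)
    rw [Complex.norm_exp_ofReal_mul_I]
  have hpt : ∀ ω, ‖Complex.exp ((a * x ω : ℝ) * Complex.I) - T ω‖ ≤ w ^ 3 := by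
    intro ω
    have hy : |a * x ω| ≤ w := by
      rw [abs_mul]; exact mul_le_mul_of_nonneg_left (hM ω) (abs_nonneg _)
    have hz : ‖((a * x ω : ℝ) : ℂ) * Complex.I‖ = |a * x ω| := by simp [abs_mul]
    have := Complex.exp_bound (x := ((a * x ω : ℝ) : ℂ) * Complex.I)
      (by rw [hz]; exact hy.trans ha) (n := 3) (by norm_num)
    have hs : ∑ k ∈ Finset.range 3, (((a * x ω : ℝ) : ℂ) * Complex.I) ^ k / (k.factorial : ℂ) =
        T ω := by
      simp only [Finset.sum_range_succ, Finset.range_zero, Finset.sum_empty, hT, mul_pow,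
        Complex.I_sq, Nat.factorial]
      push_cast
      ring
    rw [hs, hz] at this
    refine this.trans ?_
    have h3 : |a * x ω| ^ 3 ≤ w ^ 3 := pow_le_pow_left₀ (abs_nonneg _) hy 3
    have h4 : ((Nat.succ 3 : ℕ) : ℝ) * ((Nat.factorial 3 : ℕ) * (3 : ℕ) : ℝ)⁻¹ ≤ 1 := by
      norm_num [Nat.factorial]
    exact (mul_le_of_le_one_right (by positivity) h4).trans h3
  have hA : ‖∫ ω, Complex.exp ((a * x ω : ℝ) * Complex.I) ∂P - ∫ ω, T ω ∂P‖ ≤ w ^ 3 := by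
    rw [← integral_sub hei hTi]
    refine (norm_integral_le_of_norm_le_const (Filter.Eventually.of_forall hpt)).trans ?_
    simp
  have hz0 : 0 ≤ v * a ^ 2 / 2 := by positivity
  have hzw : v * a ^ 2 / 2 ≤ w ^ 2 := by
    have : v * a ^ 2 ≤ M ^ 2 * a ^ 2 := mul_le_mul_of_nonneg_right hvM (sq_nonneg a)
    have h5 : w ^ 2 = M ^ 2 * a ^ 2 := by rw [hw, mul_pow, sq_abs]; ring
    rw [h5]
    have : 0 ≤ v * a ^ 2 := by positivity
    linarith
  -- The Gaussian factor has the same expansion, with error at most `w ^ 4`, hence at most `w ^ 3`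
  -- as `w ≤ 1`.
  have hB : ‖((1 - v * a ^ 2 / 2 : ℝ) : ℂ) - Complex.exp ((-(v * a ^ 2 / 2) : ℝ))‖ ≤ w ^ 3 := by
    rw [← Complex.ofReal_exp, ← Complex.ofReal_sub, Complex.norm_real, Real.norm_eq_abs,
      abs_sub_comm]
    have hw1 : w ^ 2 ≤ 1 := pow_le_one₀ hw0 ha
    have := Real.abs_exp_sub_one_sub_id_le (x := -(v * a ^ 2 / 2))
      (by rw [abs_neg, abs_of_nonneg hz0]; linarith)
    have h6 : Real.exp (-(v * a ^ 2 / 2)) - (1 - v * a ^ 2 / 2) =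
        Real.exp (-(v * a ^ 2 / 2)) - 1 - -(v * a ^ 2 / 2) := by ring
    rw [h6]
    refine this.trans ?_
    rw [neg_sq]
    calc (v * a ^ 2 / 2) ^ 2 ≤ (w ^ 2) ^ 2 := pow_le_pow_left₀ hz0 hzw 2
      _ = w ^ 3 * w := by ring
      _ ≤ w ^ 3 := mul_le_of_le_one_right (by positivity) ha
  rw [hTint] at hA
  calc _ ≤ _ + _ := norm_sub_le_norm_sub_add_norm_sub _ ((1 - v * a ^ 2 / 2 : ℝ) : ℂ) _
    _ ≤ w ^ 3 + w ^ 3 := add_le_add hA hB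
    _ = _ := by ring

/-- Quantitative central limit theorem for the characteristic function of a linear form in
bounded centered independent variables. -/
lemma norm_integral_exp_sum_sub_exp_le {ι : Type*} [Fintype ι] {x : ι → Ω → ℝ}
    (hind : iIndepFun x P) (hx : ∀ e, Measurable (x e)) {M v : ℝ} (hM : ∀ e ω, |x e ω| ≤ M)
    (h1 : ∀ e, ∫ ω, x e ω ∂P = 0) (h2 : ∀ e, ∫ ω, x e ω ^ 2 ∂P = v) (a : ι → ℝ)
    (ha : ∀ e, |a e| * M ≤ 1) :
    ‖∫ ω, Complex.exp ((∑ e, a e * x e ω : ℝ) * Complex.I) ∂P -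
      Complex.exp ((-(v * (∑ e, a e ^ 2) / 2) : ℝ))‖ ≤ ∑ e, 2 * (|a e| * M) ^ 3 := by
  have e1 : ∫ ω, Complex.exp ((∑ e, a e * x e ω : ℝ) * Complex.I) ∂P =
      ∏ e, ∫ ω, Complex.exp ((a e * x e ω : ℝ) * Complex.I) ∂P := by
    rw [← hind.integral_fun_prod_comp
      (f := fun e (y : ℝ) => Complex.exp ((a e * y : ℝ) * Complex.I))
      (fun e => (hx e).aemeasurable)
      (fun e => Measurable.aestronglyMeasurable (by fun_prop))]
    refine integral_congr_ae (Filter.Eventually.of_forall fun ω => ?_)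
    simp only
    rw [← Complex.exp_sum, Complex.ofReal_sum, Finset.sum_mul]
  have e2 : Complex.exp ((-(v * (∑ e, a e ^ 2) / 2) : ℝ)) =
      ∏ e, Complex.exp ((-(v * a e ^ 2 / 2) : ℝ)) := by
    rw [← Complex.exp_sum, ← Complex.ofReal_sum]
    congr 2
    rw [Finset.mul_sum, Finset.sum_div, Finset.sum_neg_distrib]
  rw [e1, e2]
  refine (norm_prod_sub_prod_le _ _ _ (fun e _ => ?_) fun e _ => ?_).trans
    (Finset.sum_le_sum fun e _ => norm_integral_exp_sub_exp_le (hx e) (hM e) (h1 e) (h2 e) (ha e))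
  · refine (norm_integral_le_of_norm_le_const (C := 1)
      (Filter.Eventually.of_forall fun ω => ?_)).trans (by simp)
    rw [Complex.norm_exp_ofReal_mul_I]
  · rw [← Complex.ofReal_exp, Complex.norm_real, Real.norm_eq_abs, Real.abs_exp]
    have hv : 0 ≤ v := h2 e ▸ integral_nonneg fun ω => sq_nonneg _
    exact Real.exp_le_one_iff.2 (by have := mul_nonneg hv (sq_nonneg (a e)); linarith)

/-- Nonnegativity of the variance of `|f|`. -/
lemma integral_abs_sq_le {f : Ω → ℝ} (hf : Integrable f P) (hf2 : Integrable (fun ω => f ω ^ 2) P) :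
    (∫ ω, |f ω| ∂P) ^ 2 ≤ ∫ ω, f ω ^ 2 ∂P := by
  set c := ∫ ω, |f ω| ∂P with hc
  have h : 0 ≤ ∫ ω, (|f ω| - c) ^ 2 ∂P := integral_nonneg fun ω => sq_nonneg _
  have h3 : ∀ ω, (|f ω| - c) ^ 2 = f ω ^ 2 - (2 * c) * |f ω| + c ^ 2 := fun ω => by
    rw [sub_sq, sq_abs]; ring
  simp_rw [h3] at h
  have hi : Integrable (fun ω => 2 * c * |f ω|) P := hf.abs.const_mul _
  have hi' : Integrable (fun ω => f ω ^ 2 - 2 * c * |f ω|) P := hf2.sub hi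
  rw [integral_add hi' (integrable_const _), integral_sub hf2 hi, integral_const_mul, ← hc] at h
  simp at h
  nlinarith

end CentralLimit

/-! ### Growth conditions and linearization along the sequence. -/

open Filter Topology Asymptotics

/-- The growth conditions on the sizes `m` and `K`. -/
structure GrowthRegime (m K : ℕ → ℕ) (L : ℝ) : Prop where
  nonneg : 0 ≤ L
  tendsto_m : Tendsto m atTop atTop
  m_le : ∀ᶠ n in atTop, m n ≤ n
  K_le : ∀ᶠ n in atTop, K n ≤ n
  m_sq_le : ∀ᶠ n in atTop, (m n : ℝ) ^ 2 ≤ L * n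
  m_mul_K_le : ∀ᶠ n in atTop, (m n : ℝ) * K n ≤ L * n
  tendsto_m_div : Tendsto (fun n => (m n : ℝ) / n) atTop (𝓝 0)
  tendsto_K_div : Tendsto (fun n => (K n : ℝ) / n) atTop (𝓝 0)

lemma tendsto_div_of_isBigO_sqrt {a : ℕ → ℕ}
    (ha : (fun n : ℕ => (a n : ℝ)) =O[atTop] (fun n : ℕ => √(n : ℝ))) :
    Tendsto (fun n => (a n : ℝ) / n) atTop (𝓝 0) := by
  obtain ⟨c, hc⟩ := ha.bound
  have h0 : Tendsto (fun n : ℕ => c / √(n : ℝ)) atTop (𝓝 0) :=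
    Tendsto.div_atTop tendsto_const_nhds
      (Real.tendsto_sqrt_atTop.comp tendsto_natCast_atTop_atTop)
  refine squeeze_zero' (Eventually.of_forall fun n => by positivity) ?_ h0
  filter_upwards [hc, eventually_gt_atTop 0] with n hn hn0
  rw [Real.norm_of_nonneg (by positivity), Real.norm_of_nonneg (by positivity)] at hn
  have hnR : (0 : ℝ) < n := by exact_mod_cast hn0
  rw [div_le_div_iff₀ hnR (Real.sqrt_pos.2 hnR)]
  calc (a n : ℝ) * √n ≤ c * √n * √n := mul_le_mul_of_nonneg_right hn (Real.sqrt_nonneg _)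
    _ = c * n := by rw [mul_assoc, Real.mul_self_sqrt hnR.le]

lemma le_of_tendsto_div {a : ℕ → ℕ} (h : Tendsto (fun n => (a n : ℝ) / n) atTop (𝓝 0)) :
    ∀ᶠ n in atTop, a n ≤ n := by
  filter_upwards [h.eventually_lt_const one_pos, eventually_gt_atTop 0] with n hn hn0
  have hnR : (0 : ℝ) < n := by exact_mod_cast hn0
  rw [div_lt_one hnR] at hn
  exact_mod_cast hn.le

lemma exists_growthRegime {m K : ℕ → ℕ} (hm_top : Tendsto m atTop atTop)
    (hm : (fun n : ℕ => (m n : ℝ)) =O[atTop] (fun n : ℕ => √(n : ℝ)))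
    (hK : (fun n : ℕ => (K n : ℝ)) =O[atTop] (fun n : ℕ => √(n : ℝ))) :
    ∃ L, GrowthRegime m K L := by
  obtain ⟨c, hc0, hc⟩ := hm.exists_nonneg
  obtain ⟨d, hd0, hd⟩ := hK.exists_nonneg
  have hm0 := tendsto_div_of_isBigO_sqrt hm
  have hK0 := tendsto_div_of_isBigO_sqrt hK
  have hc' : ∀ᶠ n in atTop, (m n : ℝ) ≤ c * √n := hc.bound.mono fun n hn => by
    rwa [Real.norm_of_nonneg (by positivity), Real.norm_of_nonneg (by positivity)] at hn
  have hd' : ∀ᶠ n in atTop, (K n : ℝ) ≤ d * √n := hd.bound.mono fun n hn => by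
    rwa [Real.norm_of_nonneg (by positivity), Real.norm_of_nonneg (by positivity)] at hn
  -- If `m ≤ c √n` and `K ≤ d √n`, this constant dominates both `m ^ 2 / n` and `m * K / n`.
  refine ⟨c ^ 2 + c * d, by positivity, hm_top, le_of_tendsto_div hm0, le_of_tendsto_div hK0,
    ?_, ?_, hm0, hK0⟩
  · filter_upwards [hc'] with n hn
    have hs := Real.sq_sqrt (Nat.cast_nonneg (α := ℝ) n)
    calc (m n : ℝ) ^ 2 ≤ (c * √n) ^ 2 := pow_le_pow_left₀ (by positivity) hn 2
      _ = c ^ 2 * n := by rw [mul_pow, hs]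
      _ ≤ _ := mul_le_mul_of_nonneg_right (by nlinarith [mul_nonneg hc0 hd0]) (by positivity)
  · filter_upwards [hc', hd'] with n hn hn'
    have hs := Real.mul_self_sqrt (Nat.cast_nonneg (α := ℝ) n)
    calc (m n : ℝ) * K n ≤ (c * √n) * (d * √n) := by gcongr
      _ = c * d * (√n * √n) := by ring
      _ = c * d * n := by rw [hs]
      _ ≤ _ := mul_le_mul_of_nonneg_right (by nlinarith [sq_nonneg c]) (by positivity)

/-- For fixed `n` the weight takes finitely many values once `B₀` is a `K`-subset, which holds only
almost surely. The bound is not uniform in `n` and serves integrability alone. -/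
lemma IsPlantedModel.exists_ae_abs_rescaled_le {Ω : Type*} [MeasurableSpace Ω] {P : Measure Ω}
    [IsProbabilityMeasure P] {n K : ℕ} {p : ℝ} {η : ℕ → ℕ → Ω → Bool} {B₀ : Ω → Finset ℕ}
    (hp : p ≠ 0) (h : IsPlantedModel P n K p η B₀) (hK : K ≤ n) (m i : ℕ) :
    ∃ C, ∀ᵐ ω ∂P, |√n * centeredWeight P n m K p η B₀ i ω| ≤ C := by
  obtain ⟨C, hC⟩ := (Set.finite_range fun z : ↥((side n).powersetCard K) ×
    (↥(side n ×ˢ side n) → Bool) => |√n * (multilinear (side n ×ˢ side n)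
      (coef n m p⁻¹ (side K ×ˢ z.1.1) i) (extendVar p (side n ×ˢ side n) z.2) -
        ∫ ω', weight n m p (edgeIndicator K η B₀ ω') i ∂P)|).bddAbove
  refine ⟨C, ?_⟩
  filter_upwards [h.ae_mem_powersetCard hK] with ω hω
  rw [centeredWeight, weight_edgeIndicator hp, multilinear_edgeVar]
  exact hC ⟨(⟨B₀ ω, hω⟩, fun e => η e.1.1 e.1.2 ω), rfl⟩

lemma exists_abs_linForm_le {Ω : Type*} {p : ℝ} (hp0 : 0 < p) (hp1 : p < 1) (n m : ℕ)
    (η : ℕ → ℕ → Ω → Bool) (i : ℕ) : ∃ C, ∀ ω, |linForm n m p η i ω| ≤ C := by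
  refine ⟨√n * ∑ e ∈ side n ×ˢ side n, |linCoef n m i p⁻¹ e.1| * p⁻¹, fun ω => ?_⟩
  rw [linForm, abs_mul, abs_of_nonneg (Real.sqrt_nonneg _)]
  refine mul_le_mul_of_nonneg_left ((Finset.abs_sum_le_sum_abs _ _).trans
    (Finset.sum_le_sum fun e _ => ?_)) (Real.sqrt_nonneg _)
  rw [abs_mul]
  exact mul_le_mul_of_nonneg_left (abs_centeredEdge_le hp0 hp1 _) (abs_nonneg _)

section Sequence

variable {p : ℝ} {m K : ℕ → ℕ} {L : ℝ} {Ω : ℕ → Type*} [∀ n, MeasurableSpace (Ω n)]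
  {P : ∀ n, Measure (Ω n)} [∀ n, IsProbabilityMeasure (P n)]
  {η : ∀ n, ℕ → ℕ → Ω n → Bool} {B₀ : ∀ n, Ω n → Finset ℕ}

lemma integrable_rescaled_pow (hp : p ≠ 0) {n : ℕ}
    (h : IsPlantedModel (P n) n (K n) p (η n) (B₀ n)) (hK : K n ≤ n) (i r : ℕ) :
    Integrable (fun ω =>
      (√n * centeredWeight (P n) n (m n) (K n) p (η n) (B₀ n) i ω) ^ r) (P n) := by
  obtain ⟨C, hC⟩ := h.exists_ae_abs_rescaled_le hp hK (m n) i
  refine Integrable.of_bound (C := C ^ r)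
    ((((h.measurable_weight hp (m n) i).sub_const _).const_mul _).pow_const r).aestronglyMeasurable
    (hC.mono fun ω hω => ?_)
  rw [norm_pow]
  exact pow_le_pow_left₀ (norm_nonneg _) hω r

lemma integrable_rescaled_sub_linForm_pow (hp0 : 0 < p) (hp1 : p < 1) {n : ℕ}
    (h : IsPlantedModel (P n) n (K n) p (η n) (B₀ n)) (hK : K n ≤ n) (i r : ℕ) :
    Integrable (fun ω => (√n * centeredWeight (P n) n (m n) (K n) p (η n) (B₀ n) i ω -
      linForm n (m n) p (η n) i ω) ^ r) (P n) := by
  obtain ⟨C, hC⟩ := h.exists_ae_abs_rescaled_le hp0.ne' hK (m n) i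
  obtain ⟨D, hD⟩ := exists_abs_linForm_le hp0 hp1 n (m n) (η n) i
  refine Integrable.of_bound (C := (C + D) ^ r)
    (((((h.measurable_weight hp0.ne' (m n) i).sub_const _).const_mul _).sub
      (h.measurable_linForm (m n) i)).pow_const r).aestronglyMeasurable
    (hC.mono fun ω hω => ?_)
  rw [norm_pow]
  exact pow_le_pow_left₀ (norm_nonneg _) ((abs_sub _ _).trans (add_le_add hω (hD ω))) r

lemma integrable_linForm_pow (hp0 : 0 < p) (hp1 : p < 1) {n : ℕ}
    (h : IsPlantedModel (P n) n (K n) p (η n) (B₀ n)) (i r : ℕ) :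
    Integrable (fun ω => linForm n (m n) p (η n) i ω ^ r) (P n) := by
  obtain ⟨D, hD⟩ := exists_abs_linForm_le hp0 hp1 n (m n) (η n) i
  refine integrable_of_abs_le (C := D ^ r)
    ((h.measurable_linForm (m n) i).pow_const r).aestronglyMeasurable fun ω => ?_
  rw [abs_pow]
  exact pow_le_pow_left₀ (abs_nonneg _) (hD ω) r

/-- The linear approximation is asymptotically exact in every moment norm. -/
lemma tendsto_integral_rescaled_sub_linForm_pow (hp0 : 0 < p) (hp1 : p < 1)
    (hg : GrowthRegime m K L) (h : ∀ n, IsPlantedModel (P n) n (K n) p (η n) (B₀ n))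
    {i : ℕ → ℕ} (hi : ∀ᶠ n in atTop, i n ∈ side n) {r : ℕ} (hr : 1 ≤ r) :
    Tendsto (fun n => ∫ ω, (√n * centeredWeight (P n) n (m n) (K n) p (η n) (B₀ n) (i n) ω -
      linForm n (m n) p (η n) (i n) ω) ^ (2 * r) ∂(P n)) atTop (𝓝 0) := by
  obtain ⟨t, ht0, ht⟩ := exists_integral_multilinear_pow_le r hr p⁻¹ (by positivity)
  obtain ⟨C, hC, hE⟩ := exists_sum_sq_errCoef_le p⁻¹ t L (one_le_inv₀ hp0 |>.2 hp1.le) ht0.le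
    hg.nonneg
  -- The error bound depends on `b` only through `|b| = K n`, so it is uniform over the
  -- conditioning.
  set B : ℕ → ℝ := fun n => C * (1 / n + K n / n +
    (1 / m n + m n / n + |expTrunc (m n) (p⁻¹ - 1) - Real.exp (p⁻¹ - 1)|) ^ 2) with hB
  have hB0 : Tendsto (fun n => B n ^ r) atTop (𝓝 0) := by
    have h1 : Tendsto (fun n : ℕ => (1 : ℝ) / n) atTop (𝓝 0) := tendsto_one_div_atTop_nhds_zero_nat
    have h2 : Tendsto (fun n : ℕ => (1 : ℝ) / m n) atTop (𝓝 0) := h1.comp hg.tendsto_m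
    have h3 : Tendsto (fun n => |expTrunc (m n) (p⁻¹ - 1) - Real.exp (p⁻¹ - 1)|) atTop (𝓝 0) := by
      have := (((tendsto_expTrunc (p⁻¹ - 1)).comp hg.tendsto_m).sub_const
        (Real.exp (p⁻¹ - 1))).abs
      simpa using this
    have h4 := (((h1.add hg.tendsto_K_div).add
      (((h2.add hg.tendsto_m_div).add h3).pow 2)).const_mul C).pow r
    have h5 : (C * (0 + 0 + (0 + 0 + 0) ^ 2)) ^ r = 0 := by simp [show r ≠ 0 by omega]
    rwa [h5] at h4
  refine squeeze_zero' (Eventually.of_forall fun n => integral_nonneg fun ω => ?_) ?_ hB0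
  · exact (even_two_mul r).pow_nonneg _
  · filter_upwards [hi, hg.tendsto_m.eventually_ge_atTop 2, hg.m_le, hg.K_le, hg.m_sq_le,
      hg.m_mul_K_le] with n hin hm2 hmn hKn hmL hmK
    refine (h n).integral_rescaled_sub_linForm_pow_le hp0 hp1 ht0.le
      ((h n).integral_multilinear_le hp0 hp1 (ht (P n))) hKn (m n) (i n) fun b hb => ?_
    have hb := Finset.mem_powersetCard.1 hb
    have := hE hm2 hmn hKn hin hb.1 hmL hmK (by rw [hb.2]; exact hmK)
    rwa [hb.2] at this

/-- The moments of the linear approximation are bounded. -/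
lemma exists_eventually_integral_linForm_pow_le (hp0 : 0 < p) (hp1 : p < 1)
    (hg : GrowthRegime m K L) (h : ∀ n, IsPlantedModel (P n) n (K n) p (η n) (B₀ n))
    (i : ℕ → ℕ) {r : ℕ} (hr : 1 ≤ r) :
    ∃ C, ∀ᶠ n in atTop, ∫ ω, linForm n (m n) p (η n) (i n) ω ^ (2 * r) ∂(P n) ≤ C := by
  obtain ⟨t, ht0, ht⟩ := exists_integral_multilinear_pow_le r hr p⁻¹ (by positivity)
  refine ⟨(t * (16 * Real.exp (p⁻¹ - 1) ^ 2 * (1 + 2 * L))) ^ r, ?_⟩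
  filter_upwards [eventually_gt_atTop 0, hg.m_sq_le] with n hn hmL
  refine (integral_linForm_pow_le
    ((h n).integral_multilinear_le hp0 hp1 (ht (P n))) (m n) (i n)).trans ?_
  -- Taking `K = n` and `b = side n` turns the bound for planted edges into one for the sum over all
  -- edges.
  have h1 := sum_linCoef_sq_le (i := i n) (b := side n) (q := p⁻¹) hn le_rfl hmL
  have hnR : (n : ℝ) ≠ 0 := by exact_mod_cast hn.ne'
  rw [card_side, div_self hnR, mul_one] at h1
  exact pow_le_pow_left₀ (by positivity) (mul_le_mul_of_nonneg_left h1 ht0.le) r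

/-- The moments of the rescaled centered weight are bounded. -/
lemma exists_eventually_integral_rescaled_pow_le (hp0 : 0 < p) (hp1 : p < 1)
    (hg : GrowthRegime m K L) (h : ∀ n, IsPlantedModel (P n) n (K n) p (η n) (B₀ n))
    {i : ℕ → ℕ} (hi : ∀ᶠ n in atTop, i n ∈ side n) {r : ℕ} (hr : 1 ≤ r) :
    ∃ C, ∀ᶠ n in atTop, ∫ ω, (√n * centeredWeight (P n) n (m n) (K n) p (η n) (B₀ n) (i n) ω) ^
      (2 * r) ∂(P n) ≤ C := by
  obtain ⟨C, hC⟩ := exists_eventually_integral_linForm_pow_le hp0 hp1 hg h i hr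
  have h0 := tendsto_integral_rescaled_sub_linForm_pow hp0 hp1 hg h hi hr
  -- Convexity of the even power separates the linear form from the error, whose moment is
  -- eventually at most one.
  refine ⟨2 ^ (2 * r - 1) * (1 + C), ?_⟩
  filter_upwards [hC, h0.eventually_le_const one_pos, hg.K_le] with n hn hn1 hKn
  have i1 := integrable_rescaled_pow (m := m) hp0.ne' (h n) hKn (i n) (2 * r)
  have i2 := integrable_rescaled_sub_linForm_pow (m := m) hp0 hp1 (h n) hKn (i n) (2 * r)
  have i3 := integrable_linForm_pow (m := m) hp0 hp1 (h n) (i n) (2 * r)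
  refine (integral_mono i1 ((i2.add i3).const_mul (2 ^ (2 * r - 1))) fun ω => ?_).trans ?_
  · have := (even_two_mul r).add_pow_le
      (a := √n * centeredWeight (P n) n (m n) (K n) p (η n) (B₀ n) (i n) ω -
        linForm n (m n) p (η n) (i n) ω) (b := linForm n (m n) p (η n) (i n) ω)
    simpa using this
  · simp only [Pi.add_apply]
    rw [integral_const_mul, integral_add i2 i3]
    exact mul_le_mul_of_nonneg_left (add_le_add hn1 hn) (by positivity)

end Sequence

/-! ### The covariance of the linear forms. -/

section Covariance

variable {ℓ : ℕ}

/-- The coefficients of a linear combination of the linear approximations. -/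
noncomputable def combCoef (n m : ℕ) (q : ℝ) (i : Fin ℓ → ℕ) (s : Fin ℓ → ℝ) (u : ℕ) : ℝ :=
  √n * ∑ j, s j * linCoef n m (i j) q u

lemma sum_mul_linForm {Ω : Type*} (n m : ℕ) (p : ℝ) (η : ℕ → ℕ → Ω → Bool) (i : Fin ℓ → ℕ)
    (s : Fin ℓ → ℝ) (ω : Ω) : ∑ j, s j * linForm n m p η (i j) ω =
      ∑ e ∈ side n ×ˢ side n, combCoef n m p⁻¹ i s e.1 * edgeVar p η ω e := by
  simp only [linForm, combCoef, Finset.mul_sum, Finset.sum_mul]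
  rw [Finset.sum_comm]
  refine Finset.sum_congr rfl fun e _ => Finset.sum_congr rfl fun j _ => ?_
  ring

/-- Each coefficient is `O(n^(-1/2))`, the uniform smallness needed for the central limit theorem.
-/
lemma abs_combCoef_le {n m : ℕ} (hn : 0 < n) (hmn : m ≤ n) (q : ℝ) (i : Fin ℓ → ℕ)
    (s : Fin ℓ → ℝ) (u : ℕ) :
    |combCoef n m q i s u| ≤ 4 * Real.exp (q - 1) * (∑ j, |s j|) / √n := by
  have hnR : (0 : ℝ) < n := by exact_mod_cast hn
  have hmR : (m : ℝ) ≤ n := by exact_mod_cast hmn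
  have h1 : ∀ i', |linCoef n m i' q u| ≤ 4 * Real.exp (q - 1) / n := by
    intro i'
    have hm2 : (m : ℝ) / (n : ℝ) ^ 2 ≤ 1 / n := by
      rw [div_le_div_iff₀ (by positivity) hnR]; nlinarith
    have hi : (if u = i' then (1 : ℝ) else 0) / n ≤ 1 / n := by
      split_ifs
      · exact le_rfl
      · rw [zero_div]; positivity
    have h0 : 0 ≤ (if u = i' then (1 : ℝ) else 0) / n + m / (n : ℝ) ^ 2 := by
      split_ifs <;> positivity
    rw [linCoef, abs_of_nonneg (by positivity)]
    calc _ ≤ 2 * Real.exp (q - 1) * (1 / n + 1 / n) := by gcongr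
      _ = _ := by ring
  rw [combCoef, abs_mul, abs_of_nonneg (Real.sqrt_nonneg _)]
  have h2 : |∑ j, s j * linCoef n m (i j) q u| ≤ ∑ j, |s j| * (4 * Real.exp (q - 1) / n) :=
    (Finset.abs_sum_le_sum_abs _ _).trans (Finset.sum_le_sum fun j _ => by
      rw [abs_mul]; exact mul_le_mul_of_nonneg_left (h1 _) (abs_nonneg _))
  refine (mul_le_mul_of_nonneg_left h2 (Real.sqrt_nonneg _)).trans (le_of_eq ?_)
  rw [← Finset.sum_mul]
  have hs := Real.mul_self_sqrt hnR.le
  have hs0 := (Real.sqrt_pos.2 hnR).ne'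
  field_simp
  rw [sq, hs, mul_comm]

lemma sum_linCoef_mul_linCoef {n m i i' : ℕ} {q : ℝ} (hn : 0 < n) (hi : i ∈ side n)
    (hi' : i' ∈ side n) : n * ∑ e ∈ side n ×ˢ side n, linCoef n m i q e.1 * linCoef n m i' q e.1 =
      4 * Real.exp (2 * (q - 1)) * ((if i = i' then 1 else 0) + 2 * m / n + (m : ℝ) ^ 2 / n) := by
  have hnR : (n : ℝ) ≠ 0 := by exact_mod_cast hn.ne'
  rw [sum_product_fst _ _ fun u => linCoef n m i q u * linCoef n m i' q u, card_side]
  have h1 : ∀ u, linCoef n m i q u * linCoef n m i' q u = 4 * Real.exp (2 * (q - 1)) *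
      ((if u = i then (if i = i' then (1 : ℝ) else 0) else 0) / (n : ℝ) ^ 2 +
      ((if u = i then (1 : ℝ) else 0) + (if u = i' then (1 : ℝ) else 0)) * (m / (n : ℝ) ^ 3) +
        (m : ℝ) ^ 2 / (n : ℝ) ^ 4) := by
    intro u
    have he : Real.exp (2 * (q - 1)) = Real.exp (q - 1) * Real.exp (q - 1) := by
      rw [← Real.exp_add]; congr 1; ring
    rw [linCoef, linCoef, he]
    by_cases h : u = i
    · subst h
      by_cases h' : u = i' <;> simp [h'] <;> field_simp <;> ring
    · by_cases h' : u = i'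
      · have hii : ¬ i' = i := fun hc => h (h'.trans hc)
        simp [h', hii]
        field_simp
        ring
      · simp [h, h']
        field_simp
        ring
  simp_rw [h1]
  rw [← Finset.mul_sum, Finset.sum_add_distrib, Finset.sum_add_distrib, ← Finset.sum_div,
    ← Finset.sum_mul, Finset.sum_add_distrib, Finset.sum_ite_eq', Finset.sum_ite_eq',
    Finset.sum_ite_eq', if_pos hi, if_pos hi, if_pos hi', Finset.sum_const, card_side,
    nsmul_eq_mul]
  field_simp
  ring

/-- The exact variance of the combination. The surplus over the target quadratic form comes from the
cross terms `2 * m / n` and vanishes in the limit. -/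
lemma sum_combCoef_sq {n m : ℕ} {p : ℝ} (hn : 0 < n) {i : Fin ℓ → ℕ} (hi : ∀ j, i j ∈ side n)
    (s : Fin ℓ → ℝ) : (p⁻¹ - 1) * ∑ e ∈ side n ×ˢ side n, combCoef n m p⁻¹ i s e.1 ^ 2 =
      s ⬝ᵥ (covMatrix n m p i).mulVec s +
        8 * (p⁻¹ - 1) * Real.exp (2 * (p⁻¹ - 1)) * (∑ j, s j) ^ 2 * (m / n) := by
  have h1 : ∀ u, combCoef n m p⁻¹ i s u ^ 2 = ∑ j, ∑ j', s j * s j' *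
      (n * (linCoef n m (i j) p⁻¹ u * linCoef n m (i j') p⁻¹ u)) := by
    intro u
    rw [combCoef, mul_pow, Real.sq_sqrt (Nat.cast_nonneg n), sq, Finset.sum_mul_sum,
      Finset.mul_sum]
    refine Finset.sum_congr rfl fun j _ => ?_
    rw [Finset.mul_sum]
    exact Finset.sum_congr rfl fun j' _ => by ring
  have h2 : ∑ e ∈ side n ×ˢ side n, combCoef n m p⁻¹ i s e.1 ^ 2 = ∑ j, ∑ j', s j * s j' *
      (4 * Real.exp (2 * (p⁻¹ - 1)) * ((if i j = i j' then 1 else 0) + 2 * m / n +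
        (m : ℝ) ^ 2 / n)) := by
    simp_rw [h1]
    rw [Finset.sum_comm]
    refine Finset.sum_congr rfl fun j _ => ?_
    rw [Finset.sum_comm]
    refine Finset.sum_congr rfl fun j' _ => ?_
    rw [← Finset.mul_sum, ← Finset.mul_sum, sum_linCoef_mul_linCoef hn (hi j) (hi j')]
  rw [h2, sq (∑ j, s j), Finset.sum_mul_sum, Finset.mul_sum, Finset.mul_sum, Finset.sum_mul]
  simp only [dotProduct, Matrix.mulVec, covMatrix, Matrix.of_apply]
  rw [← Finset.sum_add_distrib]
  refine Finset.sum_congr rfl fun j _ => ?_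
  rw [Finset.mul_sum, Finset.mul_sum, Finset.mul_sum, Finset.sum_mul, ← Finset.sum_add_distrib]
  refine Finset.sum_congr rfl fun j' _ => ?_
  ring

/-- Grouping indices with the same vertex turns the indicator part into a sum of squares; with the
rank-one part this gives positive semidefiniteness, also for repeated vertices. -/
lemma dotProduct_covMatrix_mulVec (n m : ℕ) (p : ℝ) (i : Fin ℓ → ℕ) (s : Fin ℓ → ℝ) :
    s ⬝ᵥ (covMatrix n m p i).mulVec s = 4 * (p⁻¹ - 1) * Real.exp (2 * (p⁻¹ - 1)) *
      ((∑ u ∈ Finset.univ.image i, (∑ j, if i j = u then s j else 0) ^ 2) +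
        (m : ℝ) ^ 2 / n * (∑ j, s j) ^ 2) := by
  have h1 : ∑ u ∈ Finset.univ.image i, (∑ j, if i j = u then s j else 0) ^ 2 =
      ∑ j, ∑ j', s j * s j' * (if i j = i j' then 1 else 0) := by
    simp_rw [sq, Finset.sum_mul_sum]
    rw [Finset.sum_comm]
    refine Finset.sum_congr rfl fun j _ => ?_
    rw [Finset.sum_comm]
    refine Finset.sum_congr rfl fun j' _ => ?_
    rw [Finset.sum_eq_single (i j)]
    · by_cases h : i j = i j' <;> simp [h, eq_comm]
    · intro u _ hu; simp [Ne.symm hu]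
    · intro h; exact absurd (Finset.mem_image_of_mem i (Finset.mem_univ j)) h
  rw [h1, sq (∑ j, s j), Finset.sum_mul_sum, Finset.mul_sum, ← Finset.sum_add_distrib,
    Finset.mul_sum]
  simp only [dotProduct, Matrix.mulVec, covMatrix, Matrix.of_apply]
  refine Finset.sum_congr rfl fun j _ => ?_
  rw [Finset.mul_sum, Finset.mul_sum, ← Finset.sum_add_distrib, Finset.mul_sum]
  refine Finset.sum_congr rfl fun j' _ => ?_
  ring

lemma posSemidef_covMatrix (n m : ℕ) {p : ℝ} (hp0 : 0 < p) (hp1 : p < 1) (i : Fin ℓ → ℕ) :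
    (covMatrix n m p i).PosSemidef := by
  have hv : 0 ≤ p⁻¹ - 1 := sub_nonneg.2 ((one_le_inv₀ hp0).2 hp1.le)
  refine Matrix.PosSemidef.of_dotProduct_mulVec_nonneg ?_ fun s => ?_
  · ext j j'
    simp [covMatrix, eq_comm]
  · have := dotProduct_covMatrix_mulVec n m p i s
    rw [show star s = s from rfl, this]
    have : 0 ≤ ∑ u ∈ Finset.univ.image i, (∑ j, if i j = u then s j else 0) ^ 2 :=
      Finset.sum_nonneg fun _ _ => sq_nonneg _
    positivity

lemma abs_covMatrix_le {n m : ℕ} {p L : ℝ} (hp0 : 0 < p) (hp1 : p < 1) (hn : 0 < n)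
    (hmL : (m : ℝ) ^ 2 ≤ L * n) (i : Fin ℓ → ℕ) (j j' : Fin ℓ) :
    |covMatrix n m p i j j'| ≤ 4 * (p⁻¹ - 1) * Real.exp (2 * (p⁻¹ - 1)) * (1 + L) := by
  have hv : 0 ≤ p⁻¹ - 1 := sub_nonneg.2 ((one_le_inv₀ hp0).2 hp1.le)
  have hnR : (0 : ℝ) < n := by exact_mod_cast hn
  have h1 : (m : ℝ) ^ 2 / n ≤ L := (div_le_iff₀ hnR).2 hmL
  have h2 : 0 ≤ (if i j = i j' then (1 : ℝ) else 0) := by split_ifs <;> norm_num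
  have h3 : (if i j = i j' then (1 : ℝ) else 0) ≤ 1 := by split_ifs <;> norm_num
  rw [covMatrix, Matrix.of_apply, abs_of_nonneg (by positivity)]
  gcongr

end Covariance

/-! ### Merging of the characteristic functions. -/

lemma norm_exp_mul_I_sub_le (y z : ℝ) :
    ‖Complex.exp (y * Complex.I) - Complex.exp (z * Complex.I)‖ ≤ |y - z| := by
  have h : Complex.exp (y * Complex.I) - Complex.exp (z * Complex.I) =
      Complex.exp (z * Complex.I) * (Complex.exp (Complex.I * ((y - z : ℝ) : ℂ)) - 1) := by
    rw [mul_sub, ← Complex.exp_add, mul_one]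
    congr 2
    push_cast
    ring
  rw [h, norm_mul, Complex.norm_exp_ofReal_mul_I, one_mul]
  exact Real.norm_exp_I_mul_ofReal_sub_one_le

section Sequence

variable {p : ℝ} {m K : ℕ → ℕ} {L : ℝ} {Ω : ℕ → Type*} [∀ n, MeasurableSpace (Ω n)]
  {P : ∀ n, Measure (Ω n)} [∀ n, IsProbabilityMeasure (P n)]
  {η : ∀ n, ℕ → ℕ → Ω n → Bool} {B₀ : ∀ n, Ω n → Finset ℕ} {ℓ : ℕ}

lemma tendsto_integral_abs_rescaled_sub_linForm (hp0 : 0 < p) (hp1 : p < 1)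
    (hg : GrowthRegime m K L) (h : ∀ n, IsPlantedModel (P n) n (K n) p (η n) (B₀ n))
    {i : ℕ → ℕ} (hi : ∀ᶠ n in atTop, i n ∈ side n) :
    Tendsto (fun n => ∫ ω, |√n * centeredWeight (P n) n (m n) (K n) p (η n) (B₀ n) (i n) ω -
      linForm n (m n) p (η n) (i n) ω| ∂(P n)) atTop (𝓝 0) := by
  have h2 := (tendsto_integral_rescaled_sub_linForm_pow hp0 hp1 hg h hi le_rfl).sqrt
  rw [Real.sqrt_zero] at h2
  refine squeeze_zero' (Eventually.of_forall fun n => integral_nonneg fun ω => abs_nonneg _) ?_ h2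
  filter_upwards [hg.K_le] with n hKn
  refine Real.le_sqrt_of_sq_le (integral_abs_sq_le ?_ ?_)
  · simpa using integrable_rescaled_sub_linForm_pow (m := m) hp0 hp1 (h n) hKn (i n) 1
  · exact integrable_rescaled_sub_linForm_pow (m := m) hp0 hp1 (h n) hKn (i n) 2

/-- The map `y ↦ e ^ (i y)` is 1-Lipschitz, so convergence of the errors in mean suffices. -/
lemma tendsto_integral_exp_rescaled_sub (hp0 : 0 < p) (hp1 : p < 1)
    (hg : GrowthRegime m K L) (h : ∀ n, IsPlantedModel (P n) n (K n) p (η n) (B₀ n))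
    {i : ℕ → Fin ℓ → ℕ} (hi : ∀ᶠ n in atTop, ∀ j, i n j ∈ side n) (s : Fin ℓ → ℝ) :
    Tendsto (fun n => ∫ ω, Complex.exp ((∑ j, s j *
        (√n * centeredWeight (P n) n (m n) (K n) p (η n) (B₀ n) (i n j) ω) : ℝ) * Complex.I) ∂(P n) -
      ∫ ω, Complex.exp ((∑ j, s j * linForm n (m n) p (η n) (i n j) ω : ℝ) * Complex.I) ∂(P n))
      atTop (𝓝 0) := by
  have h0 : Tendsto (fun n => ∑ j, |s j| *
      ∫ ω, |√n * centeredWeight (P n) n (m n) (K n) p (η n) (B₀ n) (i n j) ω -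
        linForm n (m n) p (η n) (i n j) ω| ∂(P n)) atTop (𝓝 0) := by
    have := tendsto_finsetSum (Finset.univ : Finset (Fin ℓ)) fun j _ =>
      (tendsto_integral_abs_rescaled_sub_linForm hp0 hp1 hg h
        (i := fun n => i n j) (hi.mono fun n hn => hn j)).const_mul |s j|
    simpa using this
  refine squeeze_zero_norm' ?_ h0
  filter_upwards [hg.K_le] with n hKn
  have hm1 : ∀ j, Measurable fun ω =>
      √n * centeredWeight (P n) n (m n) (K n) p (η n) (B₀ n) (i n j) ω := fun j =>
    ((((h n).measurable_weight hp0.ne' (m n) (i n j)).sub_const _).const_mul _)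
  have hm2 : ∀ j, Measurable (linForm n (m n) p (η n) (i n j)) := fun j =>
    (h n).measurable_linForm (m n) (i n j)
  have hint : ∀ f : Ω n → ℝ, Measurable f →
      Integrable (fun ω => Complex.exp ((f ω : ℝ) * Complex.I)) (P n) := fun f hf => by
    refine Integrable.of_bound (C := 1) (Measurable.aestronglyMeasurable (by fun_prop))
      (Eventually.of_forall fun ω => ?_)
    rw [Complex.norm_exp_ofReal_mul_I]
  have habs : ∀ j, Integrable (fun ω =>
      |√n * centeredWeight (P n) n (m n) (K n) p (η n) (B₀ n) (i n j) ω -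
        linForm n (m n) p (η n) (i n j) ω|) (P n) := fun j => by
    have := (integrable_rescaled_sub_linForm_pow (m := m) hp0 hp1 (h n) hKn (i n j) 1).abs
    simpa using this
  rw [← integral_sub (hint _ (Finset.measurable_sum _ fun j _ => (hm1 j).const_mul _))
    (hint _ (Finset.measurable_sum _ fun j _ => (hm2 j).const_mul _))]
  refine (norm_integral_le_integral_norm _).trans ?_
  simp_rw [← integral_const_mul]
  rw [← integral_finsetSum _ fun j _ => (habs j).const_mul _]
  refine integral_mono_of_nonneg (Eventually.of_forall fun ω => norm_nonneg _)
    (integrable_finsetSum _ fun j _ => (habs j).const_mul _) (Eventually.of_forall fun ω => ?_)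
  refine (norm_exp_mul_I_sub_le _ _).trans ?_
  rw [← Finset.sum_sub_distrib]
  refine (Finset.abs_sum_le_sum_abs _ _).trans (Finset.sum_le_sum fun j _ => ?_)
  rw [← mul_sub, abs_mul]

lemma sum_combCoef_sq_le {n m : ℕ} {q : ℝ} (hn : 0 < n) (hmL : (m : ℝ) ^ 2 ≤ L * n)
    (i : Fin ℓ → ℕ) (s : Fin ℓ → ℝ) : ∑ e ∈ side n ×ˢ side n, combCoef n m q i s e.1 ^ 2 ≤
      (∑ j, s j ^ 2) * (ℓ * (16 * Real.exp (q - 1) ^ 2 * (1 + 2 * L))) := by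
  have hnR : (n : ℝ) ≠ 0 := by exact_mod_cast hn.ne'
  have h1 : ∀ u, combCoef n m q i s u ^ 2 ≤
      (∑ j, s j ^ 2) * ∑ j, n * linCoef n m (i j) q u ^ 2 := by
    intro u
    rw [combCoef, mul_pow, Real.sq_sqrt (Nat.cast_nonneg n), ← Finset.mul_sum]
    have := Finset.sum_mul_sq_le_sq_mul_sq Finset.univ s fun j => linCoef n m (i j) q u
    calc _ ≤ (n : ℝ) * ((∑ j, s j ^ 2) * ∑ j, linCoef n m (i j) q u ^ 2) :=
          mul_le_mul_of_nonneg_left this (Nat.cast_nonneg n)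
      _ = _ := by ring
  refine (Finset.sum_le_sum fun e _ => h1 e.1).trans ?_
  rw [← Finset.mul_sum, Finset.sum_comm]
  refine mul_le_mul_of_nonneg_left ?_ (Finset.sum_nonneg fun _ _ => sq_nonneg _)
  refine (Finset.sum_le_card_nsmul _ _ (16 * Real.exp (q - 1) ^ 2 * (1 + 2 * L))
    fun j _ => ?_).trans (by simp)
  rw [← Finset.mul_sum]
  have h2 := sum_linCoef_sq_le (i := i j) (b := side n) (q := q) hn le_rfl hmL
  rwa [card_side, div_self hnR, mul_one] at h2

/-- The cubic error is at most the largest coefficient, of order `n^(-1/2)`, times the bounded sum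
of squares. -/
lemma tendsto_integral_exp_linForm_sub (hp0 : 0 < p) (hp1 : p < 1)
    (hg : GrowthRegime m K L) (h : ∀ n, IsPlantedModel (P n) n (K n) p (η n) (B₀ n))
    (i : ℕ → Fin ℓ → ℕ) (s : Fin ℓ → ℝ) :
    Tendsto (fun n =>
      ∫ ω, Complex.exp ((∑ j, s j * linForm n (m n) p (η n) (i n j) ω : ℝ) * Complex.I) ∂(P n) -
      Complex.exp ((-((p⁻¹ - 1) * (∑ e ∈ side n ×ˢ side n,
        combCoef n (m n) p⁻¹ (i n) s e.1 ^ 2) / 2) : ℝ))) atTop (𝓝 0) := by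
  set A : ℕ → ℝ := fun n => 4 * Real.exp (p⁻¹ - 1) * (∑ j, |s j|) / √n with hA
  set D := (∑ j, s j ^ 2) * (ℓ * (16 * Real.exp (p⁻¹ - 1) ^ 2 * (1 + 2 * L))) with hD
  have hA0 : Tendsto A atTop (𝓝 0) := Tendsto.div_atTop tendsto_const_nhds
    (Real.tendsto_sqrt_atTop.comp tendsto_natCast_atTop_atTop)
  have hM : 0 < p⁻¹ := by positivity
  have hlim : Tendsto (fun n => A n * (2 * p⁻¹ ^ 3 * D)) atTop (𝓝 0) := by
    have := hA0.mul_const (2 * p⁻¹ ^ 3 * D)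
    rwa [zero_mul] at this
  refine squeeze_zero_norm' ?_ hlim
  have hA1 : ∀ᶠ n in atTop, A n * p⁻¹ ≤ 1 := by
    have : Tendsto (fun n => A n * p⁻¹) atTop (𝓝 0) := by simpa using hA0.mul_const p⁻¹
    exact this.eventually_le_const one_pos
  filter_upwards [eventually_gt_atTop 0, hg.m_le, hg.m_sq_le, hA1] with n hn hmn hmL hAn
  have hab : ∀ u, |combCoef n (m n) p⁻¹ (i n) s u| ≤ A n := fun u => abs_combCoef_le hn hmn _ _ _ _
  have hAn0 : 0 ≤ A n := (abs_nonneg _).trans (hab 0)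
  have key := norm_integral_exp_sum_sub_exp_le (h n).iIndepFun_edgeVar (h n).measurable_edgeVar
    (fun e ω => abs_centeredEdge_le hp0 hp1 _) ((h n).integral_edgeVar hp0.ne')
    ((h n).integral_edgeVar_sq hp0.ne') (fun e => combCoef n (m n) p⁻¹ (i n) s e.1.1)
    fun e => (mul_le_mul_of_nonneg_right (hab _) hM.le).trans hAn
  simp_rw [sum_mul_linForm]
  rw [Finset.sum_coe_sort (side n ×ˢ side n)
      (fun e => combCoef n (m n) p⁻¹ (i n) s e.1 ^ 2),
    Finset.sum_coe_sort (side n ×ˢ side n)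
      (fun e => 2 * (|combCoef n (m n) p⁻¹ (i n) s e.1| * p⁻¹) ^ 3)] at key
  have hconv : ∀ ω, ∑ e : ↥(side n ×ˢ side n), combCoef n (m n) p⁻¹ (i n) s e.1.1 *
      edgeVar p (η n) ω e = ∑ e ∈ side n ×ˢ side n, combCoef n (m n) p⁻¹ (i n) s e.1 *
      edgeVar p (η n) ω e := fun ω => Finset.sum_coe_sort (side n ×ˢ side n)
        fun e => combCoef n (m n) p⁻¹ (i n) s e.1 * edgeVar p (η n) ω e
  simp_rw [hconv] at key
  refine key.trans ?_
  calc _ ≤ ∑ e ∈ side n ×ˢ side n, A n * (2 * p⁻¹ ^ 3) * combCoef n (m n) p⁻¹ (i n) s e.1 ^ 2 := by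
        refine Finset.sum_le_sum fun e _ => ?_
        have h1 := mul_le_mul_of_nonneg_right (hab e.1)
          (show 0 ≤ 2 * p⁻¹ ^ 3 * combCoef n (m n) p⁻¹ (i n) s e.1 ^ 2 by positivity)
        rw [← sq_abs]
        rw [← sq_abs] at h1
        calc _ = _ := by ring
          _ ≤ _ := h1
          _ = _ := by ring
    _ = A n * (2 * p⁻¹ ^ 3) * ∑ e ∈ side n ×ˢ side n, combCoef n (m n) p⁻¹ (i n) s e.1 ^ 2 := by
        rw [Finset.mul_sum]
    _ ≤ A n * (2 * p⁻¹ ^ 3) * D :=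
        mul_le_mul_of_nonneg_left (sum_combCoef_sq_le hn hmL _ _) (by positivity)
    _ = _ := by ring

/-- The quadratic form is nonnegative, so its exponential factors out with a bound of one and only
the `m / n` surplus remains. -/
lemma tendsto_exp_combCoef_sub (hp0 : 0 < p) (hp1 : p < 1) (hg : GrowthRegime m K L)
    {i : ℕ → Fin ℓ → ℕ} (hi : ∀ᶠ n in atTop, ∀ j, i n j ∈ side n) (s : Fin ℓ → ℝ) :
    Tendsto (fun n => Real.exp (-((p⁻¹ - 1) * (∑ e ∈ side n ×ˢ side n,
        combCoef n (m n) p⁻¹ (i n) s e.1 ^ 2) / 2)) -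
      Real.exp (-(s ⬝ᵥ (covMatrix n (m n) p (i n)).mulVec s / 2))) atTop (𝓝 0) := by
  set c := 8 * (p⁻¹ - 1) * Real.exp (2 * (p⁻¹ - 1)) * (∑ j, s j) ^ 2 with hc
  have h1 : Tendsto (fun n => |Real.exp (-(c * (m n / n) / 2)) - 1|) atTop (𝓝 0) := by
    have : Tendsto (fun n => Real.exp (-(c * ((m n : ℝ) / n) / 2)) - 1) atTop
        (𝓝 (Real.exp (-(c * 0 / 2)) - 1)) :=
      ((Real.continuous_exp.tendsto _).comp
        (((hg.tendsto_m_div.const_mul c).div_const 2).neg)).sub_const 1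
    simpa using this.abs
  refine squeeze_zero_norm' ?_ h1
  filter_upwards [hi, eventually_gt_atTop 0] with n hin hn
  rw [sum_combCoef_sq hn hin]
  set Q := s ⬝ᵥ (covMatrix n (m n) p (i n)).mulVec s with hQ
  have hQ0 : 0 ≤ Q := (posSemidef_covMatrix n (m n) hp0 hp1 (i n)).dotProduct_mulVec_nonneg s
  have h2 : Real.exp (-((Q + c * (m n / n)) / 2)) - Real.exp (-(Q / 2)) =
      Real.exp (-(Q / 2)) * (Real.exp (-(c * (m n / n) / 2)) - 1) := by
    rw [mul_sub, ← Real.exp_add, mul_one]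
    congr 2
    ring
  rw [h2, norm_mul, Real.norm_eq_abs, Real.norm_eq_abs, Real.abs_exp]
  exact mul_le_of_le_one_left (abs_nonneg _) (Real.exp_le_one_iff.2 (by linarith))

/-- The characteristic functions of the rescaled centered weights merge with those of the
Gaussian vectors. -/
lemma tendsto_charFun_sub (hp0 : 0 < p) (hp1 : p < 1)
    (hg : GrowthRegime m K L) (h : ∀ n, IsPlantedModel (P n) n (K n) p (η n) (B₀ n))
    {i : ℕ → Fin ℓ → ℕ} (hi : ∀ᶠ n in atTop, ∀ j, i n j ∈ side n)
    (s : EuclideanSpace ℝ (Fin ℓ)) :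
    Tendsto (fun n =>
      charFun ((P n).map (rescaledVector (P n) n (m n) (K n) p (η n) (B₀ n) (i n))) s -
      charFun (multivariateGaussian 0 (covMatrix n (m n) p (i n))) s) atTop (𝓝 0) := by
  have h1 := tendsto_integral_exp_rescaled_sub hp0 hp1 hg h hi s
  have h2 := tendsto_integral_exp_linForm_sub hp0 hp1 hg h i s
  have h3 := (Complex.continuous_ofReal.tendsto 0).comp
    (tendsto_exp_combCoef_sub hp0 hp1 hg hi s)
  have h4 := (h1.add h2).add h3
  rw [Complex.ofReal_zero, add_zero, add_zero] at h4
  refine h4.congr fun n => ?_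
  have e1 : charFun ((P n).map (rescaledVector (P n) n (m n) (K n) p (η n) (B₀ n) (i n))) s =
      ∫ ω, Complex.exp ((∑ j, s j * (√n * centeredWeight (P n) n (m n) (K n) p (η n) (B₀ n)
        (i n j) ω) : ℝ) * Complex.I) ∂(P n) := by
    rw [charFun_apply, integral_map
      ((h n).measurable_rescaledVector hp0.ne' (m n) (i n)).aemeasurable
      (Measurable.aestronglyMeasurable (by fun_prop))]
    refine integral_congr_ae (Eventually.of_forall fun ω => ?_)
    simp [PiLp.inner_apply, rescaledVector]
  have e2 : charFun (multivariateGaussian 0 (covMatrix n (m n) p (i n))) s =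
      ((Real.exp (-(s.ofLp ⬝ᵥ (covMatrix n (m n) p (i n)).mulVec s.ofLp / 2)) : ℝ) : ℂ) := by
    rw [charFun_multivariateGaussian (posSemidef_covMatrix n (m n) hp0 hp1 (i n))]
    simp
  rw [e1, e2]
  simp only [Function.comp_apply, Complex.ofReal_sub, Complex.ofReal_exp]
  ring

end Sequence

/-! ### From weak convergence to convergence of unbounded integrals. -/

section WeakConvergence

/-- Truncation has an effect only if `|y| > M`, and then the loss is at most `|y| ≤ y ^ 2 / M`. -/
lemma abs_sub_truncate_le {M : ℝ} (hM : 0 < M) (y : ℝ) :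
    |y - max (min y M) (-M)| ≤ y ^ 2 / M := by
  rw [le_div_iff₀ hM]
  rcases le_total y M with h1 | h1
  · rw [min_eq_left h1]
    rcases le_total (-M) y with h2 | h2
    · rw [max_eq_left h2, sub_self, abs_zero, zero_mul]; positivity
    · rw [max_eq_right h2, abs_of_nonpos (by linarith)]; nlinarith
  · rw [min_eq_right h1, max_eq_left (by linarith), abs_of_nonneg (by linarith)]; nlinarith

variable {E : Type*} [TopologicalSpace E] [MeasurableSpace E] [BorelSpace E]

/-- Truncation of a continuous function. -/
noncomputable def truncate {g : E → ℝ} (hg : Continuous g) {M : ℝ} (hM : 0 < M) :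
    BoundedContinuousFunction E ℝ :=
  BoundedContinuousFunction.ofNormedAddCommGroup (fun x => max (min (g x) M) (-M))
    (by fun_prop) M fun x => by
      rw [Real.norm_eq_abs, abs_le]
      exact ⟨le_max_right _ _, max_le (min_le_right _ _) (by linarith)⟩

lemma integrable_of_integrable_sq {μ : Measure E} [IsProbabilityMeasure μ] {g : E → ℝ}
    (hg : Continuous g) (h : Integrable (fun x => g x ^ 2) μ) : Integrable g μ := by
  refine ((integrable_const (1 : ℝ)).add h).mono' hg.measurable.aestronglyMeasurable
    (Eventually.of_forall fun x => ?_)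
  rw [Real.norm_eq_abs, Pi.add_apply, ← sq_abs]
  nlinarith [sq_nonneg (|g x| - 1), abs_nonneg (g x)]

lemma abs_integral_sub_truncate_le {μ : Measure E} [IsProbabilityMeasure μ] {g : E → ℝ}
    (hg : Continuous g) {M B : ℝ} (hM : 0 < M) (h : Integrable (fun x => g x ^ 2) μ)
    (hB : ∫ x, g x ^ 2 ∂μ ≤ B) : |∫ x, g x ∂μ - ∫ x, truncate hg hM x ∂μ| ≤ B / M := by
  rw [← integral_sub (integrable_of_integrable_sq hg h) ((truncate hg hM).integrable μ)]
  calc _ ≤ ∫ x, |g x - truncate hg hM x| ∂μ := abs_integral_le_integral_abs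
    _ ≤ ∫ x, g x ^ 2 / M ∂μ := integral_mono_of_nonneg (Eventually.of_forall fun _ => abs_nonneg _)
        (h.div_const M) (Eventually.of_forall fun x => abs_sub_truncate_le hM (g x))
    _ ≤ B / M := by
        rw [integral_div]
        exact div_le_div_of_nonneg_right hB hM.le

/-- Weak convergence and bounded second moments imply convergence of integrals. -/
lemma tendsto_integral_of_sq_bounded [OpensMeasurableSpace E] {μs : ℕ → ProbabilityMeasure E}
    {μ : ProbabilityMeasure E} (h : Tendsto μs atTop (𝓝 μ)) {g : E → ℝ} (hg : Continuous g)
    {B : ℝ} (hB : ∀ᶠ k in atTop, Integrable (fun x => g x ^ 2) (μs k : Measure E) ∧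
      ∫ x, g x ^ 2 ∂(μs k : Measure E) ≤ B)
    (hμ : Integrable (fun x => g x ^ 2) (μ : Measure E) ∧ ∫ x, g x ^ 2 ∂(μ : Measure E) ≤ B) :
    Tendsto (fun k => ∫ x, g x ∂(μs k : Measure E)) atTop (𝓝 (∫ x, g x ∂(μ : Measure E))) := by
  have hB0 : 0 ≤ B := (integral_nonneg fun x => sq_nonneg (g x)).trans hμ.2
  rw [Metric.tendsto_nhds]
  intro ε hε
  -- Chosen so that each of the two truncation errors, at most `B / M`, stays below `ε / 3`.
  set M := 4 * (B + 1) / ε with hMdef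
  have hM : 0 < M := by positivity
  have hBM : B / M < ε / 3 := by
    rw [hMdef, div_div_eq_mul_div, div_lt_div_iff₀ (by positivity) (by norm_num)]
    nlinarith
  have h1 := (ProbabilityMeasure.tendsto_iff_forall_integral_tendsto.1 h) (truncate hg hM)
  have h2 := (Metric.tendsto_nhds.1 h1) (ε / 3) (by positivity)
  filter_upwards [hB, h2] with k hk hk2
  have a1 := abs_integral_sub_truncate_le hg hM hk.1 hk.2
  have a2 := abs_integral_sub_truncate_le hg hM hμ.1 hμ.2
  rw [Real.dist_eq] at hk2 ⊢
  rw [abs_le] at a1 a2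
  rw [abs_lt] at hk2 ⊢
  constructor <;> linarith

end WeakConvergence

/-! ### Moment bounds for monomials and Gaussian vectors. -/

section GaussianMoments

/-- After raising to the power `r = |α| + 1`, each `y j ^ (2 * r)` is at most the right side, which
is at least one; the total exponent `|α|` does not exceed `r`. Uniform second moments of monomials
thus reduce to even moments of coordinates. -/
lemma sq_prod_pow_le {ℓ : ℕ} (α : Fin ℓ → ℕ) (y : Fin ℓ → ℝ) :
    (∏ j, y j ^ α j) ^ 2 ≤ 1 + ∑ j, y j ^ (2 * (∑ j, α j + 1)) := by
  set r := ∑ j, α j + 1 with hr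
  set T := 1 + ∑ j, y j ^ (2 * r) with hT
  have hnn : ∀ j, 0 ≤ y j ^ (2 * r) := fun j => (even_two_mul r).pow_nonneg _
  have hT1 : 1 ≤ T := le_add_of_nonneg_right (Finset.sum_nonneg fun j _ => hnn j)
  have hj : ∀ j, y j ^ (2 * r) ≤ T := fun j =>
    (Finset.single_le_sum (f := fun j => y j ^ (2 * r)) (fun j _ => hnn j)
      (Finset.mem_univ j)).trans (le_add_of_nonneg_left zero_le_one)
  refine (pow_le_pow_iff_left₀ (sq_nonneg _) (by linarith) (show r ≠ 0 by omega)).1 ?_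
  calc ((∏ j, y j ^ α j) ^ 2) ^ r = ∏ j, (y j ^ (2 * r)) ^ α j := by
        rw [← pow_mul, ← Finset.prod_pow]
        exact Finset.prod_congr rfl fun j _ => by rw [← pow_mul, ← pow_mul, mul_comm]
    _ ≤ ∏ j, T ^ α j := Finset.prod_le_prod (fun j _ => pow_nonneg (hnn j) _)
        fun j _ => pow_le_pow_left₀ (hnn j) (hj j) _
    _ = T ^ ∑ j, α j := Finset.prod_pow_eq_pow_sum _ _ _
    _ ≤ T ^ r := pow_le_pow_right₀ hT1 (by omega)

lemma integrable_pow_gaussianReal (v : NNReal) (k : ℕ) :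
    Integrable (fun x : ℝ => x ^ k) (gaussianReal 0 v) := by
  have := (memLp_id_gaussianReal (μ := 0) (v := v) (k : NNReal)).integrable_norm_pow'
  refine this.mono' (by fun_prop) (Eventually.of_forall fun x => ?_)
  simp

/-- Scaling by the standard deviation, which covers the degenerate variance zero as well. -/
lemma integral_pow_gaussianReal (v : NNReal) (k : ℕ) :
    ∫ x, x ^ (2 * k) ∂(gaussianReal 0 v) = v ^ k * ∫ x, x ^ (2 * k) ∂(gaussianReal 0 1) := by
  have h := gaussianReal_map_const_mul (μ := 0) (v := 1) (√v)
  have hv : NNReal.mk (√(v : ℝ) ^ 2) (sq_nonneg _) * 1 = v := by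
    ext
    simp
  rw [mul_zero, hv] at h
  rw [← h, integral_map (by fun_prop) (by fun_prop)]
  simp_rw [mul_pow, pow_mul, Real.sq_sqrt v.coe_nonneg]
  rw [integral_const_mul]

variable {ℓ : ℕ} {S : Matrix (Fin ℓ) (Fin ℓ) ℝ}

lemma integrable_pow_multivariateGaussian (hS : S.PosSemidef) (j : Fin ℓ) (k : ℕ) :
    Integrable (fun x : EuclideanSpace ℝ (Fin ℓ) => x j ^ k) (multivariateGaussian 0 S) :=
  (measurePreserving_eval_multivariateGaussian (μ := 0) hS (i := j)).integrable_comp_of_integrable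
    (integrable_pow_gaussianReal _ k)

lemma integral_pow_multivariateGaussian_le (hS : S.PosSemidef) (j : Fin ℓ) (k : ℕ) {c : ℝ}
    (hc : |S j j| ≤ c) : ∫ x : EuclideanSpace ℝ (Fin ℓ), x j ^ (2 * k) ∂(multivariateGaussian 0 S) ≤
      c ^ k * ∫ x, x ^ (2 * k) ∂(gaussianReal 0 1) := by
  have h := measurePreserving_eval_multivariateGaussian (μ := 0) hS (i := j)
  have h1 : ∫ x : EuclideanSpace ℝ (Fin ℓ), x j ^ (2 * k) ∂(multivariateGaussian 0 S) =
      ∫ y, y ^ (2 * k) ∂(gaussianReal 0 (S j j).toNNReal) := by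
    have h2 := h.map_eq
    rw [show ((0 : EuclideanSpace ℝ (Fin ℓ)) j) = 0 from rfl] at h2
    rw [← h2, integral_map h.measurable.aemeasurable (by fun_prop)]
  rw [h1, integral_pow_gaussianReal]
  refine mul_le_mul_of_nonneg_right ?_ (integral_nonneg fun x => (even_two_mul k).pow_nonneg _)
  refine pow_le_pow_left₀ (NNReal.coe_nonneg _) ?_ k
  rw [Real.coe_toNNReal']
  exact max_le ((le_abs_self _).trans hc) ((abs_nonneg _).trans hc)

/-- Second moments of monomials under bounds for even moments of the coordinates. -/
lemma integral_sq_prod_pow_le {Ω : Type*} [MeasurableSpace Ω] {P : Measure Ω}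
    [IsProbabilityMeasure P] {y : Ω → EuclideanSpace ℝ (Fin ℓ)} (hy : Measurable y)
    (α : Fin ℓ → ℕ) {C : Fin ℓ → ℝ}
    (hi : ∀ j, Integrable (fun ω => y ω j ^ (2 * (∑ j, α j + 1))) P)
    (hC : ∀ j, ∫ ω, y ω j ^ (2 * (∑ j, α j + 1)) ∂P ≤ C j) :
    Integrable (fun ω => (∏ j, y ω j ^ α j) ^ 2) P ∧
      ∫ ω, (∏ j, y ω j ^ α j) ^ 2 ∂P ≤ 1 + ∑ j, C j := by
  have hI : Integrable (fun ω => 1 + ∑ j, y ω j ^ (2 * (∑ j, α j + 1))) P :=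
    (integrable_const 1).add (integrable_finsetSum _ fun j _ => hi j)
  have hm : Measurable fun ω => (∏ j, y ω j ^ α j) ^ 2 := by fun_prop
  refine ⟨hI.mono' hm.aestronglyMeasurable (Eventually.of_forall fun ω => ?_), ?_⟩
  · rw [Real.norm_of_nonneg (sq_nonneg _)]
    exact sq_prod_pow_le α fun j => y ω j
  · refine (integral_mono_of_nonneg (Eventually.of_forall fun ω => sq_nonneg _) hI
      (Eventually.of_forall fun ω => sq_prod_pow_le α fun j => y ω j)).trans ?_
    rw [integral_add (integrable_const _) (integrable_finsetSum _ fun j _ => hi j),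
      integral_finsetSum _ fun j _ => hi j]
    simp only [integral_const, probReal_univ, smul_eq_mul, mul_one]
    exact add_le_add_right (Finset.sum_le_sum fun j _ => hC j) 1

end GaussianMoments

/-! ### Limits along subsequences of convergent covariance. -/

section Limit

variable {p : ℝ} {m K : ℕ → ℕ} {L : ℝ} {Ω : ℕ → Type*} [∀ n, MeasurableSpace (Ω n)]
  {P : ∀ n, Measure (Ω n)} [∀ n, IsProbabilityMeasure (P n)]
  {η : ∀ n, ℕ → ℕ → Ω n → Bool} {B₀ : ∀ n, Ω n → Finset ℕ} {ℓ : ℕ}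

lemma posSemidef_of_tendsto {C : ℕ → Matrix (Fin ℓ) (Fin ℓ) ℝ} {S : Matrix (Fin ℓ) (Fin ℓ) ℝ}
    (hC : ∀ k, (C k).PosSemidef) (h : Tendsto C atTop (𝓝 S)) : S.PosSemidef := by
  refine Matrix.PosSemidef.of_dotProduct_mulVec_nonneg ?_ fun s => ?_
  · have h1 : Tendsto (fun k => (C k).conjTranspose) atTop (𝓝 S.conjTranspose) :=
      (continuous_id.matrix_conjTranspose.tendsto S).comp h
    exact tendsto_nhds_unique (h1.congr fun k => (hC k).isHermitian) h
  · have h1 : Tendsto (fun k => star s ⬝ᵥ (C k).mulVec s) atTop (𝓝 (star s ⬝ᵥ S.mulVec s)) :=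
      ((Continuous.dotProduct continuous_const
        (Continuous.matrix_mulVec continuous_id continuous_const)).tendsto S).comp h
    exact ge_of_tendsto' h1 fun k => (hC k).dotProduct_mulVec_nonneg s

/-- Every subsequence of the covariance matrices has a convergent subsequence. -/
lemma exists_tendsto_covMatrix (hp0 : 0 < p) (hp1 : p < 1) (hg : GrowthRegime m K L)
    (i : ℕ → Fin ℓ → ℕ) {φ : ℕ → ℕ} (hφ : Tendsto φ atTop atTop) :
    ∃ ψ : ℕ → ℕ, Tendsto (fun k => φ (ψ k)) atTop atTop ∧ ∃ S : Matrix (Fin ℓ) (Fin ℓ) ℝ,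
      Tendsto (fun k => covMatrix (φ (ψ k)) (m (φ (ψ k))) p (i (φ (ψ k)))) atTop (𝓝 S) := by
  set c := 4 * (p⁻¹ - 1) * Real.exp (2 * (p⁻¹ - 1)) * (1 + L)
  have hcomp : IsCompact (Set.univ.pi fun _ : Fin ℓ => Set.univ.pi fun _ : Fin ℓ =>
      Set.Icc (-c) c) :=
    isCompact_univ_pi fun _ => isCompact_univ_pi fun _ => isCompact_Icc
  have hev : ∀ᶠ n in atTop, (covMatrix n (m n) p (i n) : Fin ℓ → Fin ℓ → ℝ) ∈
      Set.univ.pi fun _ : Fin ℓ => Set.univ.pi fun _ : Fin ℓ => Set.Icc (-c) c := by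
    filter_upwards [eventually_gt_atTop 0, hg.m_sq_le] with n hn hmL
    exact fun j _ j' _ => abs_le.1 (abs_covMatrix_le hp0 hp1 hn hmL (i n) j j')
  obtain ⟨S, -, ψ, hψ, hS⟩ := hcomp.tendsto_subseq' (hφ.eventually hev).frequently
  exact ⟨ψ, hφ.comp hψ.tendsto_atTop, S, hS⟩

/-- The law of the rescaled centered weights. -/
noncomputable def lawRescaled (P : ∀ n, Measure (Ω n)) [∀ n, IsProbabilityMeasure (P n)]
    (hp0 : p ≠ 0) (h : ∀ n, IsPlantedModel (P n) n (K n) p (η n) (B₀ n)) (m : ℕ → ℕ)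
    (i : ℕ → Fin ℓ → ℕ) (n : ℕ) : ProbabilityMeasure (EuclideanSpace ℝ (Fin ℓ)) :=
  ⟨(P n).map (rescaledVector (P n) n (m n) (K n) p (η n) (B₀ n) (i n)),
    Measure.isProbabilityMeasure_map
      ((h n).measurable_rescaledVector hp0 (m n) (i n)).aemeasurable⟩

/-- Centered Gaussian laws as probability measures. -/
noncomputable def lawGaussian (S : Matrix (Fin ℓ) (Fin ℓ) ℝ) :
    ProbabilityMeasure (EuclideanSpace ℝ (Fin ℓ)) :=
  ⟨multivariateGaussian 0 S, inferInstance⟩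

lemma tendsto_charFun_lawGaussian {C : ℕ → Matrix (Fin ℓ) (Fin ℓ) ℝ}
    {S : Matrix (Fin ℓ) (Fin ℓ) ℝ} (hC : ∀ k, (C k).PosSemidef) (h : Tendsto C atTop (𝓝 S))
    (s : EuclideanSpace ℝ (Fin ℓ)) :
    Tendsto (fun k => charFun (multivariateGaussian 0 (C k)) s) atTop
      (𝓝 (charFun (multivariateGaussian 0 S) s)) := by
  have hS := posSemidef_of_tendsto hC h
  simp_rw [charFun_multivariateGaussian hS, fun k => charFun_multivariateGaussian (hC k)
    (μ := (0 : EuclideanSpace ℝ (Fin ℓ))) s]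
  have h1 : Tendsto (fun k => s.ofLp ⬝ᵥ (C k).mulVec s.ofLp) atTop
      (𝓝 (s.ofLp ⬝ᵥ S.mulVec s.ofLp)) :=
    ((Continuous.dotProduct continuous_const
      (Continuous.matrix_mulVec continuous_id continuous_const)).tendsto S).comp h
  exact (Complex.continuous_exp.tendsto _).comp
    (tendsto_const_nhds.sub (((Complex.continuous_ofReal.tendsto _).comp h1).div_const 2))

lemma tendsto_lawGaussian {C : ℕ → Matrix (Fin ℓ) (Fin ℓ) ℝ}
    {S : Matrix (Fin ℓ) (Fin ℓ) ℝ} (hC : ∀ k, (C k).PosSemidef) (h : Tendsto C atTop (𝓝 S)) :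
    Tendsto (fun k => lawGaussian (C k)) atTop (𝓝 (lawGaussian S)) :=
  ProbabilityMeasure.tendsto_of_tendsto_charFun (tendsto_charFun_lawGaussian hC h)

/-- Central limit theorem along subsequences of convergent covariance matrices. -/
lemma tendsto_lawRescaled (hp0 : 0 < p) (hp1 : p < 1) (hg : GrowthRegime m K L)
    (h : ∀ n, IsPlantedModel (P n) n (K n) p (η n) (B₀ n)) {i : ℕ → Fin ℓ → ℕ}
    (hi : ∀ᶠ n in atTop, ∀ j, i n j ∈ side n) {φ : ℕ → ℕ} (hφ : Tendsto φ atTop atTop)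
    {S : Matrix (Fin ℓ) (Fin ℓ) ℝ}
    (hS : Tendsto (fun k => covMatrix (φ k) (m (φ k)) p (i (φ k))) atTop (𝓝 S)) :
    Tendsto (fun k => lawRescaled P hp0.ne' h m i (φ k)) atTop (𝓝 (lawGaussian S)) := by
  refine ProbabilityMeasure.tendsto_of_tendsto_charFun fun s => ?_
  have h1 := (tendsto_charFun_sub hp0 hp1 hg h hi s).comp hφ
  have h2 := tendsto_charFun_lawGaussian (fun k => posSemidef_covMatrix _ _ hp0 hp1 _) hS s
  have h3 := h1.add h2
  rw [zero_add] at h3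
  refine h3.congr fun k => ?_
  simp only [Function.comp_apply, sub_add_cancel]
  rfl

/-- Passing from subsequences to merging of integrals. -/
lemma tendsto_integral_sub (hp0 : 0 < p) (hp1 : p < 1) (hg : GrowthRegime m K L)
    (h : ∀ n, IsPlantedModel (P n) n (K n) p (η n) (B₀ n)) {i : ℕ → Fin ℓ → ℕ}
    (hi : ∀ᶠ n in atTop, ∀ j, i n j ∈ side n) {g : EuclideanSpace ℝ (Fin ℓ) → ℝ}
    (hg1 : ∀ (φ : ℕ → ℕ), Tendsto φ atTop atTop → ∀ S : Matrix (Fin ℓ) (Fin ℓ) ℝ,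
      Tendsto (fun k => covMatrix (φ k) (m (φ k)) p (i (φ k))) atTop (𝓝 S) →
      Tendsto (fun k => lawRescaled P hp0.ne' h m i (φ k)) atTop (𝓝 (lawGaussian S)) →
      Tendsto (fun k => ∫ x, g x ∂(lawRescaled P hp0.ne' h m i (φ k) : Measure _)) atTop
        (𝓝 (∫ x, g x ∂(multivariateGaussian 0 S))))
    (hg2 : ∀ (φ : ℕ → ℕ), Tendsto φ atTop atTop → ∀ S : Matrix (Fin ℓ) (Fin ℓ) ℝ,
      Tendsto (fun k => covMatrix (φ k) (m (φ k)) p (i (φ k))) atTop (𝓝 S) →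
      Tendsto (fun k => lawGaussian (covMatrix (φ k) (m (φ k)) p (i (φ k)))) atTop
        (𝓝 (lawGaussian S)) →
      Tendsto (fun k => ∫ x, g x ∂(multivariateGaussian 0
        (covMatrix (φ k) (m (φ k)) p (i (φ k))))) atTop
        (𝓝 (∫ x, g x ∂(multivariateGaussian 0 S)))) :
    Tendsto (fun n =>
      ∫ x, g x ∂(lawRescaled P hp0.ne' h m i n : Measure (EuclideanSpace ℝ (Fin ℓ))) -
      ∫ x, g x ∂(multivariateGaussian 0 (covMatrix n (m n) p (i n)))) atTop (𝓝 0) := by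
  -- Any subsequence has a further one along which the covariances tend to some `S`. There both
  -- integrals have the same limit, the integral against the Gaussian law of covariance `S`.
  refine tendsto_of_subseq_tendsto fun φ hφ => ?_
  obtain ⟨ψ, hψ, S, hS⟩ := exists_tendsto_covMatrix hp0 hp1 hg i hφ
  refine ⟨ψ, ?_⟩
  have h1 := hg1 _ hψ S hS (tendsto_lawRescaled hp0 hp1 hg h hi hψ hS)
  have h2 := hg2 _ hψ S hS
    (tendsto_lawGaussian (fun k => posSemidef_covMatrix _ _ hp0 hp1 _) hS)
  simpa using h1.sub h2

lemma tendsto_integral_boundedContinuous (hp0 : 0 < p) (hp1 : p < 1) (hg : GrowthRegime m K L)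
    (h : ∀ n, IsPlantedModel (P n) n (K n) p (η n) (B₀ n)) {i : ℕ → Fin ℓ → ℕ}
    (hi : ∀ᶠ n in atTop, ∀ j, i n j ∈ side n)
    (f : BoundedContinuousFunction (EuclideanSpace ℝ (Fin ℓ)) ℝ) :
    Tendsto (fun n =>
      ∫ x, f x ∂(lawRescaled P hp0.ne' h m i n : Measure (EuclideanSpace ℝ (Fin ℓ))) -
      ∫ x, f x ∂(multivariateGaussian 0 (covMatrix n (m n) p (i n)))) atTop (𝓝 0) :=
  tendsto_integral_sub hp0 hp1 hg h hi
    (fun _ _ _ _ hw => ProbabilityMeasure.tendsto_iff_forall_integral_tendsto.1 hw f)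
    (fun _ _ _ _ hw => ProbabilityMeasure.tendsto_iff_forall_integral_tendsto.1 hw f)

/-- Monomials are unbounded, so weak convergence is supplemented by second moment bounds for the
monomial, uniform over the rescaled laws, the approximating Gaussians and their limits. -/
lemma tendsto_integral_prod_pow (hp0 : 0 < p) (hp1 : p < 1) (hg : GrowthRegime m K L)
    (h : ∀ n, IsPlantedModel (P n) n (K n) p (η n) (B₀ n)) {i : ℕ → Fin ℓ → ℕ}
    (hi : ∀ᶠ n in atTop, ∀ j, i n j ∈ side n) (α : Fin ℓ → ℕ) :
    Tendsto (fun n =>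
      ∫ x : EuclideanSpace ℝ (Fin ℓ), ∏ j, (x j) ^ α j
        ∂(lawRescaled P hp0.ne' h m i n : Measure (EuclideanSpace ℝ (Fin ℓ))) -
      ∫ x : EuclideanSpace ℝ (Fin ℓ), ∏ j, (x j) ^ α j
        ∂(multivariateGaussian 0 (covMatrix n (m n) p (i n))))
      atTop (𝓝 0) := by
  set r := ∑ j, α j + 1 with hr
  set c := 4 * (p⁻¹ - 1) * Real.exp (2 * (p⁻¹ - 1)) * (1 + L) with hc
  have hcont : Continuous fun x : EuclideanSpace ℝ (Fin ℓ) => ∏ j, (x j) ^ α j := by fun_prop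
  choose C hC using fun j => exists_eventually_integral_rescaled_pow_le hp0 hp1 hg h
    (i := fun n => i n j) (hi.mono fun n hn => hn j) (show 1 ≤ r by omega)
  set D := c ^ r * ∫ x, x ^ (2 * r) ∂(gaussianReal 0 1) with hD
  set B := max (1 + ∑ j, C j) (1 + ∑ _j : Fin ℓ, D) with hB
  have hcov : ∀ᶠ n in atTop, ∀ j j', |covMatrix n (m n) p (i n) j j'| ≤ c := by
    filter_upwards [eventually_gt_atTop 0, hg.m_sq_le] with n hn hmL j j'
    exact abs_covMatrix_le hp0 hp1 hn hmL (i n) j j'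
  have hgauss : ∀ T : Matrix (Fin ℓ) (Fin ℓ) ℝ, T.PosSemidef → (∀ j, |T j j| ≤ c) →
      Integrable (fun x : EuclideanSpace ℝ (Fin ℓ) => (∏ j, (x j) ^ α j) ^ 2)
        (multivariateGaussian 0 T) ∧
      ∫ x : EuclideanSpace ℝ (Fin ℓ), (∏ j, (x j) ^ α j) ^ 2 ∂(multivariateGaussian 0 T) ≤ B := by
    intro T hT hTc
    have := integral_sq_prod_pow_le (P := multivariateGaussian 0 T) measurable_id α
      (fun j => integrable_pow_multivariateGaussian hT j (2 * r))
      (fun j => integral_pow_multivariateGaussian_le hT j r (hTc j))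
    exact ⟨this.1, this.2.trans (le_max_right _ _)⟩
  have hlimS : ∀ (φ : ℕ → ℕ), Tendsto φ atTop atTop → ∀ S : Matrix (Fin ℓ) (Fin ℓ) ℝ,
      Tendsto (fun k => covMatrix (φ k) (m (φ k)) p (i (φ k))) atTop (𝓝 S) →
      S.PosSemidef ∧ ∀ j, |S j j| ≤ c := by
    intro φ hφ S hS
    refine ⟨posSemidef_of_tendsto (fun k => posSemidef_covMatrix _ _ hp0 hp1 _) hS, fun j => ?_⟩
    have h1 : Tendsto (fun k => |covMatrix (φ k) (m (φ k)) p (i (φ k)) j j|) atTop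
        (𝓝 |S j j|) := ((tendsto_pi_nhds.1 (tendsto_pi_nhds.1 hS j)) j).abs
    exact le_of_tendsto h1 ((hφ.eventually hcov).mono fun k hk => hk j j)
  have hlaw : ∀ᶠ n in atTop,
      Integrable (fun x : EuclideanSpace ℝ (Fin ℓ) => (∏ j, (x j) ^ α j) ^ 2)
        (lawRescaled P hp0.ne' h m i n : Measure (EuclideanSpace ℝ (Fin ℓ))) ∧
      ∫ x : EuclideanSpace ℝ (Fin ℓ), (∏ j, (x j) ^ α j) ^ 2
        ∂(lawRescaled P hp0.ne' h m i n : Measure (EuclideanSpace ℝ (Fin ℓ))) ≤ B := by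
    filter_upwards [eventually_all.2 hC, hg.K_le] with n hn hKn
    have hmeas := (h n).measurable_rescaledVector hp0.ne' (m n) (i n)
    have := integral_sq_prod_pow_le (P := P n) hmeas α (C := C)
      (fun j => integrable_rescaled_pow (m := m) hp0.ne' (h n) hKn (i n j) (2 * r)) hn
    have hcont2 : Continuous fun x : EuclideanSpace ℝ (Fin ℓ) => (∏ j, (x j) ^ α j) ^ 2 :=
      hcont.pow 2
    change Integrable _ ((P n).map _) ∧ ∫ x, _ ∂((P n).map _) ≤ B
    rw [integrable_map_measure hcont2.aestronglyMeasurable hmeas.aemeasurable,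
      integral_map hmeas.aemeasurable hcont2.aestronglyMeasurable]
    exact ⟨this.1, this.2.trans (le_max_left _ _)⟩
  refine tendsto_integral_sub hp0 hp1 hg h hi (fun φ hφ S hS hw => ?_) fun φ hφ S hS hw => ?_
  · obtain ⟨hS1, hS2⟩ := hlimS φ hφ S hS
    exact tendsto_integral_of_sq_bounded hw hcont (hφ.eventually hlaw) (hgauss S hS1 hS2)
  · obtain ⟨hS1, hS2⟩ := hlimS φ hφ S hS
    exact tendsto_integral_of_sq_bounded hw hcont ((hφ.eventually hcov).mono fun k hk =>
      hgauss _ (posSemidef_covMatrix _ _ hp0 hp1 _) fun j => hk j j) (hgauss S hS1 hS2)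

end Limit

/-! ### The prescribed vertices and the main theorem. -/

lemma eventually_vertexIndex_mem_side {m K : ℕ → ℕ} {L : ℝ} (hg : GrowthRegime m K L)
    {ℓ : ℕ} (ℓ₀ : ℕ) {i' : Fin ℓ → ℕ} (hi'_pos : ∀ j, 1 ≤ i' j) :
    ∀ᶠ n in atTop, ∀ j, vertexIndex ℓ₀ (K n) i' j ∈ side n := by
  refine eventually_all.2 fun j => ?_
  -- The labels `i' j` are fixed and `K = o(n)`, so even the shifted label is eventually at most
  -- `n`.
  have h1 : Tendsto (fun n : ℕ => ((i' j + K n : ℕ) : ℝ) / n) atTop (𝓝 0) := by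
    have := (tendsto_const_div_atTop_nhds_zero_nat (i' j : ℝ)).add hg.tendsto_K_div
    rw [add_zero] at this
    refine this.congr fun n => ?_
    push_cast
    ring
  filter_upwards [le_of_tendsto_div (a := fun n => i' j + K n) h1] with n hn
  have := hi'_pos j
  rw [side, Finset.mem_Icc, vertexIndex]
  split_ifs <;> constructor <;> omega

end PlantedGBS

open PlantedGBS MeasureTheory ProbabilityTheory Filter Asymptotics Topology in
theorem mainTheorem2
    (p : ℝ) (hp0 : 0 < p) (hp1 : p < 1)
    (m K : ℕ → ℕ)
    (hm_top : Tendsto m atTop atTop)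
    (hm : (fun n : ℕ => (m n : ℝ)) =O[atTop] (fun n : ℕ => √(n : ℝ)))
    (hK : (fun n : ℕ => (K n : ℝ)) =O[atTop] (fun n : ℕ => √(n : ℝ)))
    {Ω : ℕ → Type*} [∀ n, MeasurableSpace (Ω n)]
    (P : ∀ n, Measure (Ω n)) [∀ n, IsProbabilityMeasure (P n)]
    (η : ∀ n, ℕ → ℕ → Ω n → Bool) (B₀ : ∀ n, Ω n → Finset ℕ)
    (hmodel : ∀ n, IsPlantedModel (P n) n (K n) p (η n) (B₀ n))
    (ℓ ℓ₀ : ℕ) (hℓ₀ : ℓ₀ ≤ ℓ) (i' : Fin ℓ → ℕ)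
    (hi'_pos : ∀ j, 1 ≤ i' j)
    (hi'_le : ∀ᶠ n in atTop, ∀ j : Fin ℓ, (j : ℕ) < ℓ₀ → i' j ≤ K n) :
    -- all mixed moments agree asymptotically with those of the Gaussian vector
    (∀ α : Fin ℓ → ℕ,
      Tendsto (fun n : ℕ =>
        (∫ ω, ∏ j, (rescaledVector (P n) n (m n) (K n) p (η n) (B₀ n)
            (vertexIndex ℓ₀ (K n) i') ω j) ^ α j ∂(P n)) -
        ∫ x, ∏ j, (x j) ^ α j
          ∂(multivariateGaussian 0 (covMatrix n (m n) p (vertexIndex ℓ₀ (K n) i'))))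
        atTop (𝓝 0)) ∧
    -- the laws merge weakly with the Gaussian laws, whose covariance may depend on `n`
    (∀ f : BoundedContinuousFunction (EuclideanSpace ℝ (Fin ℓ)) ℝ,
      Tendsto (fun n : ℕ =>
        (∫ ω, f (rescaledVector (P n) n (m n) (K n) p (η n) (B₀ n)
            (vertexIndex ℓ₀ (K n) i') ω) ∂(P n)) -
        ∫ x, f x
          ∂(multivariateGaussian 0 (covMatrix n (m n) p (vertexIndex ℓ₀ (K n) i'))))
        atTop (𝓝 0)) ∧
    -- weak convergence to a fixed Gaussian law as soon as the covariance matrices converge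
    (∀ S : Matrix (Fin ℓ) (Fin ℓ) ℝ,
      Tendsto (fun n : ℕ => covMatrix n (m n) p (vertexIndex ℓ₀ (K n) i')) atTop (𝓝 S) →
      TendstoInDistribution
        (fun n => rescaledVector (P n) n (m n) (K n) p (η n) (B₀ n)
          (vertexIndex ℓ₀ (K n) i'))
        atTop id P (multivariateGaussian 0 S)) := by
  obtain ⟨L, hg⟩ := exists_growthRegime hm_top hm hK
  have hi := eventually_vertexIndex_mem_side hg ℓ₀ hi'_pos
  have hmeas := fun n => (hmodel n).measurable_rescaledVector hp0.ne' (m n)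
    (vertexIndex ℓ₀ (K n) i')
  refine ⟨fun α => ?_, fun f => ?_, fun S hS => ?_⟩
  · have hcont : Continuous fun x : EuclideanSpace ℝ (Fin ℓ) => ∏ j, (x j) ^ α j := by fun_prop
    refine (tendsto_integral_prod_pow hp0 hp1 hg hmodel hi α).congr fun n => ?_
    exact congrArg (· - _)
      (integral_map (hmeas n).aemeasurable hcont.measurable.aestronglyMeasurable)
  · refine (tendsto_integral_boundedContinuous hp0 hp1 hg hmodel hi f).congr fun n => ?_
    exact congrArg (· - _)
      (integral_map (hmeas n).aemeasurable f.continuous.measurable.aestronglyMeasurable)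
  · refine ⟨fun n => (hmeas n).aemeasurable, by fun_prop, ?_⟩
    -- The covariances converge along the whole sequence, so the identity is taken as subsequence.
    have h1 := tendsto_lawRescaled hp0 hp1 hg hmodel hi tendsto_id hS
    have h2 : lawGaussian S = ⟨(multivariateGaussian 0 S).map id,
        Measure.isProbabilityMeasure_map aemeasurable_id⟩ :=
      Subtype.ext Measure.map_id.symm
    rw [h2] at h1
    exact h1
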